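/- Let $n\ge 3$, let $\sigma$ be the surface measure on the unit sphere $S^{n-1}\subset\mathbb R^n$, $\omega_n=\sigma(S^{n-1})$, $m=\sigma/\omega_n$, and let $\bar\rho$ denote the uniform state, i.e. the probability measure $m$. Let $W:[-1,1]\to\mathbb R$ be continuous, defining the kernel $W(x,y)=W(\langle x,y\rangle)$. For $\gamma>0$ and a Borel probability measure $\mu$ on $S^{n-1}$ put $$\mathcal F_\gamma(\mu)=\gamma^{-1}\mathcal E(\mu)+\tfrac12\iint W(\langle x,y\rangle)\,d\mu(x)\,d\mu(y),$$ where $\mathcal E(\mu)=\int\rho\log\rho\,dm$ if $\mu$ has a positive density $\rho$ with respect to $m$, and $\mathcal E(\mu)=+\infty$ otherwise. Minimizers are global minimizers over all Borel probability measures. With $C_k$ the Gegenbauer polynomials of index $\frac{n-2}{2}$, set $$\hat W_k=\frac{\int_{-1}^1W(t)\frac{C_k(t)}{C_k(1)}(1-t^2)^{\frac{n-3}2}dt}{\int_{-1}^1(1-t^2)^{\frac{n-3}2}dt}.$$ Fix a pole $e\in S^{n-1}$ and let $Y_{l,0}$ be the zonal harmonic $x\mapsto C_l(\langle e,x\rangle)$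 normalized in $L^2(m)$. Let $\gamma_\#=-1/\min_{k\ge1}\hat W_k$. A number $\gamma_c>0$ is a transition point if (i) for all $\gamma\in(0,\gamma_c)$ the uniform state is the unique minimizer of $\mathcal F_\gamma$; (ii) it is a minimizer of $\mathcal F_{\gamma_c}$; (iii) for every $\gamma>\gamma_c$ there is a minimizer of $\mathcal F_\gamma$ different from $\bar\rho$, with a positive density. It is continuous if $\bar\rho$ is the unique minimizer of $\mathcal F_{\gamma_c}$ and every family $(\rho_\gamma)_{\gamma>\gamma_c}$ of absolutely continuous minimizers of $\mathcal F_\gamma$ satisfies $\|\rho_\gamma-\bar\rho\|_{L^1}\to0$ as $\gamma\downarrow\gamma_c$; otherwise it is discontinuous. Let $\delta\ge0$. The kernel satisfies the relaxed resonance condition with bandwidth $\delta$, with witness $u$, if $\hat W_k<0$ for some $k\ge1$, and $u=\sum_l c_lY_{l,0}$ is a finite linear combination over modes $l\ge1$ with $\hat W_l\le-(1-\delta)/\gamma_\#$ such that $$\|u\|_\infty\le1,\qquad U_3:=\int u^3\,d\sigma\ne0,\qquad \delta<\min\Bigl(\tfrac14,\tfrac{U_3^2}{49\,\omega_n^2}\Bigr).$$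 **Theorem.** (a) If $W$ satisfies the relaxed resonance condition with bandwidth $\delta$ (for some witness), then $\mathcal F_\gamma$ has a discontinuous transition point $\gamma_c\in(0,\gamma_\#)$. (b) If $u$ is a witness of the condition and $\xi=\operatorname{sign}U_3$, then $\rho_\#=\bar\rho(1+\varepsilon\xi u)$ is a probability measure with everywhere positive density and $\mathcal F_{\gamma_\#}(\rho_\#)<\mathcal F_{\gamma_\#}(\bar\rho)$, where $\varepsilon=\sqrt\delta$ if $\delta>0$, and $\varepsilon$ is any number with $0<\varepsilon<\min\bigl(\tfrac12,\tfrac{|U_3|}{4\omega_n}\bigr)$ if $\delta=0$. -/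

import Mathlib

open MeasureTheory Filter Topology Set

namespace SphereMV

/-- The unit sphere `S^{n-1}` of `ℝ^n`. -/
abbrev Sphere (n : ℕ) : Type := Metric.sphere (0 : EuclideanSpace ℝ (Fin n)) 1

/-- The surface measure `σ` on `S^{n-1}` induced by Lebesgue measure. -/
noncomputable def surf (n : ℕ) : Measure (Sphere n) :=
  (volume : Measure (EuclideanSpace ℝ (Fin n))).toSphere

/-- The total surface `ω_n = σ(S^{n-1})`. -/
noncomputable def surfTotal (n : ℕ) : ℝ := (surf n).real univ

/-- The normalized surface measure `m = σ / ω_n`, that is, the uniform state. -/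
noncomputable def unif (n : ℕ) : Measure (Sphere n) := (surf n univ)⁻¹ • surf n

/-- Gegenbauer polynomials `C_k^a(t)`, by their three term recurrence
`(k+2) C_{k+2} = 2 (a+k+1) t C_{k+1} - (2a+k) C_k`. -/
noncomputable def gegenbauer (a : ℝ) : ℕ → ℝ → ℝ
  | 0, _ => 1
  | 1, t => 2 * a * t
  | k + 2, t =>
      (2 * (a + k + 1) * t * gegenbauer a (k + 1) t - (2 * a + k) * gegenbauer a k t) / (k + 2)

/-- The index `(n-2)/2` of the Gegenbauer polynomials that belong to `S^{n-1}`. -/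
noncomputable def gegIndex (n : ℕ) : ℝ := ((n : ℝ) - 2) / 2

/-- The spherical harmonics decomposition of a profile `W : [-1,1] → ℝ`:
`Ŵ_k = c ∫_{-1}^1 W(t) C_k(t) / C_k(1) (1-t^2)^{(n-3)/2} dt`
with `1 / c = ∫_{-1}^1 (1-t^2)^{(n-3)/2} dt`. -/
noncomputable def sphCoeff (n : ℕ) (W : ℝ → ℝ) (k : ℕ) : ℝ :=
  (∫ t in (-1 : ℝ)..1, (1 - t ^ 2) ^ (((n : ℝ) - 3) / 2))⁻¹ *
    ∫ t in (-1 : ℝ)..1,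
      W t * (gegenbauer (gegIndex n) k t / gegenbauer (gegIndex n) k 1) *
        (1 - t ^ 2) ^ (((n : ℝ) - 3) / 2)

/-- The (unnormalized) zonal harmonic `x ↦ C_l(⟨e, x⟩)` with pole `e`. -/
noncomputable def zonalRaw {n : ℕ} (e : Sphere n) (l : ℕ) (x : Sphere n) : ℝ :=
  gegenbauer (gegIndex n) l
    (inner ℝ (e : EuclideanSpace ℝ (Fin n)) (x : EuclideanSpace ℝ (Fin n)))

/-- The zonal harmonic `Y_{l,0}` with pole `e`, of norm one in `L²(m)`. -/
noncomputable def zonal {n : ℕ} (e : Sphere n) (l : ℕ) (x : Sphere n) : ℝ :=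
  (Real.sqrt (∫ y, zonalRaw e l y ^ 2 ∂(unif n)))⁻¹ * zonalRaw e l x

/-- The finite linear combination `∑_l c_l Y_{l,0}`. -/
noncomputable def zonalComb {n : ℕ} (e : Sphere n) (c : ℕ →₀ ℝ) (x : Sphere n) : ℝ :=
  c.sum fun l a => a * zonal e l x

/-- The relative entropy with respect to `m`: `∫ ρ log ρ dm` if `μ` has a positive density `ρ`,
with the value `+∞` if that integral diverges or if there is no positive density. -/
noncomputable def entropy {n : ℕ} (μ : Measure (Sphere n)) : EReal :=
  open Classical in
  if μ ≪ unif n ∧ (∀ᵐ x ∂(unif n), 0 < μ.rnDeriv (unif n) x) ∧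
      Integrable (fun x => (μ.rnDeriv (unif n) x).toReal *
        Real.log (μ.rnDeriv (unif n) x).toReal) (unif n)
  then ((∫ x, (μ.rnDeriv (unif n) x).toReal *
        Real.log (μ.rnDeriv (unif n) x).toReal ∂(unif n) : ℝ) : EReal)
  else ⊤

/-- The interaction energy `½ ∫∫ W(⟨x,y⟩) dμ(x) dμ(y)`. -/
noncomputable def interaction {n : ℕ} (W : ℝ → ℝ) (μ : Measure (Sphere n)) : ℝ :=
  (1 / 2) * ∫ p : Sphere n × Sphere n,
    W (inner ℝ (p.1 : EuclideanSpace ℝ (Fin n)) (p.2 : EuclideanSpace ℝ (Fin n))) ∂(μ.prod μ)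

/-- The free energy `γ⁻¹ · entropy + interaction` (used for `γ > 0`). -/
noncomputable def freeEnergy {n : ℕ} (W : ℝ → ℝ) (γ : ℝ) (μ : Measure (Sphere n)) : EReal :=
  ((γ⁻¹ : ℝ) : EReal) * entropy μ + (interaction W μ : EReal)

/-- `μ` is a global minimizer of the free energy among all Borel probability measures. -/
def IsMinimizer {n : ℕ} (W : ℝ → ℝ) (γ : ℝ) (μ : Measure (Sphere n)) : Prop :=
  IsProbabilityMeasure μ ∧
    ∀ ν : Measure (Sphere n), IsProbabilityMeasure ν → freeEnergy W γ μ ≤ freeEnergy W γ ν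

/-- The uniform state is the one and only global minimizer. -/
def UniformIsUniqueMinimizer (n : ℕ) (W : ℝ → ℝ) (γ : ℝ) : Prop :=
  IsMinimizer W γ (unif n) ∧ ∀ μ : Measure (Sphere n), IsMinimizer W γ μ → μ = unif n

/-- Transition points of the free energy. -/
structure IsTransitionPoint (n : ℕ) (W : ℝ → ℝ) (γc : ℝ) : Prop where
  pos : 0 < γc
  unique_below : ∀ γ : ℝ, 0 < γ → γ < γc → UniformIsUniqueMinimizer n W γ
  minimizer_at : IsMinimizer W γc (unif n)
  nonuniform_above : ∀ γ : ℝ, γc < γ → ∃ μ : Measure (Sphere n),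
    μ ≪ unif n ∧ (∀ᵐ x ∂(unif n), 0 < μ.rnDeriv (unif n) x) ∧ μ ≠ unif n ∧ IsMinimizer W γ μ

/-- The `L¹` distance between the density of `μ` and that of the uniform state. -/
noncomputable def l1DistUnif {n : ℕ} (μ : Measure (Sphere n)) : ℝ :=
  ∫ x, |(μ.rnDeriv (unif n) x).toReal - 1| ∂(unif n)

/-- Continuous transition points. -/
def IsContinuousTransition (n : ℕ) (W : ℝ → ℝ) (γc : ℝ) : Prop :=
  IsTransitionPoint n W γc ∧ UniformIsUniqueMinimizer n W γc ∧
    ∀ μ : ℝ → Measure (Sphere n),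
      (∀ γ : ℝ, γc < γ → μ γ ≪ unif n ∧ IsMinimizer W γ (μ γ)) →
        Tendsto (fun γ => l1DistUnif (μ γ)) (𝓝[>] γc) (𝓝 0)

/-- Discontinuous transition points: the transition points that are not continuous. -/
def IsDiscontinuousTransition (n : ℕ) (W : ℝ → ℝ) (γc : ℝ) : Prop :=
  IsTransitionPoint n W γc ∧ ¬ IsContinuousTransition n W γc

/-- The point of linear stability `γ_# = -1 / min_{k ≥ 1} Ŵ_k`. -/
noncomputable def gammaSharp (n : ℕ) (W : ℝ → ℝ) : ℝ := -1 / ⨅ k : ℕ+, sphCoeff n W k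

/-- The `δ`-resonating modes `{k ≥ 1 : Ŵ_k ≤ -(1-δ)/γ_#}`. -/
def resonatingModes (n : ℕ) (W : ℝ → ℝ) (δ : ℝ) : Set ℕ :=
  {k | 1 ≤ k ∧ sphCoeff n W k ≤ -(1 - δ) / gammaSharp n W}

/-- `U_3 = ∫ u³ dσ` for `u = ∑_l c_l Y_{l,0}`. -/
noncomputable def cubeIntegral {n : ℕ} (e : Sphere n) (c : ℕ →₀ ℝ) : ℝ :=
  ∫ x, zonalComb e c x ^ 3 ∂(surf n)

/-- `W` satisfies the relaxed resonance condition with bandwidth `δ`, the combination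
`u = ∑_l c_l Y_{l,0}` being a witness. -/
structure IsResonantWith {n : ℕ} (e : Sphere n) (W : ℝ → ℝ) (δ : ℝ) (c : ℕ →₀ ℝ) : Prop where
  unstable : ∃ k : ℕ, 1 ≤ k ∧ sphCoeff n W k < 0
  modes : (c.support : Set ℕ) ⊆ resonatingModes n W δ
  bounded : ∀ x : Sphere n, |zonalComb e c x| ≤ 1
  cube_ne_zero : cubeIntegral e c ≠ 0
  bandwidth : δ < min (1 / 4) (cubeIntegral e c ^ 2 / (49 * surfTotal n ^ 2))

/-- The relaxed resonance condition with bandwidth `δ`. -/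
def RelaxedResonance {n : ℕ} (e : Sphere n) (W : ℝ → ℝ) (δ : ℝ) : Prop :=
  ∃ c : ℕ →₀ ℝ, IsResonantWith e W δ c

/-- The function `1 + ε ξ u` with `ξ = sign ∫ u³ dσ`. -/
noncomputable def competitorDensity {n : ℕ} (e : Sphere n) (c : ℕ →₀ ℝ) (ε : ℝ)
    (x : Sphere n) : ℝ :=
  1 + ε * Real.sign (cubeIntegral e c) * zonalComb e c x

/-- The state `ρ̄ (1 + ε ξ u)`. -/
noncomputable def competitor {n : ℕ} (e : Sphere n) (c : ℕ →₀ ℝ) (ε : ℝ) : Measure (Sphere n) :=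
  (unif n).withDensity fun x => ENNReal.ofReal (competitorDensity e c ε x)

end SphereMV

open SphereMV

/-! The potential of the uniform state is constant. So for a density ρ = 1 + v with ∫ v dm = 0, γ
times the excess of the free energy over the uniform state is `densEntropy` + γ · `excess`: an
affine function of γ with nonnegative constant term. At γ_# the modes in u are eigenfunctions with
eigenvalues at most -(1-δ)/γ_#. Along v = εξu the quadratic parts of entropy and interaction
therefore cancel up to ε²δ/2 · ∫ u² dm. The entropy also has the cubic term -ε³ξ/6 · ∫ u³ dm, made
negative by the choice of ξ, and a remainder of at most 2/3 · ε⁴ ∫ u⁴ dm. As |u| ≤ 1, the sum is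
negative once ε(δ/2 + 2ε²/3) < |U_3| ε² / (6 ω_n). For ε = √δ this reads 49δ < U_3²/ω_n², for δ = 0
it reads ε < |U_3|/(4ω_n). This is (b), carried by `resonance_parameter` and
`densEnergy_competitorDensity_lt`.

For (a), consider the γ at which some density beats the uniform state (`unstableSet`). Affinity in γ
makes this set upward closed, a strict inequality survives a small decrease of γ, so there is no
least element, and the Csiszár-Kullback inequality keeps the set away from 0. It contains γ_#, hence
its infimum γ_c lies strictly below γ_#; it is a transition point because minimizers exist
(`exists_minimizer`). The transition is not continuous: a minimizer is the Gibbs density of its own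
potential (`ae_eq_gibbs_of_minimizer`), so L¹ closeness to 1 becomes uniform closeness, and below
γ_# the second variation at the uniform state is positive, which forces such a minimizer to be
uniform (`minimizer_eq_unif_of_near`).

The spectral input is the Funk-Hecke formula (`funk_hecke`) and the lower bound `le_integral_kernel`
of the quadratic form. Neither uses rotations or completeness of the spherical harmonics: Gaussian
integration by parts gives the moments of linear functionals on the sphere, these give orthogonality
of Gegenbauer polynomials, and polynomial kernels approximate continuous ones. -/

namespace SphereMV

set_option linter.unusedSectionVars false

/-! ### Moments on the unit sphere from Gaussian integrals -/

/-- The radial Gaussian integral `∫_0^∞ r^k exp (-r²) dr`. -/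
noncomputable def radialGaussian (k : ℕ) : ℝ := ∫ r in Ioi (0 : ℝ), r ^ k * Real.exp (-r ^ 2)

theorem radialGaussian_eq (k : ℕ) :
    radialGaussian k = (1 / 2) * Real.Gamma ((k + 1) / 2) := by
  have h := integral_rpow_mul_exp_neg_rpow (p := 2) (q := k) (by norm_num)
    (by have : (0 : ℝ) ≤ k := k.cast_nonneg
        linarith)
  rw [← h, radialGaussian]
  refine setIntegral_congr_fun measurableSet_Ioi fun r _ => ?_
  simp [Real.rpow_natCast]

theorem radialGaussian_add_two (k : ℕ) :
    radialGaussian (k + 2) = (k + 1) / 2 * radialGaussian k := by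
  have hk : ((k : ℝ) + 1) / 2 ≠ 0 := by positivity
  rw [radialGaussian_eq, radialGaussian_eq]
  have : (((k + 2 : ℕ) : ℝ) + 1) / 2 = ((k : ℝ) + 1) / 2 + 1 := by push_cast; ring
  rw [this, Real.Gamma_add_one hk]
  ring

theorem radialGaussian_pos (k : ℕ) : 0 < radialGaussian k := by
  rw [radialGaussian_eq]
  have := Real.Gamma_pos_of_pos (show (0 : ℝ) < ((k : ℝ) + 1) / 2 by positivity)
  positivity

section Polar

variable {E : Type*} [NormedAddCommGroup E] [InnerProductSpace ℝ E] [FiniteDimensional ℝ E]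
  [MeasurableSpace E] [BorelSpace E]

/-- Polar coordinates y = rθ: homogeneity splits the integrand into a function of θ times a function
of r. No integrability is needed, since the product formula for Bochner integrals holds
unconditionally. -/
theorem integral_homogeneous_mul_radial [Nontrivial E] (F : E → ℝ) (d : ℕ)
    (hF : ∀ r : ℝ, 0 < r → ∀ y, F (r • y) = r ^ d * F y) (ψ : ℝ → ℝ) :
    ∫ y, F y * ψ ‖y‖ =
      (∫ y : Metric.sphere (0 : E) 1, F y ∂(volume : Measure E).toSphere) *
        ∫ r in Ioi (0 : ℝ), r ^ (Module.finrank ℝ E - 1 + d) * ψ r := by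
  calc ∫ y, F y * ψ ‖y‖
      = ∫ y : ({(0 : E)}ᶜ : Set E), F y.1 * ψ ‖y.1‖ ∂((volume : Measure E).comap (↑)) := by
        rw [integral_subtype_comap (measurableSet_singleton _).compl fun y : E => F y * ψ ‖y‖,
          restrict_compl_singleton]
    _ = ∫ p : Metric.sphere (0 : E) 1 × Ioi (0 : ℝ), F p.1 * (p.2.1 ^ d * ψ p.2.1)
          ∂((volume : Measure E).toSphere.prod
            (Measure.volumeIoiPow (Module.finrank ℝ E - 1))) := by
        rw [← (Measure.measurePreserving_homeomorphUnitSphereProd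
          (volume : Measure E)).integral_comp (Homeomorph.measurableEmbedding _)]
        refine integral_congr_ae (.of_forall fun y => ?_)
        have hy : 0 < ‖y.1‖ := norm_pos_iff.2 y.2
        have h1 : y.1 = ‖y.1‖ • (‖y.1‖⁻¹ • y.1) := by
          rw [smul_smul, mul_inv_cancel₀ hy.ne', one_smul]
        simp only [homeomorphUnitSphereProd_apply_snd_coe, homeomorphUnitSphereProd_apply_fst_coe]
        conv_lhs => rw [h1, hF _ hy]
        rw [← h1]
        ring
    _ = _ := by
        rw [integral_prod_mul (fun y : Metric.sphere (0 : E) 1 => F y)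
          (fun r : Ioi (0 : ℝ) => r.1 ^ d * ψ r.1)]
        congr 1
        simp only [Measure.volumeIoiPow, ENNReal.ofReal]
        rw [integral_withDensity_eq_integral_smul,
          integral_subtype_comap measurableSet_Ioi fun a => Real.toNNReal
            (a ^ (Module.finrank ℝ E - 1)) • (a ^ d * ψ a),
          setIntegral_congr_fun measurableSet_Ioi fun r hr => ?_]
        · rw [NNReal.smul_def, Real.coe_toNNReal _ (pow_nonneg (mem_Ioi.1 hr).le _), smul_eq_mul,
            pow_add, mul_assoc]
        · exact (measurable_subtype_coe.pow_const _).real_toNNReal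

/-- Half of the Gaussian exponent absorbs the polynomial growth, the other half is integrable. -/
theorem integrable_mul_exp_neg_norm_sq (F : E → ℝ) (hF : Continuous F) (d : ℕ)
    (hd : ∀ y, |F y| ≤ ‖y‖ ^ d) :
    Integrable (fun y => F y * Real.exp (-‖y‖ ^ 2)) := by
  have hg : Integrable fun y : E => Real.exp (-‖y‖ ^ 2 / 2) := by
    have h := (GaussianFourier.integrable_cexp_neg_mul_sq_norm_add (V := E) (b := (1 / 2 : ℂ))
      (by norm_num) 0 0).norm
    refine h.congr (.of_forall fun y => ?_)
    simp only [Complex.norm_exp]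
    congr 1
    have : (-(1 / 2 : ℂ) * (‖y‖ : ℂ) ^ 2 + 0 * ((inner ℝ (0 : E) y : ℝ) : ℂ)) =
      ((-‖y‖ ^ 2 / 2 : ℝ) : ℂ) := by push_cast; ring
    rw [this, Complex.ofReal_re]
  have hb : ∃ C : ℝ, ∀ t : ℝ, 0 ≤ t → t ^ d * Real.exp (-t ^ 2 / 2) ≤ C := by
    refine ⟨d.factorial * Real.exp 1, fun t ht => ?_⟩
    have h1 : t ^ d ≤ d.factorial * Real.exp t := by
      have := Real.pow_div_factorial_le_exp t ht d
      rwa [div_le_iff₀ (by positivity), mul_comm] at this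
    calc t ^ d * Real.exp (-t ^ 2 / 2) ≤ d.factorial * Real.exp t * Real.exp (-t ^ 2 / 2) := by
          gcongr
      _ = d.factorial * Real.exp (t + -t ^ 2 / 2) := by rw [mul_assoc, ← Real.exp_add]
      _ ≤ _ := by
          gcongr
          nlinarith [sq_nonneg (t - 1)]
  obtain ⟨C, hC⟩ := hb
  refine (hg.const_mul C).mono' (by fun_prop) (.of_forall fun y => ?_)
  have h2 : Real.exp (-‖y‖ ^ 2) = Real.exp (-‖y‖ ^ 2 / 2) * Real.exp (-‖y‖ ^ 2 / 2) := by
    rw [← Real.exp_add]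
    congr 1
    ring
  rw [norm_mul, Real.norm_eq_abs, Real.norm_eq_abs, Real.abs_exp, h2, ← mul_assoc]
  gcongr
  exact (mul_le_mul_of_nonneg_right (hd y) (Real.exp_pos _).le).trans (hC _ (norm_nonneg _))

/-- Gaussian integration by parts in the direction `x` for `⟪x, y⟫ ^ a * ⟪z, y⟫ ^ b`. -/
theorem gaussian_integration_by_parts (x z : E) (hx : ‖x‖ = 1) (hz : ‖z‖ = 1) (a b : ℕ) :
    2 * ∫ y : E, inner ℝ x y ^ (a + 1) * inner ℝ z y ^ b * Real.exp (-‖y‖ ^ 2) =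
      a * (∫ y : E, inner ℝ x y ^ (a - 1) * inner ℝ z y ^ b * Real.exp (-‖y‖ ^ 2)) +
        b * inner ℝ x z *
          ∫ y : E, inner ℝ x y ^ a * inner ℝ z y ^ (b - 1) * Real.exp (-‖y‖ ^ 2) := by
  have hbound : ∀ (i j : ℕ) (y : E), |inner ℝ x y ^ i * inner ℝ z y ^ j| ≤ ‖y‖ ^ (i + j) := by
    intro i j y
    have h1 := abs_real_inner_le_norm x y
    have h2 := abs_real_inner_le_norm z y
    rw [hx, one_mul] at h1
    rw [hz, one_mul] at h2
    rw [abs_mul, abs_pow, abs_pow, pow_add]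
    gcongr
  have hint : ∀ i j : ℕ, Integrable fun y : E =>
      inner ℝ x y ^ i * inner ℝ z y ^ j * Real.exp (-‖y‖ ^ 2) := fun i j =>
    integrable_mul_exp_neg_norm_sq _ (by fun_prop) (i + j) (hbound i j)
  have hline : ∀ w y : E, HasDerivAt (fun t : ℝ => inner ℝ w (y + t • x)) (inner ℝ w x) 0 := by
    intro w y
    have : (fun t : ℝ => inner ℝ w (y + t • x)) = fun t : ℝ => inner ℝ w y + t * inner ℝ w x := by
      ext t
      rw [inner_add_right, inner_smul_right]
    rw [this]
    simpa using ((hasDerivAt_id (0 : ℝ)).mul_const (inner ℝ w x)).const_add (inner ℝ w y)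
  -- For a = 0 or b = 0 the truncated exponents `a - 1`, `b - 1` come with a zero factor.
  set f' : E → ℝ := fun y => a * inner ℝ x y ^ (a - 1) * inner ℝ z y ^ b +
    b * inner ℝ x z * inner ℝ x y ^ a * inner ℝ z y ^ (b - 1) with hf'
  have hf : ∀ y : E, HasLineDerivAt ℝ (fun y => inner ℝ x y ^ a * inner ℝ z y ^ b) (f' y) y x := by
    intro y
    have h := ((hline x y).pow a).mul ((hline z y).pow b)
    unfold HasLineDerivAt
    refine h.congr_deriv ?_
    simp only [zero_smul, add_zero, real_inner_self_eq_norm_sq, hx, hf', real_inner_comm x z,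
      Pi.pow_apply]
    ring
  have hg : ∀ y : E, HasLineDerivAt ℝ (fun y : E => Real.exp (-‖y‖ ^ 2))
      (-2 * inner ℝ x y * Real.exp (-‖y‖ ^ 2)) y x := by
    intro y
    have h0 : HasDerivAt (fun t : ℝ => -‖y + t • x‖ ^ 2) (-2 * inner ℝ x y) 0 := by
      have : (fun t : ℝ => -‖y + t • x‖ ^ 2) =
          fun t : ℝ => -(‖y‖ ^ 2 + t * (2 * inner ℝ x y) + t ^ 2) := by
        ext t
        rw [norm_add_sq_real, inner_smul_right, norm_smul, hx, real_inner_comm, Real.norm_eq_abs,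
          mul_one, sq_abs]
        ring
      rw [this]
      have := ((((hasDerivAt_id (0 : ℝ)).mul_const (2 * inner ℝ x y)).const_add (‖y‖ ^ 2)).add
        ((hasDerivAt_id (0 : ℝ)).pow 2)).neg
      refine this.congr_deriv ?_
      simp
    have := h0.exp
    unfold HasLineDerivAt
    refine this.congr_deriv ?_
    simp only [zero_smul, add_zero]
    ring
  have key := integral_bilinear_hasLineDerivAt_right_eq_neg_left_of_integrable (μ := volume)
    (f := fun y : E => inner ℝ x y ^ a * inner ℝ z y ^ b) (f' := f')
    (g := fun y : E => Real.exp (-‖y‖ ^ 2))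
    (g' := fun y : E => -2 * inner ℝ x y * Real.exp (-‖y‖ ^ 2)) (v := x)
    (B := ContinuousLinearMap.mul ℝ ℝ) ?_ ?_ ?_ (fun y _ => hf y) (fun y _ => hg y)
  · simp only [ContinuousLinearMap.mul_apply'] at key
    have e1 : ∫ y : E, inner ℝ x y ^ a * inner ℝ z y ^ b *
        (-2 * inner ℝ x y * Real.exp (-‖y‖ ^ 2)) =
        -2 * ∫ y : E, inner ℝ x y ^ (a + 1) * inner ℝ z y ^ b * Real.exp (-‖y‖ ^ 2) := by
      rw [← integral_const_mul]
      congr 1 with y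
      ring
    have e2 : ∫ y : E, f' y * Real.exp (-‖y‖ ^ 2) =
        a * (∫ y : E, inner ℝ x y ^ (a - 1) * inner ℝ z y ^ b * Real.exp (-‖y‖ ^ 2)) +
        b * inner ℝ x z *
          ∫ y : E, inner ℝ x y ^ a * inner ℝ z y ^ (b - 1) * Real.exp (-‖y‖ ^ 2) := by
      rw [← integral_const_mul, ← integral_const_mul,
        ← integral_add ((hint _ _).const_mul _) ((hint _ _).const_mul _)]
      congr 1 with y
      simp only [hf']
      ring
    rw [e1, e2] at key
    linarith
  · refine (((hint (a - 1) b).const_mul a).add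
      ((hint a (b - 1)).const_mul (b * inner ℝ x z))).congr (.of_forall fun y => ?_)
    simp only [hf', Pi.add_apply, ContinuousLinearMap.mul_apply']
    ring
  · refine ((hint (a + 1) b).const_mul (-2)).congr (.of_forall fun y => ?_)
    simp only [ContinuousLinearMap.mul_apply']
    ring
  · exact hint a b

theorem integral_inner_pow_mul_gaussian [Nontrivial E] (x z : E) (a b : ℕ) :
    ∫ y : E, inner ℝ x y ^ a * inner ℝ z y ^ b * Real.exp (-‖y‖ ^ 2) =
      (∫ y : Metric.sphere (0 : E) 1, inner ℝ x (y : E) ^ a * inner ℝ z (y : E) ^ b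
        ∂(volume : Measure E).toSphere) *
        radialGaussian (Module.finrank ℝ E - 1 + (a + b)) := by
  refine integral_homogeneous_mul_radial (fun y : E => inner ℝ x y ^ a * inner ℝ z y ^ b) (a + b)
    (fun r _ y => ?_) fun r => Real.exp (-r ^ 2)
  simp only [inner_smul_right]
  ring

/-- The recurrence for the moments of two linear functionals on the unit sphere. -/
theorem toSphere_moment_recurrence [Nontrivial E] (x z : E) (hx : ‖x‖ = 1) (hz : ‖z‖ = 1)
    (a b : ℕ) :
    ((a : ℝ) + b + Module.finrank ℝ E - 1) *
      ∫ y : Metric.sphere (0 : E) 1, inner ℝ x (y : E) ^ (a + 1) * inner ℝ z (y : E) ^ b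
        ∂(volume : Measure E).toSphere =
      a * (∫ y : Metric.sphere (0 : E) 1, inner ℝ x (y : E) ^ (a - 1) * inner ℝ z (y : E) ^ b
        ∂(volume : Measure E).toSphere) +
      b * inner ℝ x z *
        ∫ y : Metric.sphere (0 : E) 1, inner ℝ x (y : E) ^ a * inner ℝ z (y : E) ^ (b - 1)
          ∂(volume : Measure E).toSphere := by
  have hn : 1 ≤ Module.finrank ℝ E := Module.finrank_pos
  obtain ⟨N, hN⟩ := Nat.exists_eq_add_of_le hn
  have key := gaussian_integration_by_parts x z hx hz a b
  simp only [integral_inner_pow_mul_gaussian, hN, Nat.add_sub_cancel_left] at key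
  rw [hN]
  push_cast
  -- The radial degrees on the two sides differ by two, so one radial integral cancels. For a = b =
  -- 0 the lower degree would be negative, but then the right side vanishes.
  rcases Nat.eq_zero_or_pos (a + b) with h0 | h0
  · obtain ⟨rfl, rfl⟩ : a = 0 ∧ b = 0 := by omega
    have hR := radialGaussian_pos (N + (0 + 1 + 0))
    simp only [CharP.cast_eq_zero, zero_mul, add_zero, zero_add, mul_eq_zero] at key ⊢
    rcases key with h | h | h
    · norm_num at h
    · exact Or.inr h
    · exact absurd h (by simpa using hR.ne')
  · obtain ⟨d, hd⟩ := Nat.exists_eq_add_of_le h0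
    have hR := radialGaussian_pos (N + d)
    have e1 : radialGaussian (N + (a + 1 + b)) = ((N + d : ℕ) + 1) / 2 * radialGaussian (N + d) := by
      rw [← radialGaussian_add_two]
      congr 1
      omega
    have hab : (a : ℝ) + b = 1 + d := by exact_mod_cast hd
    have e2 : (a : ℝ) * radialGaussian (N + (a - 1 + b)) = a * radialGaussian (N + d) := by
      rcases Nat.eq_zero_or_pos a with rfl | ha
      · simp
      · congr 3
        omega
    have e3 : (b : ℝ) * radialGaussian (N + (a + (b - 1))) = b * radialGaussian (N + d) := by
      rcases Nat.eq_zero_or_pos b with rfl | ha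
      · simp
      · congr 3
        omega
    rw [e1] at key
    apply mul_right_cancel₀ hR.ne'
    push_cast at key
    rw [hab]
    linear_combination key + (∫ y : Metric.sphere (0 : E) 1, inner ℝ x (y : E) ^ (a - 1) *
      inner ℝ z (y : E) ^ b ∂(volume : Measure E).toSphere) * e2 + inner ℝ x z *
        (∫ y : Metric.sphere (0 : E) 1, inner ℝ x (y : E) ^ a * inner ℝ z (y : E) ^ (b - 1)
          ∂(volume : Measure E).toSphere) * e3

end Polar

/-! ### The normalized measure and its moments -/

section Unif

/-- The inner product of two points of the sphere. -/
noncomputable def sdot {n : ℕ} (x y : Sphere n) : ℝ :=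
  inner ℝ (x : EuclideanSpace ℝ (Fin n)) (y : EuclideanSpace ℝ (Fin n))

variable {n : ℕ}

theorem sdot_comm (x y : Sphere n) : sdot x y = sdot y x := real_inner_comm _ _

theorem sphere_norm (x : Sphere n) : ‖(x : EuclideanSpace ℝ (Fin n))‖ = 1 := by
  simp

@[simp]
theorem sdot_self (x : Sphere n) : sdot x x = 1 := by
  rw [sdot, real_inner_self_eq_norm_sq, sphere_norm]
  norm_num

theorem sdot_mem (x y : Sphere n) : sdot x y ∈ Icc (-1 : ℝ) 1 := by
  have := abs_real_inner_le_norm (x : EuclideanSpace ℝ (Fin n)) (y : EuclideanSpace ℝ (Fin n))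
  rw [sphere_norm, sphere_norm, mul_one] at this
  exact abs_le.1 this

theorem continuous_sdot : Continuous fun p : Sphere n × Sphere n => sdot p.1 p.2 := by
  unfold sdot
  fun_prop

@[fun_prop]
theorem continuous_sdot_comp {X : Type*} [TopologicalSpace X] {f g : X → Sphere n}
    (hf : Continuous f) (hg : Continuous g) : Continuous fun x => sdot (f x) (g x) :=
  continuous_sdot.comp (hf.prodMk hg)

theorem continuous_comp_sdot {X : Type*} [TopologicalSpace X] {W : ℝ → ℝ}
    (hW : ContinuousOn W (Icc (-1) 1)) {f g : X → Sphere n}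
    (hf : Continuous f) (hg : Continuous g) : Continuous fun x => W (sdot (f x) (g x)) :=
  hW.comp_continuous (continuous_sdot_comp hf hg) fun _ => sdot_mem _ _

theorem finrank_eq : Module.finrank ℝ (EuclideanSpace ℝ (Fin n)) = n := by simp

theorem integral_unif (f : Sphere n → ℝ) :
    ∫ x, f x ∂(unif n) = (surfTotal n)⁻¹ * ∫ x, f x ∂(surf n) := by
  rw [unif, integral_smul_measure, ENNReal.toReal_inv]
  rfl

theorem continuous_eval_sdot (p : Polynomial ℝ) (x : Sphere n) :
    Continuous fun y => p.eval (sdot x y) := by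
  fun_prop

variable [Fact (3 ≤ n)]

instance : Nontrivial (EuclideanSpace ℝ (Fin n)) := by
  have h : 3 ≤ n := Fact.out
  apply Module.nontrivial_of_finrank_pos (R := ℝ)
  rw [finrank_eq]
  omega

instance : IsFiniteMeasure (surf n) := by
  unfold surf
  infer_instance

theorem surf_univ_ne_zero : surf n univ ≠ 0 := by
  rw [Ne, Measure.measure_univ_eq_zero]
  exact Measure.toSphere_ne_zero _

instance : IsProbabilityMeasure (unif n) := by
  refine ⟨?_⟩
  rw [unif, Measure.smul_apply, smul_eq_mul]
  exact ENNReal.inv_mul_cancel surf_univ_ne_zero (measure_ne_top _ _)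

instance : (unif n).IsOpenPosMeasure := by
  have : (surf n).IsOpenPosMeasure := by
    unfold surf
    infer_instance
  exact Measure.isOpenPosMeasure_smul _ (ENNReal.inv_ne_zero.2 (measure_ne_top _ _))

theorem surfTotal_pos : 0 < surfTotal n :=
  ENNReal.toReal_pos surf_univ_ne_zero (measure_ne_top _ _)

theorem integrable_unif_of_continuous {f : Sphere n → ℝ} (hf : Continuous f) :
    Integrable f (unif n) :=
  hf.integrable_of_hasCompactSupport (HasCompactSupport.of_compactSpace f)

/-- The moments of a pair of linear functionals on the sphere. -/
noncomputable def moment (a b : ℕ) (x z : Sphere n) : ℝ :=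
  ∫ y, sdot x y ^ a * sdot z y ^ b ∂(unif n)

theorem moment_recurrence (a b : ℕ) (x z : Sphere n) :
    ((a : ℝ) + b + n - 1) * moment (a + 1) b x z =
      a * moment (a - 1) b x z + b * sdot x z * moment a (b - 1) x z := by
  have h := toSphere_moment_recurrence (x : EuclideanSpace ℝ (Fin n)) (z : EuclideanSpace ℝ (Fin n))
    (sphere_norm x) (sphere_norm z) a b
  rw [finrank_eq] at h
  simp only [moment, integral_unif]
  simp only [sdot, surf]
  linear_combination (surfTotal n)⁻¹ * h

theorem three_le_cast : (3 : ℝ) ≤ n := by exact_mod_cast (Fact.out : 3 ≤ n)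

/-- The moments of a single linear functional on the sphere. -/
noncomputable def axisMoment (n : ℕ) : ℕ → ℝ
  | 0 => 1
  | 1 => 0
  | k + 2 => (k + 1) / (k + n) * axisMoment n k

theorem moment_zero_right (x z : Sphere n) (a : ℕ) : moment a 0 x z = axisMoment n a := by
  have hn := three_le_cast (n := n)
  induction a using Nat.twoStepInduction with
  | zero => simp [moment, axisMoment]
  | one =>
    have h := moment_recurrence 0 0 x z
    simp only [CharP.cast_eq_zero, zero_mul, add_zero, zero_add, mul_eq_zero] at h
    rcases h with h | h
    · linarith
    · exact h
  | more k ih _ =>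
    have h := moment_recurrence (k + 1) 0 x z
    simp only [CharP.cast_eq_zero, zero_mul, add_zero, Nat.add_sub_cancel, ih] at h
    have hk : (0 : ℝ) < k + n := by positivity
    rw [axisMoment, div_mul_eq_mul_div, eq_div_iff hk.ne']
    push_cast at h
    linear_combination h

theorem moment_zero_left (x z : Sphere n) (b : ℕ) : moment 0 b x z = axisMoment n b := by
  rw [← moment_zero_right z x b, moment, moment]
  simp

open Polynomial

/-- The recurrence lowers a, and it lowers b only together with a factor ⟨x, z⟩; hence the degree
stays at most b, whatever a is. -/
theorem exists_polynomial_moment (a b : ℕ) :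
    ∃ P : ℝ[X], P.natDegree ≤ b ∧ ∀ x z : Sphere n, moment a b x z = P.eval (sdot x z) := by
  have hn := three_le_cast (n := n)
  have succ_case : ∀ a b : ℕ, (∃ P : ℝ[X], P.natDegree ≤ b ∧
      ∀ x z : Sphere n, a * moment (a - 1) b x z = P.eval (sdot x z)) →
      (∃ P : ℝ[X], P.natDegree ≤ b ∧
        ∀ x z : Sphere n, b * sdot x z * moment a (b - 1) x z = P.eval (sdot x z)) →
      ∃ P : ℝ[X], P.natDegree ≤ b ∧
        ∀ x z : Sphere n, moment (a + 1) b x z = P.eval (sdot x z) := by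
    rintro a b ⟨P, hP, hP'⟩ ⟨Q, hQ, hQ'⟩
    refine ⟨C ((a : ℝ) + b + n - 1)⁻¹ * (P + Q),
      (natDegree_C_mul_le _ _).trans (natDegree_add_le_of_degree_le hP hQ), fun x z => ?_⟩
    have h := moment_recurrence a b x z
    have h0 : (0 : ℝ) < a + b + n - 1 := by
      have : (0 : ℝ) ≤ a + b := by positivity
      linarith
    rw [hP', hQ'] at h
    rw [eval_mul, eval_C, eval_add, ← h, inv_mul_cancel_left₀ h0.ne']
  have mul_case : ∀ a b : ℕ, (∀ b, ∃ P : ℝ[X], P.natDegree ≤ b ∧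
      ∀ x z : Sphere n, moment a b x z = P.eval (sdot x z)) →
      ∃ P : ℝ[X], P.natDegree ≤ b ∧
        ∀ x z : Sphere n, b * sdot x z * moment a (b - 1) x z = P.eval (sdot x z) := by
    intro a b h
    rcases b with _ | b
    · exact ⟨0, by simp, by simp⟩
    · obtain ⟨P, hP, hP'⟩ := h b
      refine ⟨C ((b + 1 : ℕ) : ℝ) * (X * P), (natDegree_C_mul_le _ _).trans ?_, fun x z => ?_⟩
      · exact natDegree_mul_le.trans (by have := natDegree_X_le (R := ℝ); omega)
      · rw [Nat.add_sub_cancel, hP', eval_mul, eval_mul, eval_C, eval_X, mul_assoc]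
  induction a using Nat.twoStepInduction generalizing b with
  | zero => exact ⟨C (axisMoment n b), by simp, fun x z => by rw [moment_zero_left, eval_C]⟩
  | one =>
    refine succ_case 0 b ⟨0, by simp, by simp⟩ (mul_case 0 b fun b =>
      ⟨C (axisMoment n b), by simp, fun x z => by rw [moment_zero_left, eval_C]⟩)
  | more a ih0 ih1 =>
    refine succ_case (a + 1) b ?_ (mul_case (a + 1) b ih1)
    obtain ⟨P, hP, hP'⟩ := ih0 b
    exact ⟨C ((a + 1 : ℕ) : ℝ) * P, (natDegree_C_mul_le _ _).trans hP, fun x z => by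
      rw [Nat.add_sub_cancel, hP', eval_mul, eval_C]⟩

theorem integral_eval_sdot (p : ℝ[X]) (x : Sphere n) :
    ∫ y, p.eval (sdot x y) ∂(unif n) = p.sum fun k a => a * axisMoment n k := by
  simp only [eval_eq_sum, Polynomial.sum]
  rw [integral_finsetSum _ fun i _ => integrable_unif_of_continuous (by fun_prop)]
  refine Finset.sum_congr rfl fun k _ => ?_
  rw [integral_const_mul, ← moment_zero_right x x k, moment]
  simp

/-- Convolution with a polynomial kernel does not raise the degree of q. This, rather than rotation
invariance, is the source of the Funk-Hecke formula. -/
theorem exists_polynomial_integral_eval_sdot_mul (p q : ℝ[X]) :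
    ∃ P : ℝ[X], P.natDegree ≤ q.natDegree ∧ ∀ x z : Sphere n,
      ∫ y, p.eval (sdot x y) * q.eval (sdot z y) ∂(unif n) = P.eval (sdot x z) := by
  choose M hM hM' using exists_polynomial_moment (n := n)
  refine ⟨∑ i ∈ p.support, ∑ j ∈ q.support, C (p.coeff i * q.coeff j) * M i j, ?_, fun x z => ?_⟩
  · refine natDegree_sum_le_of_forall_le _ _ fun i _ => natDegree_sum_le_of_forall_le _ _
      fun j hj => (natDegree_C_mul_le _ _).trans ((hM i j).trans (le_natDegree_of_mem_supp j hj))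
  · simp only [eval_eq_sum (p := p), eval_eq_sum (p := q), Polynomial.sum, eval_finsetSum,
      Finset.sum_mul_sum]
    rw [integral_finsetSum _ fun i _ => integrable_unif_of_continuous (by fun_prop)]
    refine Finset.sum_congr rfl fun i _ => ?_
    rw [integral_finsetSum _ fun i _ => integrable_unif_of_continuous (by fun_prop)]
    refine Finset.sum_congr rfl fun j _ => ?_
    rw [eval_mul, eval_C, ← hM', moment, ← integral_const_mul]
    congr 1 with y
    ring

end Unif

/-! ### Zonal integrals as weighted integrals over [-1, 1] -/

section Weight

variable {n : ℕ}

/-- The weight `(1 - t²)^((n-3)/2)` of the Gegenbauer polynomials on `S^{n-1}`. -/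
noncomputable def gegWeight (n : ℕ) (t : ℝ) : ℝ := (1 - t ^ 2) ^ (((n : ℝ) - 3) / 2)

theorem gegWeight_nonneg {t : ℝ} (ht : t ∈ Icc (-1 : ℝ) 1) : 0 ≤ gegWeight n t :=
  Real.rpow_nonneg (by nlinarith [ht.1, ht.2]) _

variable [Fact (3 ≤ n)]

theorem continuous_gegWeight : Continuous (gegWeight n) := by
  have := three_le_cast (n := n)
  unfold gegWeight
  exact (by fun_prop : Continuous fun t : ℝ => 1 - t ^ 2).rpow_const fun t => Or.inr (by linarith)

theorem integral_gegWeight_pos : 0 < ∫ t in (-1 : ℝ)..1, gegWeight n t := by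
  refine intervalIntegral.intervalIntegral_pos_of_pos_on
    (continuous_gegWeight.intervalIntegrable _ _) (fun t ht => ?_) (by norm_num)
  exact Real.rpow_pos_of_pos (by nlinarith [ht.1, ht.2]) _

/-- Integrate the derivative of t^(k+1) (1-t²)^((n-1)/2), which vanishes at both ends. The result is
the recursion that defines `axisMoment`. -/
theorem integral_pow_mul_gegWeight_recurrence (k : ℕ) :
    ((k : ℝ) + n) * ∫ t in (-1 : ℝ)..1, t ^ (k + 2) * gegWeight n t =
      (k + 1) * ∫ t in (-1 : ℝ)..1, t ^ k * gegWeight n t := by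
  have hn := three_le_cast (n := n)
  have hderiv : ∀ t ∈ Ioo (-1 : ℝ) 1, HasDerivAt
      (fun t : ℝ => t ^ (k + 1) * (1 - t ^ 2) ^ (((n : ℝ) - 1) / 2))
      ((k + 1) * (t ^ k * gegWeight n t) - (k + n) * (t ^ (k + 2) * gegWeight n t)) t := by
    intro t ht
    have hpos : 0 < 1 - t ^ 2 := by nlinarith [ht.1, ht.2]
    have h1 := (hasDerivAt_pow (k + 1) t).mul
      ((((hasDerivAt_pow 2 t).const_sub 1)).rpow_const (p := ((n : ℝ) - 1) / 2) (Or.inl hpos.ne'))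
    refine h1.congr_deriv ?_
    have e1 : (1 - t ^ 2) ^ (((n : ℝ) - 1) / 2) = (1 - t ^ 2) * gegWeight n t := by
      rw [gegWeight, ← Real.rpow_one_add' hpos.le]
      · congr 1
        ring
      · linarith
    have e2 : (1 - t ^ 2) ^ (((n : ℝ) - 1) / 2 - 1) = gegWeight n t := by
      rw [gegWeight]
      congr 1
      ring
    rw [e1, e2]
    simp only [Nat.add_sub_cancel]
    push_cast
    ring
  have hc := continuous_gegWeight (n := n)
  have hi : ∀ j : ℕ, IntervalIntegrable (fun t : ℝ => t ^ j * gegWeight n t) volume (-1) 1 :=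
    fun j => ((continuous_pow j).mul hc).intervalIntegrable _ _
  have h := intervalIntegral.integral_eq_sub_of_hasDerivAt_of_le (by norm_num)
    (Continuous.continuousOn ?_) hderiv
    (((hi k).const_mul _).sub ((hi (k + 2)).const_mul _))
  · rw [intervalIntegral.integral_sub ((hi k).const_mul _) ((hi (k + 2)).const_mul _),
      intervalIntegral.integral_const_mul, intervalIntegral.integral_const_mul] at h
    have h0 : (0 : ℝ) ^ (((n : ℝ) - 1) / 2) = 0 := Real.zero_rpow (by linarith)
    norm_num [h0] at h
    linarith
  · exact (continuous_pow _).mul ((by fun_prop : Continuous fun t : ℝ => 1 - t ^ 2).rpow_const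
      fun t => Or.inr (by linarith))

theorem integral_pow_mul_gegWeight (k : ℕ) :
    ∫ t in (-1 : ℝ)..1, t ^ k * gegWeight n t =
      axisMoment n k * ∫ t in (-1 : ℝ)..1, gegWeight n t := by
  induction k using Nat.twoStepInduction with
  | zero => simp [axisMoment]
  | one =>
    have h := intervalIntegral.integral_comp_neg (a := -1) (b := 1)
      fun t : ℝ => t ^ 1 * gegWeight n t
    have e : ∀ t : ℝ, gegWeight n (-t) = gegWeight n t := fun t => by simp [gegWeight]
    simp only [e, neg_neg, pow_one, neg_mul, intervalIntegral.integral_neg] at h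
    simp only [axisMoment, zero_mul, pow_one]
    linarith
  | more k ih _ =>
    have h := integral_pow_mul_gegWeight_recurrence (n := n) k
    have hk : (0 : ℝ) < k + n := by
      have := three_le_cast (n := n)
      positivity
    rw [ih] at h
    rw [axisMoment]
    field_simp
    linear_combination h

open Polynomial

theorem integral_eval_mul_gegWeight (p : ℝ[X]) (x : Sphere n) :
    ∫ t in (-1 : ℝ)..1, p.eval t * gegWeight n t =
      (∫ t in (-1 : ℝ)..1, gegWeight n t) * ∫ y, p.eval (sdot x y) ∂(unif n) := by
  rw [integral_eval_sdot]
  simp only [eval_eq_sum, Polynomial.sum, Finset.sum_mul]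
  have hc := continuous_gegWeight (n := n)
  have hi : ∀ i ∈ p.support, IntervalIntegrable (fun t => p.coeff i * t ^ i * gegWeight n t)
      volume (-1) 1 := fun i _ => Continuous.intervalIntegrable (by fun_prop) _ _
  rw [intervalIntegral.integral_finsetSum hi, Finset.mul_sum]
  refine Finset.sum_congr rfl fun k _ => ?_
  simp only [mul_assoc]
  rw [intervalIntegral.integral_const_mul, integral_pow_mul_gegWeight]
  ring

/-- Integration of a zonal function over the sphere. -/
theorem integral_comp_sdot {g : ℝ → ℝ} (hg : ContinuousOn g (Icc (-1) 1)) (x : Sphere n) :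
    (∫ t in (-1 : ℝ)..1, gegWeight n t)⁻¹ * ∫ t in (-1 : ℝ)..1, g t * gegWeight n t =
      ∫ y, g (sdot x y) ∂(unif n) := by
  set I := ∫ t in (-1 : ℝ)..1, gegWeight n t with hI
  have hIpos : 0 < I := integral_gegWeight_pos
  refine eq_of_forall_dist_le fun ε hε => ?_
  -- Both sides are averages against probability measures, so replacing g by a polynomial within ε/2
  -- costs at most ε/2 on each side.
  obtain ⟨p, hp⟩ := exists_polynomial_near_of_continuousOn (-1) 1 g hg (ε / 2) (by positivity)
  have h1 : |∫ t in (-1 : ℝ)..1, (g t - p.eval t) * gegWeight n t| ≤ ε / 2 * I := by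
    rw [hI, ← intervalIntegral.integral_const_mul, ← Real.norm_eq_abs]
    refine intervalIntegral.norm_integral_le_of_norm_le (by norm_num) (.of_forall fun t ht => ?_)
      ((continuous_const.mul (continuous_gegWeight (n := n))).intervalIntegrable _ _)
    have ht' : t ∈ Icc (-1 : ℝ) 1 := Ioc_subset_Icc_self ht
    rw [norm_mul, Real.norm_eq_abs, Real.norm_eq_abs, abs_of_nonneg (gegWeight_nonneg ht'),
      abs_sub_comm]
    exact mul_le_mul_of_nonneg_right (hp t ht').le (gegWeight_nonneg ht')
  have h2 : |∫ y, (p.eval (sdot x y) - g (sdot x y)) ∂(unif n)| ≤ ε / 2 := by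
    have := norm_integral_le_of_norm_le_const (μ := unif n)
      (f := fun y => p.eval (sdot x y) - g (sdot x y)) (C := ε / 2)
      (.of_forall fun y => (hp _ (sdot_mem x y)).le)
    simpa using this
  have hgc : Continuous fun y => g (sdot x y) := continuous_comp_sdot hg continuous_const continuous_id
  have hgi : IntervalIntegrable (fun t => g t * gegWeight n t) volume (-1) 1 := by
    refine ContinuousOn.intervalIntegrable ?_
    rw [uIcc_of_le (by norm_num)]
    exact hg.mul continuous_gegWeight.continuousOn
  have hpi : IntervalIntegrable (fun t => p.eval t * gegWeight n t) volume (-1) 1 :=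
    (p.continuous.mul continuous_gegWeight).intervalIntegrable _ _
  simp only [sub_mul] at h1
  rw [intervalIntegral.integral_sub hgi hpi, integral_eval_mul_gegWeight p x, ← hI] at h1
  rw [integral_sub (integrable_unif_of_continuous (continuous_eval_sdot p x))
    (integrable_unif_of_continuous hgc)] at h2
  have h3 : |I⁻¹ * (∫ t in (-1 : ℝ)..1, g t * gegWeight n t) -
      ∫ y, p.eval (sdot x y) ∂(unif n)| ≤ ε / 2 := by
    have e : I⁻¹ * (∫ t in (-1 : ℝ)..1, g t * gegWeight n t) -
        ∫ y, p.eval (sdot x y) ∂(unif n) = ((∫ t in (-1 : ℝ)..1, g t * gegWeight n t) -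
        I * ∫ y, p.eval (sdot x y) ∂(unif n)) / I := by
      field_simp
    rwa [e, abs_div, abs_of_pos hIpos, div_le_iff₀ hIpos]
  rw [Real.dist_eq]
  calc _ ≤ _ := abs_sub_le _ (∫ y, p.eval (sdot x y) ∂(unif n)) _
    _ ≤ ε / 2 + ε / 2 := add_le_add h3 h2
    _ = ε := by ring

end Weight

/-! ### Algebra of Gegenbauer polynomials -/

section Gegenbauer

open Polynomial

/-- The Gegenbauer polynomials as polynomials. -/
noncomputable def gegPoly (a : ℝ) : ℕ → ℝ[X]
  | 0 => 1
  | 1 => C (2 * a) * X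
  | k + 2 => C (1 / ((k : ℝ) + 2)) *
      (C (2 * (a + k + 1)) * X * gegPoly a (k + 1) - C (2 * a + k) * gegPoly a k)

theorem eval_gegPoly (a : ℝ) (k : ℕ) (t : ℝ) : (gegPoly a k).eval t = gegenbauer a k t := by
  induction k using Nat.twoStepInduction with
  | zero => simp [gegPoly, gegenbauer]
  | one => simp [gegPoly, gegenbauer]
  | more k ih0 ih1 =>
    simp only [gegPoly, gegenbauer, eval_mul, eval_sub, eval_C, eval_X, ih0, ih1]
    ring

theorem gegPoly_recurrence (a : ℝ) (k : ℕ) :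
    C ((k : ℝ) + 2) * gegPoly a (k + 2) =
      C (2 * (a + k + 1)) * X * gegPoly a (k + 1) - C (2 * a + k) * gegPoly a k := by
  have hk : ((k : ℝ) + 2) ≠ 0 := by positivity
  rw [gegPoly, ← mul_assoc, ← C_mul, mul_one_div_cancel hk, C_1, one_mul]

/-- The two identities are proved together: differentiating the three term recurrence gives the
first at k + 1 from the second at k, and the second at k + 1 then needs both. -/
theorem derivative_gegPoly (a : ℝ) (k : ℕ) :
    derivative (gegPoly a (k + 1)) =
        X * derivative (gegPoly a k) + C (k + 2 * a) * gegPoly a k ∧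
      X * derivative (gegPoly a (k + 1)) - derivative (gegPoly a k) =
        C ((k : ℝ) + 1) * gegPoly a (k + 1) := by
  induction k with
  | zero => simp [gegPoly, mul_comm]
  | succ k ih =>
    obtain ⟨hA, hB⟩ := ih
    have hrec := gegPoly_recurrence a k
    have hd := congrArg derivative hrec
    simp only [derivative_mul, derivative_sub, derivative_C, derivative_X, zero_mul, zero_add,
      mul_one] at hd
    have hk : C ((k : ℝ) + 2) ≠ 0 := by
      rw [Ne, C_eq_zero]
      positivity
    have e1 : derivative (gegPoly a (k + 2)) =
        X * derivative (gegPoly a (k + 1)) + C ((k + 1 : ℕ) + 2 * a) * gegPoly a (k + 1) := by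
      apply mul_left_cancel₀ hk
      simp only [C_add, C_mul, Nat.cast_add, Nat.cast_one, map_ofNat, C_1] at hA hB hd ⊢
      linear_combination hd + (2 * C a + C (k : ℝ)) * hB
    refine ⟨e1, ?_⟩
    rw [e1]
    simp only [C_add, C_mul, Nat.cast_add, Nat.cast_one, map_ofNat, C_1] at hA hB hrec ⊢
    linear_combination X * hB - hA - hrec

theorem gegPoly_ode (a : ℝ) (k : ℕ) :
    (1 - X ^ 2) * derivative (derivative (gegPoly a k)) -
        C (2 * a + 1) * X * derivative (gegPoly a k) =
      -C (k * (k + 2 * a)) * gegPoly a k := by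
  rcases k with _ | k
  · simp [gegPoly]
  · obtain ⟨hA, hB⟩ := derivative_gegPoly a k
    -- Eliminating the derivative of the lower polynomial leaves a first order relation; its
    -- derivative is the differential equation up to `hB`.
    have h1 : (1 - X ^ 2) * derivative (gegPoly a (k + 1)) =
        C (k + 2 * a) * gegPoly a k - C ((k : ℝ) + 1) * X * gegPoly a (k + 1) := by
      linear_combination hA - X * hB
    have hd := congrArg derivative h1
    simp only [derivative_mul, derivative_sub, derivative_C, derivative_X, zero_mul, zero_add,
      mul_one, derivative_one, derivative_X_pow, zero_sub] at hd
    simp only [C_add, C_mul, Nat.cast_add, Nat.cast_one, map_ofNat, C_1, Nat.cast_ofNat, pow_one,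
      Nat.add_one_sub_one] at hd hB ⊢
    linear_combination hd - (C (k : ℝ) + 2 * C a) * hB

theorem gegPoly_eval_one_pos {a : ℝ} (ha : 0 < a) (k : ℕ) : 0 < (gegPoly a k).eval 1 := by
  induction k with
  | zero => simp [gegPoly]
  | succ k ih =>
    obtain ⟨hA, hB⟩ := derivative_gegPoly a k
    have hA' := congrArg (eval 1) hA
    have hB' := congrArg (eval 1) hB
    simp only [eval_add, eval_mul, eval_X, eval_C, eval_sub, one_mul] at hA' hB'
    -- At t = 1 both derivative identities contain the same difference of derivatives, which drops
    -- out.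
    have h : ((k : ℝ) + 1) * (gegPoly a (k + 1)).eval 1 = (k + 2 * a) * (gegPoly a k).eval 1 := by
      linarith
    have h2 : 0 < ((k : ℝ) + 2 * a) * (gegPoly a k).eval 1 := by positivity
    rw [← h] at h2
    exact pos_of_mul_pos_right h2 (by positivity)

theorem gegPoly_natDegree_le_and_coeff_pos {a : ℝ} (ha : 0 < a) (k : ℕ) :
    (gegPoly a k).natDegree ≤ k ∧ 0 < (gegPoly a k).coeff k := by
  induction k using Nat.twoStepInduction with
  | zero => simp [gegPoly]
  | one =>
    refine ⟨(natDegree_C_mul_le _ _).trans natDegree_X_le, ?_⟩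
    simpa [gegPoly] using ha
  | more k ih0 ih1 =>
    constructor
    · rw [gegPoly]
      refine (natDegree_C_mul_le _ _).trans
        ((natDegree_sub_le_of_le (m := k + 2) (n := k + 2) ?_ ?_).trans (max_self _).le)
      · rw [mul_assoc]
        refine (natDegree_C_mul_le _ _).trans (natDegree_mul_le.trans ?_)
        have := natDegree_X_le (R := ℝ)
        omega
      · exact (natDegree_C_mul_le _ _).trans (by omega)
    · have h0 : (gegPoly a k).coeff (k + 2) = 0 := coeff_eq_zero_of_natDegree_lt (by omega)
      rw [gegPoly, coeff_C_mul, coeff_sub, mul_assoc, coeff_C_mul, coeff_X_mul, coeff_C_mul, h0]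
      have := ih1.2
      have : 0 < 2 * (a + k + 1) := by positivity
      simp only [mul_zero, sub_zero]
      positivity

theorem gegPoly_degree {a : ℝ} (ha : 0 < a) (k : ℕ) : (gegPoly a k).degree = k := by
  obtain ⟨h1, h2⟩ := gegPoly_natDegree_le_and_coeff_pos ha k
  exact degree_eq_of_le_of_coeff_ne_zero (natDegree_le_iff_degree_le.1 h1) h2.ne'

/-- The sequence of Gegenbauer polynomials. -/
noncomputable def gegSequence {a : ℝ} (ha : 0 < a) : Polynomial.Sequence ℝ where
  elems' := gegPoly a
  degree_eq' := gegPoly_degree ha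

/-- The k-th polynomial has degree exactly k, so the first N + 1 of them span degree at most N. -/
theorem exists_gegPoly_sum {a : ℝ} (ha : 0 < a) {N : ℕ} (p : ℝ[X]) (hp : p.natDegree ≤ N) :
    ∃ b : ℕ → ℝ, p = ∑ k ∈ Finset.range (N + 1), b k • gegPoly a k := by
  have h := (gegSequence ha).span_degreeLE (m := N) fun i _ =>
    isUnit_iff_ne_zero.2 (leadingCoeff_ne_zero.2 ((gegSequence ha).ne_zero i))
  have hmem : p ∈ Submodule.span ℝ (gegSequence ha '' Iic N) := by
    rw [h, mem_degreeLE]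
    exact natDegree_le_iff_degree_le.1 hp
  have e : (Iic N : Set ℕ) = ((Finset.range (N + 1) : Finset ℕ) : Set ℕ) := by
    ext i
    simp
  rw [e, Submodule.mem_span_image_finset_iff_exists_fun] at hmem
  obtain ⟨b, hb⟩ := hmem
  refine ⟨fun k => if h : k ∈ Finset.range (N + 1) then b ⟨k, h⟩ else 0, ?_⟩
  refine hb.symm.trans (Eq.trans ?_ (Finset.sum_coe_sort (Finset.range (N + 1)) fun k =>
    (if h : k ∈ Finset.range (N + 1) then b ⟨k, h⟩ else 0) • gegPoly a k))
  refine Finset.sum_congr rfl fun k _ => ?_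
  rw [dif_pos k.2]
  rfl

end Gegenbauer

/-! ### Orthogonality and the Funk-Hecke formula for polynomial kernels -/

section Orthogonality

open Polynomial

variable {n : ℕ} [Fact (3 ≤ n)]

theorem gegIndex_pos : 0 < gegIndex n := by
  have := three_le_cast (n := n)
  rw [gegIndex]
  linarith

/-- With t = ⟨x, y⟩ the integrand is the divergence of the tangential field p(t)∇t, since |∇t|² = 1
- t² and Δt = -(n-1)t. The proof only needs the recursion of the axis moments. -/
theorem integral_sdot_divergence (p : ℝ[X]) (x : Sphere n) :
    ∫ y, ((1 - X ^ 2) * derivative p - C ((n : ℝ) - 1) * X * p).eval (sdot x y) ∂(unif n) = 0 := by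
  have hi : ∀ q : ℝ[X], Integrable (fun y => q.eval (sdot x y)) (unif n) := fun q =>
    integrable_unif_of_continuous (continuous_eval_sdot q x)
  induction p using Polynomial.induction_on' with
  | add p q hp hq =>
    rw [← add_zero (0 : ℝ)]
    nth_rewrite 1 [← hp]
    rw [← hq, ← integral_add (hi _) (hi _)]
    congr 1 with y
    simp only [derivative_add, eval_sub, eval_mul, eval_add]
    ring
  | monomial k c =>
    have hm : ∀ j : ℕ, ∫ y, (sdot x y) ^ j ∂(unif n) = axisMoment n j := fun j => by
      rw [← moment_zero_right x x j, moment]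
      simp
    have hmi : ∀ j : ℕ, Integrable (fun y => (sdot x y) ^ j) (unif n) := fun j =>
      integrable_unif_of_continuous (by fun_prop)
    have e : ∀ y, ((1 - X ^ 2) * derivative (monomial k c) -
        C ((n : ℝ) - 1) * X * monomial k c).eval (sdot x y) =
        c * k * (sdot x y) ^ (k - 1) - c * (k + n - 1) * (sdot x y) ^ (k + 1) := by
      intro y
      simp only [derivative_monomial, eval_sub, eval_mul, eval_one, eval_pow, eval_X,
        eval_monomial, eval_C]
      rcases k with _ | k
      · simp
        ring
      · simp only [Nat.add_sub_cancel]
        push_cast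
        ring
    simp only [e]
    rw [integral_sub ((hmi _).const_mul _) ((hmi _).const_mul _), integral_const_mul,
      integral_const_mul, hm, hm]
    rcases k with _ | k
    · simp [axisMoment]
    · have hk : (0 : ℝ) < k + n := by
        have := three_le_cast (n := n)
        positivity
      simp only [Nat.add_sub_cancel, axisMoment]
      field_simp
      push_cast
      ring

/-- The Gegenbauer polynomial that belongs to the spherical harmonics of degree `k`. -/
noncomputable abbrev sphGeg (n k : ℕ) : ℝ[X] := gegPoly (gegIndex n) k

/-- Sturm-Liouville argument: the divergence identity applied to the Wronskian of the two
polynomials leaves their product times the difference of the eigenvalues k(k+n-2), which are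
distinct. -/
theorem integral_sphGeg_mul_sphGeg {k l : ℕ} (hkl : k ≠ l) (x : Sphere n) :
    ∫ y, (sphGeg n k * sphGeg n l).eval (sdot x y) ∂(unif n) = 0 := by
  have h := integral_sdot_divergence
    (derivative (sphGeg n k) * sphGeg n l - sphGeg n k * derivative (sphGeg n l)) x
  have ek := gegPoly_ode (gegIndex n) k
  have el := gegPoly_ode (gegIndex n) l
  have hn : (n : ℝ) - 1 = 2 * gegIndex n + 1 := by
    rw [gegIndex]
    ring
  have e : (1 - X ^ 2) * derivative
      (derivative (sphGeg n k) * sphGeg n l - sphGeg n k * derivative (sphGeg n l)) -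
      C ((n : ℝ) - 1) * X *
        (derivative (sphGeg n k) * sphGeg n l - sphGeg n k * derivative (sphGeg n l)) =
      C ((l * (l + 2 * gegIndex n)) - (k * (k + 2 * gegIndex n))) *
        (sphGeg n k * sphGeg n l) := by
    rw [hn, C_sub]
    simp only [derivative_sub, derivative_mul]
    linear_combination sphGeg n l * ek - sphGeg n k * el
  rw [e] at h
  simp only [eval_mul (p := C _), eval_C] at h
  rw [integral_const_mul, mul_eq_zero] at h
  refine h.resolve_left fun h0 => hkl ?_
  have ha := gegIndex_pos (n := n)
  have h1 : ((l : ℝ) - k) * (l + k + 2 * gegIndex n) = 0 := by linear_combination h0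
  have h2 : (0 : ℝ) < l + k + 2 * gegIndex n := by positivity
  have h3 : (l : ℝ) = k := by
    rcases mul_eq_zero.1 h1 with h | h
    · linarith
    · exact absurd h h2.ne'
  exact_mod_cast h3.symm

theorem integral_sphGeg_sq_pos (k : ℕ) (x : Sphere n) :
    0 < ∫ y, (sphGeg n k).eval (sdot x y) ^ 2 ∂(unif n) := by
  have hc : Continuous fun y => (sphGeg n k).eval (sdot x y) ^ 2 := by fun_prop
  rw [integral_pos_iff_support_of_nonneg (fun y => sq_nonneg _) (integrable_unif_of_continuous hc)]
  refine hc.isOpen_support.measure_pos _ ⟨x, ?_⟩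
  rw [Function.mem_support, sdot_self]
  exact pow_ne_zero _ (gegPoly_eval_one_pos gegIndex_pos k).ne'

theorem integral_eval_mul_sphGeg_of_natDegree_lt {l : ℕ} (q : ℝ[X]) (hq : q.natDegree < l)
    (x : Sphere n) :
    ∫ y, q.eval (sdot x y) * (sphGeg n l).eval (sdot x y) ∂(unif n) = 0 := by
  obtain ⟨N, rfl⟩ : ∃ N, l = N + 1 := ⟨l - 1, by omega⟩
  obtain ⟨b, hb⟩ := exists_gegPoly_sum (gegIndex_pos (n := n)) (N := N) q (by omega)
  rw [hb]
  simp only [eval_finsetSum, Finset.sum_mul, eval_smul, smul_eq_mul, mul_assoc]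
  rw [integral_finsetSum _ fun i _ => integrable_unif_of_continuous (by fun_prop)]
  refine Finset.sum_eq_zero fun k hk => ?_
  rw [integral_const_mul]
  simp only [← eval_mul]
  rw [integral_sphGeg_mul_sphGeg (by rw [Finset.mem_range] at hk; omega), mul_zero]

theorem sphCoeff_eq {W : ℝ → ℝ} (hW : ContinuousOn W (Icc (-1) 1)) (k : ℕ) (x : Sphere n) :
    sphCoeff n W k * (sphGeg n k).eval 1 =
      ∫ y, W (sdot x y) * (sphGeg n k).eval (sdot x y) ∂(unif n) := by
  have h := integral_comp_sdot (g := fun t => W t * ((sphGeg n k).eval t / (sphGeg n k).eval 1))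
    (hW.mul (by fun_prop)) x
  simp only [sphCoeff, ← eval_gegPoly]
  simp only [gegWeight] at h
  rw [h, ← integral_mul_const]
  congr 1 with y
  have := (gegPoly_eval_one_pos (gegIndex_pos (n := n)) k).ne'
  field_simp

/-- The Funk-Hecke formula for polynomial kernels. -/
theorem funk_hecke_polynomial (p : ℝ[X]) (l : ℕ) (x z : Sphere n) :
    ∫ y, p.eval (sdot x y) * (sphGeg n l).eval (sdot z y) ∂(unif n) =
      sphCoeff n (fun t => p.eval t) l * (sphGeg n l).eval (sdot x z) := by
  obtain ⟨P, hP, hP'⟩ := exists_polynomial_integral_eval_sdot_mul (n := n) p (sphGeg n l)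
  have hl : (sphGeg n l).natDegree = l :=
    natDegree_eq_of_degree_eq_some (gegPoly_degree gegIndex_pos l)
  rw [hl] at hP
  -- The convolution is symmetric. Moved onto the polynomial of degree j < l it yields a polynomial
  -- Q of degree at most j, which is orthogonal to the one of degree l.
  have horth : ∀ j < l, ∫ x, P.eval (sdot z x) * (sphGeg n j).eval (sdot z x) ∂(unif n) = 0 := by
    intro j hj
    obtain ⟨Q, hQ, hQ'⟩ := exists_polynomial_integral_eval_sdot_mul (n := n) p (sphGeg n j)
    have hj' : (sphGeg n j).natDegree = j :=
      natDegree_eq_of_degree_eq_some (gegPoly_degree gegIndex_pos j)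
    rw [hj'] at hQ
    calc ∫ x, P.eval (sdot z x) * (sphGeg n j).eval (sdot z x) ∂(unif n)
        = ∫ x, ∫ y, p.eval (sdot x y) * (sphGeg n l).eval (sdot z y) *
            (sphGeg n j).eval (sdot z x) ∂(unif n) ∂(unif n) := by
          congr 1 with x
          rw [integral_mul_const, hP', sdot_comm z x]
      _ = ∫ y, ∫ x, p.eval (sdot x y) * (sphGeg n l).eval (sdot z y) *
            (sphGeg n j).eval (sdot z x) ∂(unif n) ∂(unif n) := by
          refine integral_integral_swap ?_
          refine Continuous.integrable_of_hasCompactSupport ?_ (HasCompactSupport.of_compactSpace _)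
          unfold Function.uncurry
          fun_prop
      _ = ∫ y, Q.eval (sdot z y) * (sphGeg n l).eval (sdot z y) ∂(unif n) := by
          congr 1 with y
          rw [sdot_comm z y, ← hQ' y z, ← integral_mul_const]
          congr 1 with x
          rw [sdot_comm x y]
          ring
      _ = 0 := integral_eval_mul_sphGeg_of_natDegree_lt Q (by omega) z
  obtain ⟨b, hb⟩ := exists_gegPoly_sum (gegIndex_pos (n := n)) P hP
  have hb0 : ∀ j < l, b j = 0 := by
    intro j hj
    have h := horth j hj
    rw [hb] at h
    simp only [eval_finsetSum, Finset.sum_mul, eval_smul, smul_eq_mul, mul_assoc] at h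
    rw [integral_finsetSum _ fun i _ => integrable_unif_of_continuous (by fun_prop),
      Finset.sum_eq_single j] at h
    · rw [integral_const_mul, mul_eq_zero] at h
      refine h.resolve_right ?_
      have := integral_sphGeg_sq_pos (n := n) j z
      simp only [sq] at this
      exact this.ne'
    · intro i _ hij
      rw [integral_const_mul]
      simp only [← eval_mul]
      rw [integral_sphGeg_mul_sphGeg hij, mul_zero]
    · intro h
      exact absurd (Finset.mem_range.2 (by omega)) h
  have hPl : P = b l • sphGeg n l := by
    rw [hb, Finset.sum_range_succ, Finset.sum_eq_zero, zero_add]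
    intro j hj
    rw [hb0 j (Finset.mem_range.1 hj), zero_smul]
  -- A polynomial of degree at most l without lower components is a multiple of the l-th one; the
  -- factor is read off at x = z.
  have h1 := sphCoeff_eq (n := n) (W := fun t => p.eval t) (by fun_prop) l z
  rw [hP' z z, sdot_self, hPl, eval_smul, smul_eq_mul] at h1
  rw [mul_right_cancel₀ (gegPoly_eval_one_pos gegIndex_pos l).ne' h1, hP', hPl, eval_smul,
    smul_eq_mul]

end Orthogonality

/-! ### Convolution operators with continuous kernel -/

theorem tendsto_integral_of_forall_abs_sub_le {X : Type*} [MeasurableSpace X] {μ : Measure X}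
    [IsProbabilityMeasure μ] {f : ℕ → X → ℝ} {g : X → ℝ} {d : ℕ → ℝ}
    (hf : ∀ j, Integrable (f j) μ) (hg : Integrable g μ) (hd : Tendsto d atTop (𝓝 0))
    (h : ∀ j x, |f j x - g x| ≤ d j) :
    Tendsto (fun j => ∫ x, f j x ∂μ) atTop (𝓝 (∫ x, g x ∂μ)) := by
  rw [tendsto_iff_dist_tendsto_zero]
  refine squeeze_zero (fun _ => dist_nonneg) (fun j => ?_) hd
  rw [Real.dist_eq, ← integral_sub (hf j) hg]
  have := norm_integral_le_of_norm_le_const (μ := μ) (f := fun x => f j x - g x)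
    (.of_forall (h j))
  simpa using this

section Operator

open Polynomial

variable {n : ℕ}

theorem exists_polynomial_seq {W : ℝ → ℝ} (hW : ContinuousOn W (Icc (-1) 1)) :
    ∃ p : ℕ → ℝ[X], ∀ j, ∀ t ∈ Icc (-1 : ℝ) 1, |(p j).eval t - W t| ≤ 1 / ((j : ℝ) + 1) := by
  choose p hp using fun j : ℕ =>
    exists_polynomial_near_of_continuousOn (-1) 1 W hW (1 / ((j : ℝ) + 1)) (by positivity)
  exact ⟨p, fun j t ht => (hp j t ht).le⟩

theorem tendsto_const_mul_one_div (C : ℝ) :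
    Tendsto (fun j : ℕ => 1 / ((j : ℝ) + 1) * C) atTop (𝓝 0) := by
  simpa using (tendsto_one_div_add_atTop_nhds_zero_nat (𝕜 := ℝ)).mul_const C

theorem exists_abs_le_of_continuous {X : Type*} [TopologicalSpace X] [CompactSpace X] {v : X → ℝ}
    (hv : Continuous v) : ∃ C, 0 ≤ C ∧ ∀ x, |v x| ≤ C := by
  obtain ⟨C, hC⟩ := isCompact_univ.exists_bound_of_continuousOn hv.continuousOn
  exact ⟨max C 0, le_max_right _ _, fun x => (hC x (mem_univ x)).trans (le_max_left _ _)⟩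

variable [Fact (3 ≤ n)]

theorem tendsto_sphCoeff {W : ℝ → ℝ} (hW : ContinuousOn W (Icc (-1) 1)) {p : ℕ → ℝ[X]}
    (hp : ∀ j, ∀ t ∈ Icc (-1 : ℝ) 1, |(p j).eval t - W t| ≤ 1 / ((j : ℝ) + 1)) (l : ℕ)
    (z : Sphere n) :
    Tendsto (fun j => sphCoeff n (fun t => (p j).eval t) l) atTop (𝓝 (sphCoeff n W l)) := by
  have h1 := gegPoly_eval_one_pos (gegIndex_pos (n := n)) l
  obtain ⟨M, hM0, hM⟩ := exists_abs_le_of_continuous (continuous_eval_sdot (sphGeg n l) z)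
  have h : Tendsto (fun j => ∫ y, (p j).eval (sdot z y) * (sphGeg n l).eval (sdot z y) ∂(unif n))
      atTop (𝓝 (∫ y, W (sdot z y) * (sphGeg n l).eval (sdot z y) ∂(unif n))) := by
    refine tendsto_integral_of_forall_abs_sub_le
      (fun j => integrable_unif_of_continuous (by fun_prop))
      (integrable_unif_of_continuous ((continuous_comp_sdot hW continuous_const continuous_id).mul
        (continuous_eval_sdot _ _))) (tendsto_const_mul_one_div M) fun j y => ?_
    rw [← sub_mul, abs_mul]
    exact mul_le_mul (hp j _ (sdot_mem z y)) (hM y) (abs_nonneg _) (by positivity)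
  have e : ∀ j, ∫ y, (p j).eval (sdot z y) * (sphGeg n l).eval (sdot z y) ∂(unif n) =
      sphCoeff n (fun t => (p j).eval t) l * (sphGeg n l).eval 1 := fun j =>
    (sphCoeff_eq (W := fun t => (p j).eval t) (Continuous.continuousOn (by fun_prop)) l z).symm
  simp only [e, ← sphCoeff_eq hW] at h
  simpa [mul_assoc, h1.ne'] using h.mul_const ((sphGeg n l).eval 1)⁻¹

/-- The Funk-Hecke formula. -/
theorem funk_hecke {W : ℝ → ℝ} (hW : ContinuousOn W (Icc (-1) 1)) (l : ℕ) (x z : Sphere n) :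
    ∫ y, W (sdot x y) * (sphGeg n l).eval (sdot z y) ∂(unif n) =
      sphCoeff n W l * (sphGeg n l).eval (sdot x z) := by
  obtain ⟨p, hp⟩ := exists_polynomial_seq hW
  obtain ⟨M, hM0, hM⟩ := exists_abs_le_of_continuous (continuous_eval_sdot (sphGeg n l) z)
  have h : Tendsto (fun j => ∫ y, (p j).eval (sdot x y) * (sphGeg n l).eval (sdot z y) ∂(unif n))
      atTop (𝓝 (∫ y, W (sdot x y) * (sphGeg n l).eval (sdot z y) ∂(unif n))) := by
    refine tendsto_integral_of_forall_abs_sub_le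
      (fun j => integrable_unif_of_continuous (by fun_prop))
      (integrable_unif_of_continuous ((continuous_comp_sdot hW continuous_const continuous_id).mul
        (continuous_eval_sdot _ _))) (tendsto_const_mul_one_div M) fun j y => ?_
    rw [← sub_mul, abs_mul]
    exact mul_le_mul (hp j _ (sdot_mem x y)) (hM y) (abs_nonneg _) (by positivity)
  simp only [funk_hecke_polynomial] at h
  exact tendsto_nhds_unique h ((tendsto_sphCoeff hW hp l z).mul_const _)

theorem integral_kernel {W : ℝ → ℝ} (hW : ContinuousOn W (Icc (-1) 1)) (x : Sphere n) :
    ∫ y, W (sdot x y) ∂(unif n) = sphCoeff n W 0 := by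
  have := funk_hecke hW 0 x x
  simpa [sphGeg, gegPoly] using this

/-- The coefficient is an eigenvalue: evaluate the Funk-Hecke formula where the eigenfunction has
its largest modulus. The bound |C_k(t)| ≤ C_k(1) is not needed. -/
theorem abs_sphCoeff_le {W : ℝ → ℝ} (hW : ContinuousOn W (Icc (-1) 1)) {B : ℝ}
    (hB : ∀ t ∈ Icc (-1 : ℝ) 1, |W t| ≤ B) (k : ℕ) (z : Sphere n) : |sphCoeff n W k| ≤ B := by
  have hc := (continuous_eval_sdot (sphGeg n k) z).abs
  obtain ⟨x, -, hx⟩ := isCompact_univ.exists_isMaxOn ⟨z, mem_univ z⟩ hc.continuousOn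
  have hx' : ∀ y, |(sphGeg n k).eval (sdot z y)| ≤ |(sphGeg n k).eval (sdot z x)| :=
    fun y => hx (mem_univ y)
  have hpos : 0 < |(sphGeg n k).eval (sdot z x)| := by
    refine lt_of_lt_of_le ?_ (hx' z)
    rw [sdot_self]
    exact abs_pos.2 (gegPoly_eval_one_pos gegIndex_pos k).ne'
  have h := norm_integral_le_of_norm_le_const (μ := unif n)
    (f := fun y => W (sdot x y) * (sphGeg n k).eval (sdot z y))
    (C := B * |(sphGeg n k).eval (sdot z x)|) (.of_forall fun y => by
      rw [norm_mul]
      exact mul_le_mul (hB _ (sdot_mem x y)) (hx' y) (abs_nonneg _)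
        ((abs_nonneg _).trans (hB _ (sdot_mem x y))))
  rw [funk_hecke hW, norm_mul, Real.norm_eq_abs, Real.norm_eq_abs, sdot_comm x z, probReal_univ,
    mul_one] at h
  exact le_of_mul_le_mul_right h hpos

theorem sphCoeff_sub {W V : ℝ → ℝ} (hW : ContinuousOn W (Icc (-1) 1))
    (hV : ContinuousOn V (Icc (-1) 1)) (k : ℕ) (z : Sphere n) :
    sphCoeff n (fun t => W t - V t) k = sphCoeff n W k - sphCoeff n V k := by
  have h1 := (gegPoly_eval_one_pos (gegIndex_pos (n := n)) k).ne'
  apply mul_right_cancel₀ h1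
  rw [sub_mul, sphCoeff_eq (W := fun t => W t - V t) (hW.sub hV) k z, sphCoeff_eq hW k z, sphCoeff_eq hV k z,
    ← integral_sub]
  · simp only [sub_mul]
  · exact integrable_unif_of_continuous ((continuous_comp_sdot hW continuous_const continuous_id).mul
        (continuous_eval_sdot _ _))
  · exact integrable_unif_of_continuous ((continuous_comp_sdot hV continuous_const continuous_id).mul
        (continuous_eval_sdot _ _))

/-- The convolution of a function on the sphere with the `k`th Gegenbauer polynomial. -/
noncomputable def gegConv (k : ℕ) (v : Sphere n → ℝ) (x : Sphere n) : ℝ :=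
  ∫ y, (sphGeg n k).eval (sdot x y) * v y ∂(unif n)

@[fun_prop]
theorem continuous_gegConv (k : ℕ) {v : Sphere n → ℝ} (hv : Continuous v) :
    Continuous (gegConv k v) := by
  have h : Continuous fun p : Sphere n × Sphere n => (sphGeg n k).eval (sdot p.1 p.2) * v p.2 := by
    fun_prop
  unfold gegConv
  have := continuous_parametric_integral_of_continuous (μ := unif n) (s := univ)
    (f := fun x y => (sphGeg n k).eval (sdot x y) * v y) h isCompact_univ
  simpa using this

theorem integral_integral_swap_of_continuous {F : Sphere n → Sphere n → ℝ}
    (hF : Continuous fun p : Sphere n × Sphere n => F p.1 p.2) :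
    ∫ x, ∫ y, F x y ∂(unif n) ∂(unif n) = ∫ y, ∫ x, F x y ∂(unif n) ∂(unif n) :=
  integral_integral_swap
    (hF.integrable_of_hasCompactSupport (HasCompactSupport.of_compactSpace _))

theorem integral_gegConv_mul (k : ℕ) {u v : Sphere n → ℝ} (hu : Continuous u) (hv : Continuous v) :
    ∫ x, gegConv k u x * v x ∂(unif n) = ∫ x, u x * gegConv k v x ∂(unif n) := by
  calc ∫ x, gegConv k u x * v x ∂(unif n)
      = ∫ x, ∫ y, (sphGeg n k).eval (sdot x y) * u y * v x ∂(unif n) ∂(unif n) := by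
        simp only [gegConv, integral_mul_const]
    _ = ∫ y, ∫ x, (sphGeg n k).eval (sdot x y) * u y * v x ∂(unif n) ∂(unif n) :=
        integral_integral_swap_of_continuous (by fun_prop)
    _ = _ := by
        congr 1 with y
        rw [gegConv, ← integral_const_mul]
        congr 1 with x
        rw [sdot_comm]
        ring

/-- By Funk-Hecke the operators `gegConv k`, divided by the coefficient of the k-th polynomial in
its own degree, act as mutually orthogonal projections. -/
theorem gegConv_gegConv (k l : ℕ) {v : Sphere n → ℝ} (hv : Continuous v) (x : Sphere n) :
    gegConv k (gegConv l v) x =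
      sphCoeff n (fun t => (sphGeg n k).eval t) l * gegConv l v x := by
  calc gegConv k (gegConv l v) x
      = ∫ y, ∫ z, (sphGeg n k).eval (sdot x y) * ((sphGeg n l).eval (sdot y z) * v z)
          ∂(unif n) ∂(unif n) := by
        rw [gegConv]
        simp only [integral_const_mul]
        rfl
    _ = ∫ z, ∫ y, (sphGeg n k).eval (sdot x y) * ((sphGeg n l).eval (sdot y z) * v z)
          ∂(unif n) ∂(unif n) := integral_integral_swap_of_continuous (by fun_prop)
    _ = _ := by
        rw [gegConv, ← integral_const_mul]
        congr 1 with z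
        rw [← mul_assoc, ← funk_hecke_polynomial, ← integral_mul_const]
        congr 1 with y
        rw [sdot_comm y z]
        ring

theorem sphCoeff_sphGeg_of_ne {k l : ℕ} (h : k ≠ l) (z : Sphere n) :
    sphCoeff n (fun t => (sphGeg n k).eval t) l = 0 := by
  have h1 := (gegPoly_eval_one_pos (gegIndex_pos (n := n)) l).ne'
  apply mul_right_cancel₀ h1
  rw [sphCoeff_eq (Continuous.continuousOn (by fun_prop)) l z, zero_mul]
  simp only [← eval_mul]
  exact integral_sphGeg_mul_sphGeg h z

theorem sphCoeff_sphGeg_self_pos (k : ℕ) (z : Sphere n) :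
    0 < sphCoeff n (fun t => (sphGeg n k).eval t) k := by
  have h1 := gegPoly_eval_one_pos (gegIndex_pos (n := n)) k
  have h2 := integral_sphGeg_sq_pos k z
  simp only [sq] at h2
  rw [← sphCoeff_eq (W := fun t => (sphGeg n k).eval t) (Continuous.continuousOn (by fun_prop)) k z]
    at h2
  exact pos_of_mul_pos_left h2 h1.le

theorem integral_gegConv_mul_gegConv (k l : ℕ) {v : Sphere n → ℝ} (hv : Continuous v) :
    ∫ x, gegConv k v x * gegConv l v x ∂(unif n) =
      sphCoeff n (fun t => (sphGeg n k).eval t) l * ∫ x, v x * gegConv l v x ∂(unif n) := by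
  rw [integral_gegConv_mul k hv (by fun_prop), ← integral_const_mul]
  congr 1 with x
  rw [gegConv_gegConv k l hv]
  ring

theorem integral_mul_gegConv_nonneg (k : ℕ) {v : Sphere n → ℝ} (hv : Continuous v) (z : Sphere n) :
    0 ≤ ∫ x, v x * gegConv k v x ∂(unif n) := by
  have h := integral_gegConv_mul_gegConv k k hv
  have h2 : 0 ≤ ∫ x, gegConv k v x * gegConv k v x ∂(unif n) :=
    integral_nonneg fun x => mul_self_nonneg _
  rw [h] at h2
  exact nonneg_of_mul_nonneg_right h2 (sphCoeff_sphGeg_self_pos k z)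

/-- Bessel's inequality for the projections to the spaces of spherical harmonics. -/
theorem bessel_gegConv (N : ℕ) {v : Sphere n → ℝ} (hv : Continuous v) (z : Sphere n) :
    ∑ k ∈ Finset.range N, (sphCoeff n (fun t => (sphGeg n k).eval t) k)⁻¹ *
      ∫ x, v x * gegConv k v x ∂(unif n) ≤ ∫ x, v x ^ 2 ∂(unif n) := by
  set s : ℕ → ℝ := fun k => sphCoeff n (fun t => (sphGeg n k).eval t) k with hs
  have hs0 : ∀ k, s k ≠ 0 := fun k => (sphCoeff_sphGeg_self_pos k z).ne'
  -- w is the projection of v to the harmonics of degree below N. It satisfies ⟨w, w⟩ = ⟨v, w⟩, so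
  -- ‖v - w‖² ≥ 0 is the claim.
  set w : Sphere n → ℝ := fun x => ∑ k ∈ Finset.range N, (s k)⁻¹ * gegConv k v x with hw
  have hwc : Continuous w := by fun_prop
  have hvw : ∫ x, v x * w x ∂(unif n) =
      ∑ k ∈ Finset.range N, (s k)⁻¹ * ∫ x, v x * gegConv k v x ∂(unif n) := by
    simp only [hw, Finset.mul_sum]
    rw [integral_finsetSum _ fun i _ => integrable_unif_of_continuous (by fun_prop)]
    refine Finset.sum_congr rfl fun k _ => ?_
    rw [← integral_const_mul]
    congr 1 with x
    ring
  have hwT : ∀ l ∈ Finset.range N, ∫ x, w x * gegConv l v x ∂(unif n) =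
      ∫ x, v x * gegConv l v x ∂(unif n) := by
    intro l hl
    simp only [hw, Finset.sum_mul]
    rw [integral_finsetSum _ fun i _ => integrable_unif_of_continuous (by fun_prop),
      Finset.sum_eq_single_of_mem l hl]
    · simp only [mul_assoc]
      rw [integral_const_mul, integral_gegConv_mul_gegConv l l hv, ← mul_assoc]
      change (s l)⁻¹ * s l * _ = _
      rw [inv_mul_cancel₀ (hs0 l), one_mul]
    · intro k _ hkl
      simp only [mul_assoc]
      rw [integral_const_mul, integral_gegConv_mul_gegConv k l hv, sphCoeff_sphGeg_of_ne hkl z]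
      ring
  have hww : ∫ x, w x * w x ∂(unif n) = ∫ x, v x * w x ∂(unif n) := by
    rw [hvw]
    have : ∀ x, w x * w x = ∑ k ∈ Finset.range N, (s k)⁻¹ * (w x * gegConv k v x) := by
      intro x
      nth_rewrite 2 [hw]
      rw [Finset.mul_sum]
      exact Finset.sum_congr rfl fun k _ => by ring
    simp only [this]
    rw [integral_finsetSum _ fun i _ => integrable_unif_of_continuous (by fun_prop)]
    refine Finset.sum_congr rfl fun k hk => ?_
    rw [integral_const_mul, hwT k hk]
  have h0 : 0 ≤ ∫ x, (v x - w x) ^ 2 ∂(unif n) := integral_nonneg fun x => sq_nonneg _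
  have he : ∫ x, (v x - w x) ^ 2 ∂(unif n) =
      ∫ x, v x ^ 2 ∂(unif n) - 2 * ∫ x, v x * w x ∂(unif n) + ∫ x, w x * w x ∂(unif n) := by
    rw [← integral_const_mul, ← integral_sub, ← integral_add]
    · congr 1 with x
      ring
    all_goals exact integrable_unif_of_continuous (by fun_prop)
  rw [he, hww, hvw] at h0
  linarith

/-- A polynomial kernel is a finite combination of the projections, and degree 0 drops out as v has
mean zero. Completeness is replaced by Bessel's inequality, which has the useful direction because
`lam ≤ 0`. -/
theorem le_integral_polynomial_kernel (p : ℝ[X]) {lam : ℝ} (hlam : lam ≤ 0)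
    {v : Sphere n → ℝ} (hv : Continuous v) (hv0 : ∫ x, v x ∂(unif n) = 0)
    (hp : ∀ k, 1 ≤ k → lam ≤ sphCoeff n (fun t => p.eval t) k) (z : Sphere n) :
    lam * ∫ x, v x ^ 2 ∂(unif n) ≤
      ∫ x, v x * ∫ y, p.eval (sdot x y) * v y ∂(unif n) ∂(unif n) := by
  obtain ⟨b, hb⟩ := exists_gegPoly_sum (gegIndex_pos (n := n)) p le_rfl
  set N := p.natDegree + 1
  set s : ℕ → ℝ := fun k => sphCoeff n (fun t => (sphGeg n k).eval t) k with hs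
  have hs0 : ∀ k, 0 < s k := fun k => sphCoeff_sphGeg_self_pos k z
  have hcoef : ∀ k ∈ Finset.range N, sphCoeff n (fun t => p.eval t) k = b k * s k := by
    intro k hk
    have h1 := (gegPoly_eval_one_pos (gegIndex_pos (n := n)) k).ne'
    apply mul_right_cancel₀ h1
    rw [mul_assoc, hs, sphCoeff_eq (Continuous.continuousOn (by fun_prop)) k z,
      sphCoeff_eq (Continuous.continuousOn (by fun_prop)) k z, hb]
    simp only [eval_finsetSum, Finset.sum_mul, eval_smul, smul_eq_mul]
    rw [integral_finsetSum _ fun i _ => integrable_unif_of_continuous (by fun_prop),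
      Finset.sum_eq_single_of_mem k hk]
    · simp only [mul_assoc]
      rw [integral_const_mul]
    · intro j _ hj
      simp only [mul_assoc]
      rw [integral_const_mul]
      simp only [← eval_mul]
      rw [integral_sphGeg_mul_sphGeg hj, mul_zero]
  have hquad : ∫ x, v x * ∫ y, p.eval (sdot x y) * v y ∂(unif n) ∂(unif n) =
      ∑ k ∈ Finset.range N, b k * ∫ x, v x * gegConv k v x ∂(unif n) := by
    have h1 : ∀ x, ∫ y, p.eval (sdot x y) * v y ∂(unif n) =
        ∑ k ∈ Finset.range N, b k * gegConv k v x := by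
      intro x
      nth_rewrite 1 [hb]
      simp only [eval_finsetSum, Finset.sum_mul, eval_smul, smul_eq_mul]
      rw [integral_finsetSum _ fun i _ => integrable_unif_of_continuous (by fun_prop)]
      refine Finset.sum_congr rfl fun k _ => ?_
      rw [gegConv, ← integral_const_mul]
      simp only [mul_assoc]
    simp only [h1, Finset.mul_sum]
    rw [integral_finsetSum _ fun i _ => integrable_unif_of_continuous (by fun_prop)]
    refine Finset.sum_congr rfl fun k _ => ?_
    rw [← integral_const_mul]
    congr 1 with x
    ring
  have hT0 : ∫ x, v x * gegConv 0 v x ∂(unif n) = 0 := by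
    simp [gegConv, gegPoly, hv0]
  calc lam * ∫ x, v x ^ 2 ∂(unif n)
      ≤ lam * ∑ k ∈ Finset.range N, (s k)⁻¹ * ∫ x, v x * gegConv k v x ∂(unif n) :=
        mul_le_mul_of_nonpos_left (bessel_gegConv N hv z) hlam
    _ = ∑ k ∈ Finset.range N, lam * ((s k)⁻¹ * ∫ x, v x * gegConv k v x ∂(unif n)) :=
        Finset.mul_sum _ _ _
    _ ≤ ∑ k ∈ Finset.range N, b k * ∫ x, v x * gegConv k v x ∂(unif n) := by
        refine Finset.sum_le_sum fun k hk => ?_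
        rcases Nat.eq_zero_or_pos k with rfl | hk0
        · simp [hT0]
        · rw [← mul_assoc]
          refine mul_le_mul_of_nonneg_right ?_ (integral_mul_gegConv_nonneg k hv z)
          rw [← div_eq_mul_inv, div_le_iff₀ (hs0 k), ← hcoef k hk]
          exact hp k hk0
    _ = _ := hquad.symm

/-- The convolution operator with kernel `W` is bounded below, on functions of mean zero, by any
nonpositive lower bound of the coefficients of positive degree. -/
theorem le_integral_kernel {W : ℝ → ℝ} (hW : ContinuousOn W (Icc (-1) 1)) {lam : ℝ}
    (hlam : lam ≤ 0) {v : Sphere n → ℝ} (hv : Continuous v) (hv0 : ∫ x, v x ∂(unif n) = 0)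
    (hp : ∀ k, 1 ≤ k → lam ≤ sphCoeff n W k) (z : Sphere n) :
    lam * ∫ x, v x ^ 2 ∂(unif n) ≤
      ∫ x, v x * ∫ y, W (sdot x y) * v y ∂(unif n) ∂(unif n) := by
  obtain ⟨p, hpW⟩ := exists_polynomial_seq hW
  have hpc : ∀ j, ContinuousOn (fun t => (p j).eval t) (Icc (-1) 1) := fun j => by fun_prop
  -- A uniform error 1/(j+1) of the kernel moves all coefficients by at most 1/(j+1), uniformly in
  -- the degree.
  have hj : ∀ j : ℕ, (lam - 1 / ((j : ℝ) + 1)) * ∫ x, v x ^ 2 ∂(unif n) ≤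
      ∫ x, v x * ∫ y, (p j).eval (sdot x y) * v y ∂(unif n) ∂(unif n) := by
    intro j
    have hj0 : 0 ≤ 1 / ((j : ℝ) + 1) := by positivity
    refine le_integral_polynomial_kernel (p j) (by linarith) hv hv0 (fun k hk => ?_) z
    have h1 := abs_sphCoeff_le (W := fun t => (p j).eval t - W t) ((hpc j).sub hW) (hpW j) k z
    rw [sphCoeff_sub (hpc j) hW k z] at h1
    have := (abs_le.1 h1).1
    linarith [hp k hk]
  have hl : Tendsto (fun j : ℕ => (lam - 1 / ((j : ℝ) + 1)) * ∫ x, v x ^ 2 ∂(unif n)) atTop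
      (𝓝 ((lam - 0) * ∫ x, v x ^ 2 ∂(unif n))) :=
    (tendsto_one_div_add_atTop_nhds_zero_nat.const_sub lam).mul_const _
  rw [sub_zero] at hl
  refine le_of_tendsto_of_tendsto' hl ?_ hj
  obtain ⟨M, hM0, hM⟩ := exists_abs_le_of_continuous hv
  have cont : ∀ V : ℝ → ℝ, ContinuousOn V (Icc (-1) 1) →
      Continuous fun x : Sphere n => ∫ y, V (sdot x y) * v y ∂(unif n) := by
    intro V hV
    have := continuous_parametric_integral_of_continuous (μ := unif n) (s := univ)
      (f := fun x y => V (sdot x y) * v y)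
      ((continuous_comp_sdot hV continuous_fst continuous_snd).mul (hv.comp continuous_snd))
      isCompact_univ
    simpa using this
  refine tendsto_integral_of_forall_abs_sub_le
    (fun j => integrable_unif_of_continuous (hv.mul (cont _ (hpc j))))
    (integrable_unif_of_continuous (hv.mul (cont W hW)))
    (tendsto_const_mul_one_div (M * M)) fun j x => ?_
  have ic : ∀ V : ℝ → ℝ, ContinuousOn V (Icc (-1) 1) →
      Integrable (fun y => V (sdot x y) * v y) (unif n) := fun V hV =>
    integrable_unif_of_continuous ((continuous_comp_sdot hV continuous_const continuous_id).mul hv)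
  rw [← mul_sub, ← integral_sub (ic _ (hpc j)) (ic W hW), abs_mul, mul_left_comm]
  have h2 := norm_integral_le_of_norm_le_const (μ := unif n)
    (f := fun y => (p j).eval (sdot x y) * v y - W (sdot x y) * v y)
    (C := 1 / ((j : ℝ) + 1) * M) (.of_forall fun y => by
      rw [← sub_mul, norm_mul]
      exact mul_le_mul (hpW j _ (sdot_mem x y)) (hM y) (abs_nonneg _) (by positivity))
  rw [probReal_univ, mul_one, Real.norm_eq_abs] at h2
  exact mul_le_mul (hM x) h2 (abs_nonneg _) hM0

end Operator

/-- With a = √r, b = √g the entropy expression dominates (a - b)², and |r - g| = |a - b|(a + b) is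
split by Young's inequality with weight s. Being linear in the integrated quantities, the bound can
be integrated before s is chosen. -/
theorem abs_sub_le_entropy {r g s : ℝ} (hr : 0 < r) (hg : 0 < g) (hs : 0 < s) :
    |r - g| ≤ (r * Real.log r - r * Real.log g - r + g) / (2 * s) + s * (r + g) := by
  set a := Real.sqrt r with ha
  set b := Real.sqrt g with hb
  have ha0 : 0 < a := Real.sqrt_pos.2 hr
  have hb0 : 0 < b := Real.sqrt_pos.2 hg
  have hra : r = a ^ 2 := (Real.sq_sqrt hr.le).symm
  have hgb : g = b ^ 2 := (Real.sq_sqrt hg.le).symm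
  have hlog : Real.log b - Real.log a ≤ b / a - 1 := by
    rw [← Real.log_div hb0.ne' ha0.ne']
    exact Real.log_le_sub_one_of_pos (by positivity)
  have hD : (a - b) ^ 2 ≤ r * Real.log r - r * Real.log g - r + g := by
    rw [hra, hgb, Real.log_pow, Real.log_pow]
    have h1 : a ^ 2 * (Real.log b - Real.log a) ≤ a ^ 2 * (b / a - 1) :=
      mul_le_mul_of_nonneg_left hlog (by positivity)
    have h2 : a ^ 2 * (b / a - 1) = a * b - a ^ 2 := by field_simp
    push_cast
    linarith
  have h3 : |r - g| = |a - b| * (a + b) := by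
    rw [hra, hgb, sq_sub_sq, abs_mul, abs_of_pos (by positivity : 0 < a + b), mul_comm]
  have h4 : |a - b| * (a + b) ≤ (a - b) ^ 2 / (2 * s) + s * (a ^ 2 + b ^ 2) := by
    rw [← sq_abs (a - b)]
    set c := |a - b|
    have e : c ^ 2 / (2 * s) + s * (a ^ 2 + b ^ 2) - c * (a + b) =
        ((c - s * (a + b)) ^ 2 + s ^ 2 * (a - b) ^ 2) / (2 * s) := by
      field_simp
      ring
    have : 0 ≤ ((c - s * (a + b)) ^ 2 + s ^ 2 * (a - b) ^ 2) / (2 * s) := by positivity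
    linarith
  rw [h3]
  refine h4.trans ?_
  rw [← hra, ← hgb]
  gcongr

/-! ### Gibbs densities and relative entropy on a compact metric space -/

section MeanField

variable {X : Type*} [MetricSpace X] [CompactSpace X] [MeasurableSpace X] [BorelSpace X]
  {m : Measure X}

/-- Almost everywhere positive probability densities of finite entropy. -/
structure IsDensity (m : Measure X) (ρ : X → ℝ) : Prop where
  measurable : Measurable ρ
  pos : ∀ᵐ x ∂m, 0 < ρ x
  integrable : Integrable ρ m
  integral_eq_one : ∫ x, ρ x ∂m = 1
  integrable_entropy : Integrable (fun x => ρ x * Real.log (ρ x)) m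

/-- The entropy of a density. -/
noncomputable def densEntropy (m : Measure X) (ρ : X → ℝ) : ℝ := ∫ x, ρ x * Real.log (ρ x) ∂m

/-- The potential created by `f`. -/
noncomputable def pot (m : Measure X) (K : X → X → ℝ) (f : X → ℝ) (x : X) : ℝ :=
  ∫ y, K x y * f y ∂m

/-- The bilinear form of the kernel `K`. -/
noncomputable def bil (m : Measure X) (K : X → X → ℝ) (f g : X → ℝ) : ℝ :=
  ∫ x, f x * pot m K g x ∂m

/-- The free energy of a density. -/
noncomputable def densEnergy (m : Measure X) (K : X → X → ℝ) (γ : ℝ) (ρ : X → ℝ) : ℝ :=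
  γ⁻¹ * densEntropy m ρ + 1 / 2 * bil m K ρ ρ

/-- The normalization of the Gibbs density. -/
noncomputable def partition (m : Measure X) (γ : ℝ) (V : X → ℝ) : ℝ := ∫ x, Real.exp (-γ * V x) ∂m

/-- The Gibbs density of the potential `V`. -/
noncomputable def gibbs (m : Measure X) (γ : ℝ) (V : X → ℝ) (x : X) : ℝ :=
  Real.exp (-γ * V x) / partition m γ V

variable [IsProbabilityMeasure m]

theorem integrable_of_continuous {f : X → ℝ} (hf : Continuous f) : Integrable f m :=
  hf.integrable_of_hasCompactSupport (HasCompactSupport.of_compactSpace f)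

theorem integrable_continuous_mul {f g : X → ℝ} (hf : Continuous f) (hg : Integrable g m) :
    Integrable (fun x => f x * g x) m := by
  obtain ⟨C, _, hC⟩ := exists_abs_le_of_continuous hf
  exact hg.bdd_mul hf.aestronglyMeasurable (.of_forall hC)

theorem IsDensity.integral_abs {ρ : X → ℝ} (h : IsDensity m ρ) : ∫ x, |ρ x| ∂m = 1 := by
  rw [← h.integral_eq_one]
  refine integral_congr_ae ?_
  filter_upwards [h.pos] with x hx
  exact abs_of_pos hx

section Gibbs

variable {γ : ℝ} {V : X → ℝ}

theorem partition_pos (hV : Continuous V) : 0 < partition m γ V :=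
  integral_exp_pos (integrable_of_continuous (by fun_prop))

@[fun_prop]
theorem continuous_gibbs (hV : Continuous V) : Continuous (gibbs m γ V) := by
  unfold gibbs
  fun_prop

theorem gibbs_pos (hV : Continuous V) (x : X) : 0 < gibbs m γ V x :=
  div_pos (Real.exp_pos _) (partition_pos hV)

theorem log_gibbs (hV : Continuous V) (x : X) :
    Real.log (gibbs m γ V x) = -γ * V x - Real.log (partition m γ V) := by
  rw [gibbs, Real.log_div (Real.exp_pos _).ne' (partition_pos hV).ne', Real.log_exp]

theorem integral_gibbs (hV : Continuous V) : ∫ x, gibbs m γ V x ∂m = 1 := by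
  simp only [gibbs, integral_div]
  exact div_self (partition_pos hV).ne'

theorem isDensity_gibbs (hV : Continuous V) : IsDensity m (gibbs m γ V) where
  measurable := (continuous_gibbs hV).measurable
  pos := .of_forall (gibbs_pos hV)
  integrable := integrable_of_continuous (continuous_gibbs hV)
  integral_eq_one := integral_gibbs hV
  integrable_entropy := by
    simp only [log_gibbs hV]
    exact integrable_of_continuous (by fun_prop)

/-- The relative entropy of a density with respect to the Gibbs density of `V`. -/
noncomputable def gibbsDivergence (m : Measure X) (γ : ℝ) (V ρ : X → ℝ) : ℝ :=
  densEntropy m ρ + γ * ∫ x, ρ x * V x ∂m + Real.log (partition m γ V)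

/-- The terms -ρ + g integrate to zero; they are included to make the integrand pointwise
nonnegative, as `abs_sub_le_entropy` requires. -/
theorem gibbsDivergence_eq_integral (hV : Continuous V) {ρ : X → ℝ} (hρ : IsDensity m ρ) :
    gibbsDivergence m γ V ρ =
      ∫ x, (ρ x * Real.log (ρ x) - ρ x * Real.log (gibbs m γ V x) - ρ x + gibbs m γ V x) ∂m ∧
    Integrable (fun x => ρ x * Real.log (ρ x) - ρ x * Real.log (gibbs m γ V x) - ρ x +
      gibbs m γ V x) m := by
  have i1 : Integrable (fun x => γ * (ρ x * V x)) m := by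
    refine ((integrable_continuous_mul hV hρ.integrable).const_mul γ).congr (.of_forall fun x => ?_)
    ring
  have i2 := hρ.integrable.const_mul (Real.log (partition m γ V))
  have i3 := (isDensity_gibbs (m := m) (γ := γ) hV).integrable
  have j1 := hρ.integrable_entropy.fun_add i1
  have j2 := j1.fun_add i2
  have j3 : Integrable (fun x => ρ x * Real.log (ρ x) + γ * (ρ x * V x) +
      Real.log (partition m γ V) * ρ x - ρ x) m := j2.sub hρ.integrable
  have e : ∀ x, ρ x * Real.log (ρ x) - ρ x * Real.log (gibbs m γ V x) - ρ x + gibbs m γ V x =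
      ρ x * Real.log (ρ x) + γ * (ρ x * V x) + Real.log (partition m γ V) * ρ x - ρ x +
        gibbs m γ V x := by
    intro x
    rw [log_gibbs hV]
    ring
  simp only [e]
  refine ⟨?_, j3.fun_add i3⟩
  rw [integral_add j3 i3, integral_sub j2 hρ.integrable, integral_add j1 i2, integral_add hρ.integrable_entropy i1,
    integral_const_mul, integral_const_mul, integral_gibbs hV, hρ.integral_eq_one]
  rw [gibbsDivergence, densEntropy]
  ring

theorem gibbsDivergence_gibbs (hV : Continuous V) : gibbsDivergence m γ V (gibbs m γ V) = 0 := by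
  rw [(gibbsDivergence_eq_integral hV (isDensity_gibbs hV)).1]
  simp

/-- A Csiszár-Kullback inequality. -/
theorem sq_integral_abs_sub_gibbs_le (hV : Continuous V) {ρ : X → ℝ} (hρ : IsDensity m ρ) :
    (∫ x, |ρ x - gibbs m γ V x| ∂m) ^ 2 ≤ 4 * gibbsDivergence m γ V ρ := by
  obtain ⟨hD, hDi⟩ := gibbsDivergence_eq_integral (γ := γ) hV hρ
  have hg := isDensity_gibbs (m := m) (γ := γ) hV
  set N := ∫ x, |ρ x - gibbs m γ V x| ∂m with hN
  have hN0 : 0 ≤ N := integral_nonneg fun x => abs_nonneg _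
  have key : ∀ s : ℝ, 0 < s → N ≤ gibbsDivergence m γ V ρ / (2 * s) + s * 2 := by
    intro s hs
    have e : gibbsDivergence m γ V ρ / (2 * s) + s * 2 =
        ∫ x, ((ρ x * Real.log (ρ x) - ρ x * Real.log (gibbs m γ V x) - ρ x + gibbs m γ V x) /
          (2 * s) + s * (ρ x + gibbs m γ V x)) ∂m := by
      rw [integral_add (hDi.div_const _) ((hρ.integrable.fun_add hg.integrable).const_mul _),
        integral_div, integral_const_mul, integral_add hρ.integrable hg.integrable,
        hρ.integral_eq_one, hg.integral_eq_one, hD]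
      norm_num
    rw [e]
    refine integral_mono_ae (hρ.integrable.sub hg.integrable).abs
      ((hDi.div_const _).add ((hρ.integrable.fun_add hg.integrable).const_mul _)) ?_
    filter_upwards [hρ.pos] with x hx
    exact abs_sub_le_entropy hx (gibbs_pos hV x) hs
  -- The best weight is s = N/4. For N = 0 that choice is not allowed, and nonnegativity of the
  -- divergence follows by letting s be small.
  rcases hN0.eq_or_lt with h0 | h0
  · have h1 := key 1 one_pos
    rw [← h0]
    have hlim : ∀ s : ℝ, 0 < s → -(4 * s ^ 2) ≤ gibbsDivergence m γ V ρ := by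
      intro s hs
      have := key s hs
      rw [← h0] at this
      have h2 : 0 ≤ (gibbsDivergence m γ V ρ / (2 * s) + s * 2) * (2 * s) := by positivity
      rw [add_mul, div_mul_cancel₀ _ (by positivity)] at h2
      linarith
    by_contra hneg
    have hneg' : gibbsDivergence m γ V ρ < 0 := by linarith
    have := hlim (Real.sqrt (-gibbsDivergence m γ V ρ / 8)) (Real.sqrt_pos.2 (by linarith))
    rw [Real.sq_sqrt (by linarith)] at this
    linarith
  · have h1 := key (N / 4) (by positivity)
    have h2 : gibbsDivergence m γ V ρ / (2 * (N / 4)) + N / 4 * 2 =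
        (2 * gibbsDivergence m γ V ρ) / N + N / 2 := by
      field_simp
      ring
    rw [h2] at h1
    have h3 : N / 2 ≤ 2 * gibbsDivergence m γ V ρ / N := by linarith
    rw [le_div_iff₀ h0] at h3
    linarith

theorem gibbsDivergence_nonneg (hV : Continuous V) {ρ : X → ℝ} (hρ : IsDensity m ρ) :
    0 ≤ gibbsDivergence m γ V ρ := by
  have := sq_integral_abs_sub_gibbs_le (γ := γ) hV hρ
  nlinarith [sq_nonneg (∫ x, |ρ x - gibbs m γ V x| ∂m)]

theorem gibbs_const (c : ℝ) (x : X) : gibbs m γ (fun _ => c) x = 1 := by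
  simp [gibbs, partition]

theorem isDensity_one : IsDensity m (fun _ => 1) := by
  have := isDensity_gibbs (m := m) (γ := 0) (V := fun _ => (0 : ℝ)) continuous_const
  simpa only [funext (gibbs_const (m := m) (γ := 0) (0 : ℝ))] using this

theorem densEntropy_one : densEntropy m (fun _ => 1) = 0 := by simp [densEntropy]

theorem sq_integral_abs_sub_one_le {ρ : X → ℝ} (hρ : IsDensity m ρ) :
    (∫ x, |ρ x - 1| ∂m) ^ 2 ≤ 4 * densEntropy m ρ := by
  have := sq_integral_abs_sub_gibbs_le (γ := 0) (V := fun _ => (0 : ℝ)) continuous_const hρ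
  simpa [gibbsDivergence, gibbs_const, partition] using this

theorem partition_le {V' : X → ℝ} {d : ℝ} (hγ : 0 ≤ γ) (hV : Continuous V) (hV' : Continuous V')
    (h : ∀ x, |V' x - V x| ≤ d) : partition m γ V' ≤ Real.exp (γ * d) * partition m γ V := by
  rw [partition, partition, ← integral_const_mul]
  refine integral_mono (integrable_of_continuous (by fun_prop))
    (integrable_of_continuous (by fun_prop)) fun x => ?_
  simp only
  rw [← Real.exp_add, Real.exp_le_exp]
  nlinarith [(abs_le.1 (h x)).1]

theorem abs_log_partition_sub_le {V' : X → ℝ} {d : ℝ} (hγ : 0 ≤ γ) (hV : Continuous V)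
    (hV' : Continuous V') (h : ∀ x, |V' x - V x| ≤ d) :
    |Real.log (partition m γ V') - Real.log (partition m γ V)| ≤ γ * d := by
  have h1 := Real.log_le_log (partition_pos hV') (partition_le (m := m) hγ hV hV' h)
  have h2 := Real.log_le_log (partition_pos hV) (partition_le (m := m) hγ hV' hV
    fun x => (abs_sub_comm _ _).trans_le (h x))
  rw [Real.log_mul (Real.exp_pos _).ne' (partition_pos hV).ne', Real.log_exp] at h1
  rw [Real.log_mul (Real.exp_pos _).ne' (partition_pos hV').ne', Real.log_exp] at h2
  rw [abs_le]
  constructor <;> linarith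

/-- The logarithm of the Gibbs density moves by at most 2γd: γd from the potential and γd from the
normalization. -/
theorem abs_gibbs_sub_le {V' : X → ℝ} {d : ℝ} (hγ : 0 ≤ γ) (hV : Continuous V)
    (hV' : Continuous V') (h : ∀ x, |V' x - V x| ≤ d) (x : X) :
    |gibbs m γ V' x - gibbs m γ V x| ≤ (Real.exp (2 * γ * d) - 1) * gibbs m γ V x := by
  have hd : 0 ≤ d := (abs_nonneg _).trans (h x)
  have h1 : |Real.log (gibbs m γ V' x) - Real.log (gibbs m γ V x)| ≤ 2 * γ * d := by
    rw [log_gibbs hV, log_gibbs hV']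
    have h2 := abs_log_partition_sub_le (m := m) hγ hV hV' h
    have h3 : |γ * (V' x - V x)| ≤ γ * d := by
      rw [abs_mul, abs_of_nonneg hγ]
      exact mul_le_mul_of_nonneg_left (h x) hγ
    rw [abs_le] at h2 h3 ⊢
    constructor <;> linarith
  have hp := gibbs_pos (m := m) (γ := γ) hV x
  have hp' := gibbs_pos (m := m) (γ := γ) hV' x
  set g := gibbs m γ V x
  set g' := gibbs m γ V' x
  rw [abs_le] at h1
  have h4 : g' ≤ Real.exp (2 * γ * d) * g := by
    rw [← Real.log_le_log_iff hp' (by positivity), Real.log_mul (Real.exp_pos _).ne' hp.ne',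
      Real.log_exp]
    linarith
  have h5 : Real.exp (-(2 * γ * d)) * g ≤ g' := by
    rw [← Real.log_le_log_iff (by positivity) hp', Real.log_mul (Real.exp_pos _).ne' hp.ne',
      Real.log_exp]
    linarith
  -- Since 1 - exp(-s) ≤ exp(s) - 1, the bound from below is also covered.
  have h6 : 2 ≤ Real.exp (2 * γ * d) + Real.exp (-(2 * γ * d)) := by
    have := Real.one_le_cosh (2 * γ * d)
    rw [Real.cosh_eq] at this
    linarith
  rw [abs_le]
  constructor <;> nlinarith

end Gibbs

section Kernel

variable {K : X → X → ℝ} {B : ℝ}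

theorem integrable_kernel_mul (hK : Continuous fun p : X × X => K p.1 p.2) {f : X → ℝ}
    (hf : Integrable f m) (x : X) : Integrable (fun y => K x y * f y) m :=
  integrable_continuous_mul (by fun_prop) hf

theorem abs_pot_le (hB : ∀ x y, |K x y| ≤ B) {f : X → ℝ}
    (hf : Integrable f m) (x : X) : |pot m K f x| ≤ B * ∫ y, |f y| ∂m := by
  rw [pot, ← integral_const_mul, ← Real.norm_eq_abs]
  refine norm_integral_le_of_norm_le (hf.abs.const_mul B) (.of_forall fun y => ?_)
  rw [norm_mul]
  exact mul_le_mul_of_nonneg_right (hB x y) (abs_nonneg _)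

theorem continuous_pot (hK : Continuous fun p : X × X => K p.1 p.2) (hB : ∀ x y, |K x y| ≤ B)
    {f : X → ℝ} (hf : Integrable f m) : Continuous (pot m K f) := by
  unfold pot
  refine continuous_of_dominated (bound := fun y => B * |f y|)
    (fun x => (integrable_kernel_mul hK hf x).aestronglyMeasurable)
    (fun x => .of_forall fun y => ?_) (hf.abs.const_mul B) (.of_forall fun y => by fun_prop)
  rw [norm_mul]
  exact mul_le_mul_of_nonneg_right (hB x y) (abs_nonneg _)

theorem pot_add_mul (hK : Continuous fun p : X × X => K p.1 p.2) {f g : X → ℝ}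
    (hf : Integrable f m) (hg : Integrable g m) (t : ℝ) (x : X) :
    pot m K (fun y => f y + t * g y) x = pot m K f x + t * pot m K g x := by
  rw [pot, pot, pot, ← integral_const_mul,
    ← integral_add (integrable_kernel_mul hK hf x) ((integrable_kernel_mul hK hg x).const_mul t)]
  congr 1 with y
  ring

theorem abs_bil_le (hB : ∀ x y, |K x y| ≤ B)
    {f g : X → ℝ} (hf : Integrable f m) (hg : Integrable g m) :
    |bil m K f g| ≤ B * (∫ x, |f x| ∂m) * ∫ x, |g x| ∂m := by
  have h : B * (∫ x, |f x| ∂m) * ∫ x, |g x| ∂m = ∫ x, |f x| * (B * ∫ y, |g y| ∂m) ∂m := by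
    rw [integral_mul_const]
    ring
  rw [bil, h, ← Real.norm_eq_abs]
  refine norm_integral_le_of_norm_le (hf.abs.mul_const _) (.of_forall fun x => ?_)
  rw [norm_mul]
  exact mul_le_mul_of_nonneg_left (abs_pot_le hB hg x) (abs_nonneg _)

theorem bil_comm (hK : Continuous fun p : X × X => K p.1 p.2) (hs : ∀ x y, K x y = K y x)
    {f g : X → ℝ} (hf : Integrable f m) (hg : Integrable g m) :
    bil m K f g = bil m K g f := by
  have hi : Integrable (fun p : X × X => K p.1 p.2 * (f p.1 * g p.2)) (m.prod m) := by
    obtain ⟨C, _, hC⟩ := exists_abs_le_of_continuous hK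
    exact (hf.mul_prod hg).bdd_mul hK.aestronglyMeasurable (.of_forall hC)
  calc bil m K f g = ∫ x, ∫ y, K x y * (f x * g y) ∂m ∂m := by
        rw [bil]
        congr 1 with x
        rw [pot, ← integral_const_mul]
        congr 1 with y
        ring
    _ = ∫ y, ∫ x, K x y * (f x * g y) ∂m ∂m := integral_integral_swap hi
    _ = bil m K g f := by
        rw [bil]
        congr 1 with y
        rw [pot, ← integral_const_mul]
        congr 1 with x
        rw [hs]
        ring

theorem integrable_mul_pot (hK : Continuous fun p : X × X => K p.1 p.2)
    (hB : ∀ x y, |K x y| ≤ B) {f g : X → ℝ} (hf : Integrable f m) (hg : Integrable g m) :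
    Integrable (fun x => f x * pot m K g x) m := by
  simp only [mul_comm (f _)]
  exact integrable_continuous_mul (continuous_pot hK hB hg) hf

theorem bil_add_mul (hK : Continuous fun p : X × X => K p.1 p.2) (hB : ∀ x y, |K x y| ≤ B)
    (hs : ∀ x y, K x y = K y x) {f g : X → ℝ} (hf : Integrable f m) (hg : Integrable g m) (t : ℝ) :
    bil m K (fun x => f x + t * g x) (fun x => f x + t * g x) =
      bil m K f f + 2 * t * bil m K g f + t ^ 2 * bil m K g g := by
  have i := fun {f g : X → ℝ} (hf : Integrable f m) (hg : Integrable g m) =>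
    integrable_mul_pot (m := m) hK hB hf hg
  have h1 : bil m K (fun x => f x + t * g x) (fun x => f x + t * g x) =
      ∫ x, (f x * pot m K f x + t * (g x * pot m K f x) + t * (f x * pot m K g x) +
        t ^ 2 * (g x * pot m K g x)) ∂m := by
    rw [bil]
    congr 1 with x
    rw [pot_add_mul hK hf hg]
    ring
  rw [h1, integral_add
      (((i hf hf).fun_add ((i hg hf).const_mul t)).fun_add ((i hf hg).const_mul t))
      ((i hg hg).const_mul _), integral_add ((i hf hf).fun_add ((i hg hf).const_mul t))
      ((i hf hg).const_mul t), integral_add (i hf hf) ((i hg hf).const_mul t), integral_const_mul,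
      integral_const_mul, integral_const_mul]
  change bil m K f f + t * bil m K g f + t * bil m K f g + t ^ 2 * bil m K g g = _
  rw [bil_comm hK hs hf hg]
  ring

theorem abs_bil_self_sub_le (hK : Continuous fun p : X × X => K p.1 p.2)
    (hB : ∀ x y, |K x y| ≤ B) (hs : ∀ x y, K x y = K y x) {ρ g : X → ℝ} (hρ : Integrable ρ m)
    (hg : IsDensity m g) :
    |bil m K ρ ρ - bil m K g g| ≤
      2 * B * ∫ x, |ρ x - g x| ∂m + B * (∫ x, |ρ x - g x| ∂m) ^ 2 := by
  have hi : Integrable (fun x => ρ x - g x) m := hρ.sub hg.integrable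
  have h := bil_add_mul hK hB hs hg.integrable hi 1
  have e : (fun x => g x + 1 * (ρ x - g x)) = ρ := by
    ext x
    ring
  rw [e] at h
  have h1 := abs_bil_le hB hi hg.integrable
  have h2 := abs_bil_le hB hi hi
  rw [hg.integral_abs, mul_one] at h1
  have e2 : bil m K ρ ρ - bil m K g g = 2 * bil m K (fun x => ρ x - g x) g +
      bil m K (fun x => ρ x - g x) (fun x => ρ x - g x) := by
    rw [h]
    ring
  rw [e2]
  refine (abs_add_le _ _).trans (add_le_add ?_ ?_)
  · rw [abs_mul, abs_two, mul_assoc]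
    linarith
  · rw [sq, ← mul_assoc]
    exact h2

end Kernel

end MeanField

/-! ### Minimizers of the mean field free energy -/

section Variational

variable {X : Type*} [MetricSpace X] [CompactSpace X] [MeasurableSpace X] [BorelSpace X]
  {m : Measure X} [IsProbabilityMeasure m] {K : X → X → ℝ} {B γ : ℝ}

theorem mul_log_convex {a b t : ℝ} (ha : 0 < a) (hb : 0 < b) (ht0 : 0 ≤ t) (ht1 : t ≤ 1) :
    (a + t * (b - a)) * Real.log (a + t * (b - a)) ≤
      (1 - t) * (a * Real.log a) + t * (b * Real.log b) := by
  have h := Real.convexOn_mul_log.2 (mem_Ici.2 ha.le) (mem_Ici.2 hb.le) (sub_nonneg.2 ht1) ht0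
    (by ring)
  simp only [smul_eq_mul] at h
  have e : (1 - t) * a + t * b = a + t * (b - a) := by ring
  rwa [e] at h

theorem sub_one_le_mul_log {a : ℝ} (ha : 0 < a) : a - 1 ≤ a * Real.log a := by
  have h := Real.one_sub_inv_le_log_of_pos ha
  have h2 := mul_le_mul_of_nonneg_left h ha.le
  rwa [mul_sub, mul_inv_cancel₀ ha.ne', mul_one] at h2

theorem IsDensity.segment {ρ g : X → ℝ} (hρ : IsDensity m ρ) (hg : IsDensity m g) {t : ℝ}
    (ht0 : 0 ≤ t) (ht1 : t ≤ 1) : IsDensity m fun x => ρ x + t * (g x - ρ x) where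
  measurable := hρ.measurable.add ((hg.measurable.sub hρ.measurable).const_mul t)
  pos := by
    filter_upwards [hρ.pos, hg.pos] with x h1 h2
    rcases ht1.eq_or_lt with rfl | h
    · linarith
    · nlinarith [mul_pos (sub_pos.2 h) h1, mul_nonneg ht0 h2.le]
  integrable := hρ.integrable.add ((hg.integrable.sub hρ.integrable).const_mul t)
  integral_eq_one := by
    have hi : Integrable (fun x => g x - ρ x) m := hg.integrable.sub hρ.integrable
    rw [integral_add hρ.integrable (hi.const_mul t), integral_const_mul, integral_sub hg.integrable hρ.integrable, hρ.integral_eq_one,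
      hg.integral_eq_one]
    ring
  integrable_entropy := by
    have hm : Measurable fun x => ρ x + t * (g x - ρ x) :=
      hρ.measurable.add ((hg.measurable.sub hρ.measurable).const_mul t)
    have hi : Integrable (fun x => ρ x + t * (g x - ρ x)) m :=
      hρ.integrable.add ((hg.integrable.sub hρ.integrable).const_mul t)
    -- The entropy integrand lies between ρ_t - 1 and the convex combination of the two given
    -- integrands.
    refine Integrable.mono' (g := fun x => |ρ x + t * (g x - ρ x) - 1| +
      |(1 - t) * (ρ x * Real.log (ρ x)) + t * (g x * Real.log (g x))|)
      ((hi.sub (integrable_const 1)).abs.add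
        ((hρ.integrable_entropy.const_mul _).add (hg.integrable_entropy.const_mul _)).abs)
      (hm.mul (Real.measurable_log.comp hm)).aestronglyMeasurable ?_
    filter_upwards [hρ.pos, hg.pos] with x h1 h2
    have hpos : 0 < ρ x + t * (g x - ρ x) := by
      rcases ht1.eq_or_lt with rfl | h
      · linarith
      · nlinarith [mul_pos (sub_pos.2 h) h1, mul_nonneg ht0 h2.le]
    have u1 := mul_log_convex h1 h2 ht0 ht1
    have u2 := sub_one_le_mul_log hpos
    rw [Real.norm_eq_abs, abs_le]
    constructor
    · linarith [neg_abs_le (ρ x + t * (g x - ρ x) - 1),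
        abs_nonneg ((1 - t) * (ρ x * Real.log (ρ x)) + t * (g x * Real.log (g x)))]
    · linarith [le_abs_self ((1 - t) * (ρ x * Real.log (ρ x)) + t * (g x * Real.log (g x))),
        abs_nonneg (ρ x + t * (g x - ρ x) - 1)]

theorem densEntropy_segment_le {ρ g : X → ℝ} (hρ : IsDensity m ρ) (hg : IsDensity m g) {t : ℝ}
    (ht0 : 0 ≤ t) (ht1 : t ≤ 1) :
    densEntropy m (fun x => ρ x + t * (g x - ρ x)) ≤
      (1 - t) * densEntropy m ρ + t * densEntropy m g := by
  rw [densEntropy, densEntropy, densEntropy, ← integral_const_mul, ← integral_const_mul,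
    ← integral_add (hρ.integrable_entropy.const_mul _) (hg.integrable_entropy.const_mul _)]
  refine integral_mono_ae (hρ.segment hg ht0 ht1).integrable_entropy
    ((hρ.integrable_entropy.const_mul _).add (hg.integrable_entropy.const_mul _)) ?_
  filter_upwards [hρ.pos, hg.pos] with x h1 h2
  exact mul_log_convex h1 h2 ht0 ht1

variable (hK : Continuous fun p : X × X => K p.1 p.2) (hB : ∀ x y, |K x y| ≤ B)
  (hs : ∀ x y, K x y = K y x) (hγ : 0 < γ)

include hK hB hs hγ

/-- Moving a density towards the Gibbs density of its own potential lowers the free energy. -/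
theorem densEnergy_segment_gibbs_le {ρ : X → ℝ} (hρ : IsDensity m ρ) {t : ℝ}
    (ht0 : 0 ≤ t) (ht1 : t ≤ 1) :
    densEnergy m K γ (fun x => ρ x + t * (gibbs m γ (pot m K ρ) x - ρ x)) ≤
      densEnergy m K γ ρ - t * γ⁻¹ * gibbsDivergence m γ (pot m K ρ) ρ + 2 * B * t ^ 2 := by
  have hV : Continuous (pot m K ρ) := continuous_pot hK hB hρ.integrable
  set g := gibbs m γ (pot m K ρ) with hg'
  have hg : IsDensity m g := isDensity_gibbs hV
  have hi : Integrable (fun x => g x - ρ x) m := hg.integrable.sub hρ.integrable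
  have h1 := densEntropy_segment_le hρ hg ht0 ht1
  have h2 := bil_add_mul hK hB hs hρ.integrable hi t
  have h3 := (abs_le.1 (abs_bil_le hB hi hi)).2
  -- Two unit masses differ by at most 2 in L¹, so the second order term is at most t²/2 · 4B, which
  -- gives the constant 2B.
  have hN : ∫ x, |g x - ρ x| ∂m ≤ 2 := by
    calc ∫ x, |g x - ρ x| ∂m ≤ ∫ x, (|g x| + |ρ x|) ∂m :=
          integral_mono hi.abs (hg.integrable.abs.add hρ.integrable.abs) fun x => abs_sub _ _
      _ = 2 := by
          rw [integral_add hg.integrable.abs hρ.integrable.abs, hg.integral_abs, hρ.integral_abs]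
          norm_num
  have hN0 : 0 ≤ ∫ x, |g x - ρ x| ∂m := integral_nonneg fun x => abs_nonneg _
  have hB0 : 0 ≤ B := by
    obtain ⟨x⟩ : Nonempty X := nonempty_of_isProbabilityMeasure m
    exact (abs_nonneg _).trans (hB x x)
  have h4 : bil m K (fun x => g x - ρ x) (fun x => g x - ρ x) ≤ 4 * B := by
    refine h3.trans ?_
    have : (∫ x, |g x - ρ x| ∂m) * ∫ x, |g x - ρ x| ∂m ≤ 2 * 2 := mul_le_mul hN hN hN0 (by norm_num)
    rw [mul_assoc]
    nlinarith
  have h5 : bil m K (fun x => g x - ρ x) ρ =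
      ∫ x, g x * pot m K ρ x ∂m - ∫ x, ρ x * pot m K ρ x ∂m := by
    rw [bil, ← integral_sub (integrable_mul_pot hK hB hg.integrable hρ.integrable)
      (integrable_mul_pot hK hB hρ.integrable hρ.integrable)]
    simp only [sub_mul]
  -- This expresses the entropy of g by its potential energy and the normalization, so that the
  -- first order term becomes the divergence of ρ.
  have h6 : gibbsDivergence m γ (pot m K ρ) g = 0 := gibbsDivergence_gibbs hV
  rw [densEnergy, h2, h5, densEnergy]
  rw [gibbsDivergence] at h6 ⊢
  have h7 : γ⁻¹ * densEntropy m (fun x => ρ x + t * (g x - ρ x)) ≤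
      γ⁻¹ * ((1 - t) * densEntropy m ρ + t * densEntropy m g) :=
    mul_le_mul_of_nonneg_left h1 (inv_nonneg.2 hγ.le)
  have h8 : t ^ 2 * bil m K (fun x => g x - ρ x) (fun x => g x - ρ x) ≤ t ^ 2 * (4 * B) :=
    mul_le_mul_of_nonneg_left h4 (sq_nonneg t)
  set a := ∫ x, g x * pot m K ρ x ∂m
  set b := ∫ x, ρ x * pot m K ρ x ∂m
  have h9 : densEntropy m g = -γ * a - Real.log (partition m γ (pot m K ρ)) := by linarith
  have h10 : γ⁻¹ * γ = 1 := inv_mul_cancel₀ hγ.ne'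
  rw [h9] at h7
  have e : γ⁻¹ * ((1 - t) * densEntropy m ρ +
      t * (-γ * a - Real.log (partition m γ (pot m K ρ)))) + t * (a - b) =
      γ⁻¹ * densEntropy m ρ -
        t * γ⁻¹ * (densEntropy m ρ + γ * b + Real.log (partition m γ (pot m K ρ))) := by
    linear_combination (t * b - t * a) * h10
  linarith

/-- A step of length t towards the Gibbs density gains t/γ times the divergence and loses 2Bt². An
energy gap of t² has the same order as this loss, so dividing by t leaves a bound of order t. -/
theorem gibbsDivergence_le_of_almost_minimizer {ρ : X → ℝ} (hρ : IsDensity m ρ) {t : ℝ}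
    (ht0 : 0 < t) (ht1 : t ≤ 1)
    (hmin : ∀ ρ', IsDensity m ρ' → densEnergy m K γ ρ - t ^ 2 ≤ densEnergy m K γ ρ') :
    gibbsDivergence m γ (pot m K ρ) ρ ≤ γ * (1 + 2 * B) * t := by
  have hV : Continuous (pot m K ρ) := continuous_pot hK hB hρ.integrable
  have h1 := densEnergy_segment_gibbs_le hK hB hs hγ hρ ht0.le ht1
  have h2 := hmin _ (hρ.segment (isDensity_gibbs (γ := γ) hV) ht0.le ht1)
  have h3 : t * (γ⁻¹ * gibbsDivergence m γ (pot m K ρ) ρ) ≤ t * ((1 + 2 * B) * t) := by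
    linarith
  have h4 := le_of_mul_le_mul_left h3 ht0
  rw [inv_mul_le_iff₀ hγ] at h4
  linarith

/-- Minimizers are Gibbs densities of their own potential. -/
theorem ae_eq_gibbs_of_minimizer {ρ : X → ℝ} (hρ : IsDensity m ρ)
    (hmin : ∀ ρ', IsDensity m ρ' → densEnergy m K γ ρ ≤ densEnergy m K γ ρ') :
    ρ =ᵐ[m] gibbs m γ (pot m K ρ) := by
  have hV : Continuous (pot m K ρ) := continuous_pot hK hB hρ.integrable
  have h1 : gibbsDivergence m γ (pot m K ρ) ρ ≤ 0 := by
    have hlim : Tendsto (fun t : ℝ => γ * (1 + 2 * B) * t) (𝓝[>] 0) (𝓝 0) := by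
      have : Tendsto (fun t : ℝ => γ * (1 + 2 * B) * t) (𝓝 0) (𝓝 (γ * (1 + 2 * B) * 0)) :=
        tendsto_id.const_mul _
      rw [mul_zero] at this
      exact this.mono_left nhdsWithin_le_nhds
    refine ge_of_tendsto hlim ?_
    filter_upwards [Ioo_mem_nhdsGT (zero_lt_one (α := ℝ))] with t ht
    exact gibbsDivergence_le_of_almost_minimizer hK hB hs hγ hρ ht.1 ht.2.le fun ρ' h =>
      (sub_le_self _ (sq_nonneg t)).trans (hmin ρ' h)
  have h2 := sq_integral_abs_sub_gibbs_le (γ := γ) hV hρ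
  have h3 : ∫ x, |ρ x - gibbs m γ (pot m K ρ) x| ∂m = 0 :=
    pow_eq_zero_iff (two_ne_zero) |>.1 (le_antisymm (by linarith) (sq_nonneg _))
  have hi : Integrable (fun x => ρ x - gibbs m γ (pot m K ρ) x) m :=
    hρ.integrable.sub (isDensity_gibbs hV).integrable
  rw [integral_eq_zero_iff_of_nonneg (fun x => abs_nonneg _) hi.abs] at h3
  filter_upwards [h3] with x hx
  exact sub_eq_zero.1 (abs_eq_zero.1 hx)

-- All densities have mass one, so their potentials share the modulus of continuity of the kernel.
-- Compactness is thus used for potentials, and no weak limit of densities is taken.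
omit hs hγ in
theorem equicontinuous_pot {ι : Type*} (ρ : ι → X → ℝ) (hρ : ∀ i, IsDensity m (ρ i)) :
    Equicontinuous fun i => pot m K (ρ i) := by
  intro x₀
  rw [Metric.equicontinuousAt_iff_pair]
  intro ε hε
  have hu := CompactSpace.uniformContinuous_of_continuous hK
  rw [Metric.uniformContinuous_iff] at hu
  obtain ⟨δ, hδ, h⟩ := hu (ε / 2) (by positivity)
  refine ⟨Metric.ball x₀ (δ / 2), Metric.ball_mem_nhds _ (by positivity), fun x hx y hy i => ?_⟩
  have hxy : dist x y < δ := by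
    have := dist_triangle_right x y x₀
    rw [Metric.mem_ball] at hx hy
    linarith
  have hk : ∀ z, |K x z - K y z| ≤ ε / 2 := fun z => by
    have := h (a := (x, z)) (b := (y, z)) (by simpa [Prod.dist_eq] using hxy)
    exact this.le
  rw [Real.dist_eq, pot, pot, ← integral_sub (integrable_kernel_mul hK (hρ i).integrable x)
    (integrable_kernel_mul hK (hρ i).integrable y)]
  have h2 : |∫ z, (K x z * ρ i z - K y z * ρ i z) ∂m| ≤ ∫ z, ε / 2 * |ρ i z| ∂m := by
    rw [← Real.norm_eq_abs]
    refine norm_integral_le_of_norm_le ((hρ i).integrable.abs.const_mul _) (.of_forall fun z => ?_)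
    rw [← sub_mul, norm_mul]
    exact mul_le_mul_of_nonneg_right (hk z) (abs_nonneg _)
  rw [integral_const_mul, (hρ i).integral_abs] at h2
  linarith

omit hs hγ in
theorem exists_subseq_pot_tendsto (ρ : ℕ → X → ℝ) (hρ : ∀ i, IsDensity m (ρ i)) :
    ∃ (V : X → ℝ) (φ : ℕ → ℕ) (d : ℕ → ℝ), Continuous V ∧ StrictMono φ ∧
      Tendsto d atTop (𝓝 0) ∧ ∀ j x, |pot m K (ρ (φ j)) x - V x| ≤ d j := by
  set F : ℕ → BoundedContinuousFunction X ℝ := fun j => BoundedContinuousFunction.mkOfCompact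
    ⟨pot m K (ρ j), continuous_pot hK hB (hρ j).integrable⟩ with hF
  have hc : IsCompact (closure (range F)) := by
    refine BoundedContinuousFunction.arzela_ascoli (Icc (-B) B) isCompact_Icc _ ?_ ?_
    · rintro f x ⟨j, rfl⟩
      have := abs_pot_le (m := m) hB (hρ j).integrable x
      rw [(hρ j).integral_abs, mul_one] at this
      exact abs_le.1 this
    · have h := equicontinuous_pot (m := m) hK hB ρ hρ
      intro x₀ U hU
      filter_upwards [h x₀ U hU] with x hx
      rintro ⟨f, j, rfl⟩
      exact hx j
  obtain ⟨V, -, φ, hφ, hV⟩ := hc.tendsto_subseq fun j => subset_closure (mem_range_self j)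
  refine ⟨V, φ, fun j => dist (F (φ j)) V, V.continuous, hφ, tendsto_iff_dist_tendsto_zero.1 hV,
    fun j x => ?_⟩
  have := BoundedContinuousFunction.dist_coe_le_dist (f := F (φ j)) (g := V) x
  rwa [Real.dist_eq] at this

omit hs in
theorem densEnergy_lower_bound {ρ : X → ℝ} (hρ : IsDensity m ρ) :
    -(1 / 2 * B) ≤ densEnergy m K γ ρ := by
  have h1 := sq_integral_abs_sub_one_le hρ
  have h2 := (abs_le.1 (abs_bil_le (m := m) hB hρ.integrable hρ.integrable)).1
  rw [hρ.integral_abs, mul_one, mul_one] at h2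
  have h3 : 0 ≤ γ⁻¹ * densEntropy m ρ := by
    have : 0 ≤ densEntropy m ρ := by nlinarith [sq_nonneg (∫ x, |ρ x - 1| ∂m)]
    positivity
  rw [densEnergy]
  linarith

/-- The free energy has a continuous positive minimizer. -/
theorem exists_minimizer : ∃ g : X → ℝ, IsDensity m g ∧ Continuous g ∧ (∀ x, 0 < g x) ∧
    ∀ ρ, IsDensity m ρ → densEnergy m K γ g ≤ densEnergy m K γ ρ := by
  set S : Set ℝ := densEnergy m K γ '' {ρ | IsDensity m ρ} with hS
  have hbdd : BddBelow S := ⟨-(1 / 2 * B), by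
    rintro _ ⟨ρ, hρ, rfl⟩
    exact densEnergy_lower_bound hK hB hγ hρ⟩
  have hne : S.Nonempty := ⟨_, _, isDensity_one, rfl⟩
  have hinf : ∀ ρ, IsDensity m ρ → sInf S ≤ densEnergy m K γ ρ := fun ρ hρ =>
    csInf_le hbdd ⟨ρ, hρ, rfl⟩
  -- The error is a square so that `gibbsDivergence_le_of_almost_minimizer` applies with t =
  -- 1/(j+1).
  have hex : ∀ j : ℕ, ∃ ρ, IsDensity m ρ ∧
      densEnergy m K γ ρ < sInf S + (1 / ((j : ℝ) + 1)) ^ 2 := by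
    intro j
    obtain ⟨_, ⟨ρ, hρ, rfl⟩, h⟩ := exists_lt_of_csInf_lt hne
      (show sInf S < sInf S + (1 / ((j : ℝ) + 1)) ^ 2 from lt_add_of_pos_right _ (by positivity))
    exact ⟨ρ, hρ, h⟩
  choose ρ hρ hρS using hex
  obtain ⟨V, φ, d, hV, hφ, hd, hpot⟩ := exists_subseq_pot_tendsto (m := m) hK hB ρ hρ
  -- The candidate is the Gibbs density of the limit potential V.
  set g := gibbs m γ V with hg'
  have hg : IsDensity m g := isDensity_gibbs hV
  have hVc : ∀ j, Continuous (pot m K (ρ j)) := fun j => continuous_pot hK hB (hρ j).integrable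
  have hτ : Tendsto (fun j => 1 / ((φ j : ℝ) + 1)) atTop (𝓝 0) :=
    (tendsto_one_div_add_atTop_nhds_zero_nat (𝕜 := ℝ)).comp hφ.tendsto_atTop
  have hKL : ∀ j, gibbsDivergence m γ (pot m K (ρ j)) (ρ j) ≤
      γ * (1 + 2 * B) * (1 / ((j : ℝ) + 1)) := fun j =>
    gibbsDivergence_le_of_almost_minimizer hK hB hs hγ (hρ j) (by positivity)
      (by rw [div_le_one (by positivity)]; linarith [(Nat.cast_nonneg j : (0 : ℝ) ≤ j)])
      fun ρ' hρ' => by linarith [hρS j, hinf ρ' hρ']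
  -- Each ρ is L¹ close to the Gibbs density of its own potential by Csiszár-Kullback, and that one
  -- is close to g because the potentials converge uniformly.
  have hN : Tendsto (fun j => ∫ x, |ρ (φ j) x - g x| ∂m) atTop (𝓝 0) := by
    have hup : Tendsto (fun j => Real.sqrt (4 * (γ * (1 + 2 * B) * (1 / ((φ j : ℝ) + 1)))) +
        (Real.exp (2 * γ * d j) - 1)) atTop (𝓝 0) := by
      have t1 : Tendsto (fun j => Real.sqrt (4 * (γ * (1 + 2 * B) * (1 / ((φ j : ℝ) + 1)))))
          atTop (𝓝 0) := by
        have := ((hτ.const_mul (γ * (1 + 2 * B))).const_mul 4).sqrt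
        simpa using this
      have t2 : Tendsto (fun j => Real.exp (2 * γ * d j) - 1) atTop (𝓝 0) := by
        have := ((Real.continuous_exp.tendsto _).comp (hd.const_mul (2 * γ))).sub_const 1
        simpa using this
      simpa using t1.add t2
    refine squeeze_zero (fun j => integral_nonneg fun x => abs_nonneg _) (fun j => ?_) hup
    have hgj := isDensity_gibbs (m := m) (γ := γ) (hVc (φ j))
    have i1 := ((hρ (φ j)).integrable.sub hgj.integrable).abs
    have i2 := (hgj.integrable.sub hg.integrable).abs
    calc ∫ x, |ρ (φ j) x - g x| ∂m
        ≤ ∫ x, (|ρ (φ j) x - gibbs m γ (pot m K (ρ (φ j))) x| +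
            |gibbs m γ (pot m K (ρ (φ j))) x - g x|) ∂m :=
          integral_mono ((hρ (φ j)).integrable.sub hg.integrable).abs (i1.add i2)
            fun x => abs_sub_le _ _ _
      _ = ∫ x, |ρ (φ j) x - gibbs m γ (pot m K (ρ (φ j))) x| ∂m +
            ∫ x, |gibbs m γ (pot m K (ρ (φ j))) x - g x| ∂m := integral_add i1 i2
      _ ≤ _ := by
          refine add_le_add ?_ ?_
          · refine Real.le_sqrt_of_sq_le ((sq_integral_abs_sub_gibbs_le (hVc _) (hρ _)).trans ?_)
            exact mul_le_mul_of_nonneg_left (hKL (φ j)) (by norm_num)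
          · calc ∫ x, |gibbs m γ (pot m K (ρ (φ j))) x - g x| ∂m
                ≤ ∫ x, (Real.exp (2 * γ * d j) - 1) * g x ∂m :=
                  integral_mono i2 (hg.integrable.const_mul _) fun x =>
                    abs_gibbs_sub_le hγ.le hV (hVc _) (hpot j) x
              _ = _ := by rw [integral_const_mul, hg.integral_eq_one, mul_one]
  have hpotg : pot m K g = V := by
    ext x
    have t1 : Tendsto (fun j => pot m K (ρ (φ j)) x) atTop (𝓝 (V x)) := by
      rw [tendsto_iff_dist_tendsto_zero]
      exact squeeze_zero (fun _ => dist_nonneg) (fun j => hpot j x) hd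
    have t2 : Tendsto (fun j => pot m K (ρ (φ j)) x) atTop (𝓝 (pot m K g x)) := by
      rw [tendsto_iff_dist_tendsto_zero]
      refine squeeze_zero (fun _ => dist_nonneg) (fun j => ?_) (by simpa using hN.const_mul B)
      have := abs_pot_le (m := m) hB ((hρ (φ j)).integrable.sub hg.integrable) x
      rw [Real.dist_eq, pot, pot, ← integral_sub (integrable_kernel_mul hK (hρ _).integrable x)
        (integrable_kernel_mul hK hg.integrable x)]
      simpa only [pot, Pi.sub_apply, mul_sub] using this
    exact tendsto_nhds_unique t2 t1
  have hbil : Tendsto (fun j => bil m K (ρ (φ j)) (ρ (φ j))) atTop (𝓝 (bil m K g g)) := by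
    rw [tendsto_iff_dist_tendsto_zero]
    refine squeeze_zero (fun _ => dist_nonneg)
      (fun j => abs_bil_self_sub_le hK hB hs (hρ (φ j)).integrable hg) ?_
    simpa using (hN.const_mul (2 * B)).add ((hN.pow 2).const_mul B)
  have hlogZ : Tendsto (fun j => Real.log (partition m γ (pot m K (ρ (φ j))))) atTop
      (𝓝 (Real.log (partition m γ V))) := by
    rw [tendsto_iff_dist_tendsto_zero]
    exact squeeze_zero (fun _ => dist_nonneg)
      (fun j => abs_log_partition_sub_le hγ.le hV (hVc _) (hpot j))
      (by simpa using hd.const_mul γ)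
  -- The entropy need not converge under L¹ convergence. In this form of the energy the only such
  -- term is the divergence, which is nonnegative along the sequence and zero at g; the others
  -- converge.
  have henergy : ∀ ρ : X → ℝ, densEnergy m K γ ρ =
      γ⁻¹ * gibbsDivergence m γ (pot m K ρ) ρ - 1 / 2 * bil m K ρ ρ -
        γ⁻¹ * Real.log (partition m γ (pot m K ρ)) := by
    intro ρ
    rw [densEnergy, gibbsDivergence, bil]
    field_simp
    ring
  refine ⟨g, hg, continuous_gibbs hV, gibbs_pos hV, fun ρ' hρ' => ?_⟩
  refine le_trans ?_ (hinf ρ' hρ')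
  have hle : ∀ j, -(1 / 2 * bil m K (ρ (φ j)) (ρ (φ j))) -
      γ⁻¹ * Real.log (partition m γ (pot m K (ρ (φ j)))) ≤
        sInf S + (1 / ((φ j : ℝ) + 1)) ^ 2 := by
    intro j
    have h1 := hρS (φ j)
    rw [henergy] at h1
    have h2 : 0 ≤ γ⁻¹ * gibbsDivergence m γ (pot m K (ρ (φ j))) (ρ (φ j)) :=
      mul_nonneg (inv_nonneg.2 hγ.le) (gibbsDivergence_nonneg (hVc _) (hρ _))
    linarith
  have hlim := le_of_tendsto_of_tendsto' ((hbil.const_mul (1 / 2)).neg.sub (hlogZ.const_mul γ⁻¹))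
    ((hτ.pow 2).const_add (sInf S)) hle
  rw [henergy, hpotg, gibbsDivergence_gibbs hV]
  simpa using hlim

end Variational

/-! ### Taylor bounds for (1 + v) log(1 + v) -/

section LogInequalities

theorem nonneg_of_mul_deriv_nonneg {f f' : ℝ → ℝ} {a : ℝ}
    (hf : ∀ x, a < x → HasDerivAt f (f' x) x) (h0 : f 0 = 0)
    (hf' : ∀ x, a < x → 0 ≤ x * f' x) {v : ℝ} (ha : a < 0) (hv : a < v) : 0 ≤ f v := by
  rcases lt_trichotomy v 0 with hv0 | rfl | hv0
  · obtain ⟨c, hc, hc'⟩ := exists_hasDerivAt_eq_slope f f' hv0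
      (fun x hx => (hf x (hv.trans_le hx.1)).continuousAt.continuousWithinAt)
      fun x hx => hf x (hv.trans hx.1)
    have h1 := hf' c (hv.trans hc.1)
    have h2 : f' c ≤ 0 := by
      by_contra h
      nlinarith [hc.2]
    rw [hc', h0, zero_sub, zero_sub, neg_div_neg_eq] at h2
    by_contra h
    exact absurd (div_pos_of_neg_of_neg (not_le.1 h) hv0) (not_lt.2 h2)
  · exact h0.ge
  · obtain ⟨c, hc, hc'⟩ := exists_hasDerivAt_eq_slope f f' hv0
      (fun x hx => (hf x (ha.trans_le hx.1)).continuousAt.continuousWithinAt)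
      fun x hx => hf x (ha.trans hx.1)
    have h1 := hf' c (ha.trans hc.1)
    have h2 : 0 ≤ f' c := nonneg_of_mul_nonneg_right h1 hc.1
    rw [hc', h0, sub_zero, sub_zero] at h2
    by_contra h
    exact absurd (div_neg_of_neg_of_pos (not_le.1 h) hv0) (not_lt.2 h2)

/-- Dividing by 1 + v isolates the logarithm, so the derivative is rational with an explicit sign.
The choice c = 0 gives the lower bound and c = 2/3 the upper one. -/
theorem hasDerivAt_log_defect (c : ℝ) {v : ℝ} (hv : -1 < v) :
    HasDerivAt (fun v => (v + v ^ 2 / 2 - v ^ 3 / 6 + c * v ^ 4) / (1 + v) - Real.log (1 + v))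
      (v ^ 3 * (-1 / 3 + 4 * c + 3 * c * v) / (1 + v) ^ 2) v := by
  have h0 : 1 + v ≠ 0 := by linarith
  have h1 : HasDerivAt (fun v : ℝ => 1 + v) 1 v := (hasDerivAt_id v).const_add 1
  have h2 : HasDerivAt (fun v : ℝ => v + v ^ 2 / 2 - v ^ 3 / 6 + c * v ^ 4)
      (1 + v - v ^ 2 / 2 + 4 * c * v ^ 3) v := by
    have := (((hasDerivAt_id v).add ((hasDerivAt_pow 2 v).div_const 2)).sub
      ((hasDerivAt_pow 3 v).div_const 6)).add ((hasDerivAt_pow 4 v).const_mul c)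
    refine this.congr_deriv ?_
    norm_num
    ring
  refine ((h2.div h1 h0).sub (h1.log h0)).congr_deriv ?_
  field_simp
  ring

theorem le_mul_log_one_add {v : ℝ} (hv : -1 < v) :
    v + v ^ 2 / 2 - v ^ 3 / 6 ≤ (1 + v) * Real.log (1 + v) := by
  have hpos : 0 < 1 + v := by linarith
  have h := nonneg_of_mul_deriv_nonneg (a := -1)
    (f := fun v => -((v + v ^ 2 / 2 - v ^ 3 / 6 + 0 * v ^ 4) / (1 + v) - Real.log (1 + v)))
    (fun x hx => (hasDerivAt_log_defect 0 hx).neg) (by simp) (fun x hx => by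
      have : x * -(x ^ 3 * (-1 / 3 + 4 * 0 + 3 * 0 * x) / (1 + x) ^ 2) =
        (x ^ 2) ^ 2 / 3 / (1 + x) ^ 2 := by ring
      rw [this]
      positivity) (by norm_num) hv
  have h2 : (v + v ^ 2 / 2 - v ^ 3 / 6) / (1 + v) ≤ Real.log (1 + v) := by
    simp only [zero_mul, add_zero] at h
    linarith
  rwa [div_le_iff₀ hpos, mul_comm] at h2

theorem mul_log_one_add_le {v : ℝ} (hv : -(7 / 8) < v) :
    (1 + v) * Real.log (1 + v) ≤ v + v ^ 2 / 2 - v ^ 3 / 6 + 2 / 3 * v ^ 4 := by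
  have hpos : 0 < 1 + v := by linarith
  have h := nonneg_of_mul_deriv_nonneg (a := -(7 / 8))
    (f := fun v => (v + v ^ 2 / 2 - v ^ 3 / 6 + 2 / 3 * v ^ 4) / (1 + v) - Real.log (1 + v))
    (fun x hx => hasDerivAt_log_defect (2 / 3) (by linarith)) (by simp) (fun x hx => by
      have : x * (x ^ 3 * (-1 / 3 + 4 * (2 / 3) + 3 * (2 / 3) * x) / (1 + x) ^ 2) =
        (x ^ 2) ^ 2 * (7 / 3 + 2 * x) / (1 + x) ^ 2 := by ring
      rw [this]
      have : 0 < 7 / 3 + 2 * x := by linarith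
      positivity) (by norm_num) hv
  have h2 : Real.log (1 + v) ≤ (v + v ^ 2 / 2 - v ^ 3 / 6 + 2 / 3 * v ^ 4) / (1 + v) := by
    linarith
  rwa [le_div_iff₀ hpos, mul_comm] at h2

end LogInequalities

/-! ### From measures to densities on the sphere -/

section Bridge

variable {n : ℕ} [Fact (3 ≤ n)]

/-- The interaction kernel on the sphere. -/
noncomputable def sphKer {n : ℕ} (W : ℝ → ℝ) (x y : Sphere n) : ℝ := W (sdot x y)

theorem sphKer_comm (W : ℝ → ℝ) (x y : Sphere n) : sphKer W x y = sphKer W y x := by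
  rw [sphKer, sphKer, sdot_comm]

theorem continuous_sphKer {W : ℝ → ℝ} (hW : ContinuousOn W (Icc (-1) 1)) :
    Continuous fun p : Sphere n × Sphere n => sphKer W p.1 p.2 :=
  continuous_comp_sdot hW continuous_fst continuous_snd

/-- The measure with density `ρ`. -/
noncomputable def ofDensity (ρ : Sphere n → ℝ) : Measure (Sphere n) :=
  (unif n).withDensity fun x => ENNReal.ofReal (ρ x)

variable {W : ℝ → ℝ} {γ : ℝ} {ρ : Sphere n → ℝ}

theorem isProbabilityMeasure_ofDensity (hρ : IsDensity (unif n) ρ) :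
    IsProbabilityMeasure (ofDensity ρ) := by
  refine ⟨?_⟩
  rw [ofDensity, withDensity_apply _ .univ, Measure.restrict_univ,
    ← ofReal_integral_eq_lintegral_ofReal hρ.integrable (hρ.pos.mono fun x hx => hx.le),
    hρ.integral_eq_one, ENNReal.ofReal_one]

theorem ofDensity_absolutelyContinuous : ofDensity ρ ≪ unif n :=
  withDensity_absolutelyContinuous _ _

theorem rnDeriv_ofDensity (hρ : IsDensity (unif n) ρ) :
    (ofDensity ρ).rnDeriv (unif n) =ᵐ[unif n] fun x => ENNReal.ofReal (ρ x) :=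
  Measure.rnDeriv_withDensity _ hρ.measurable.ennreal_ofReal

theorem toReal_rnDeriv_ofDensity (hρ : IsDensity (unif n) ρ) :
    (fun x => ((ofDensity ρ).rnDeriv (unif n) x).toReal) =ᵐ[unif n] ρ := by
  filter_upwards [rnDeriv_ofDensity hρ, hρ.pos] with x hx hpos
  rw [hx, ENNReal.toReal_ofReal hpos.le]

theorem rnDeriv_ofDensity_pos (hρ : IsDensity (unif n) ρ) :
    ∀ᵐ x ∂(unif n), 0 < (ofDensity ρ).rnDeriv (unif n) x := by
  filter_upwards [rnDeriv_ofDensity hρ, hρ.pos] with x hx hpos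
  rw [hx]
  exact ENNReal.ofReal_pos.2 hpos

theorem entropy_ofDensity (hρ : IsDensity (unif n) ρ) :
    entropy (ofDensity ρ) = (densEntropy (unif n) ρ : EReal) := by
  have h : (fun x => ((ofDensity ρ).rnDeriv (unif n) x).toReal *
      Real.log ((ofDensity ρ).rnDeriv (unif n) x).toReal) =ᵐ[unif n]
      fun x => ρ x * Real.log (ρ x) := by
    filter_upwards [toReal_rnDeriv_ofDensity hρ] with x hx
    rw [hx]
  rw [entropy, if_pos ⟨ofDensity_absolutelyContinuous, rnDeriv_ofDensity_pos hρ,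
    hρ.integrable_entropy.congr h.symm⟩, integral_congr_ae h]
  rfl

theorem integral_ofDensity (hρ : IsDensity (unif n) ρ) (f : Sphere n → ℝ) :
    ∫ x, f x ∂(ofDensity ρ) = ∫ x, ρ x * f x ∂(unif n) := by
  rw [ofDensity, integral_withDensity_eq_integral_toReal_smul₀
    hρ.measurable.ennreal_ofReal.aemeasurable (.of_forall fun x => ENNReal.ofReal_lt_top)]
  refine integral_congr_ae ?_
  filter_upwards [hρ.pos] with x hx
  rw [ENNReal.toReal_ofReal hx.le, smul_eq_mul]

theorem interaction_ofDensity (hW : ContinuousOn W (Icc (-1) 1)) (hρ : IsDensity (unif n) ρ) :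
    interaction W (ofDensity ρ) = 1 / 2 * bil (unif n) (sphKer W) ρ ρ := by
  have := isProbabilityMeasure_ofDensity hρ
  rw [interaction]
  congr 1
  change ∫ p : Sphere n × Sphere n, sphKer W p.1 p.2 ∂((ofDensity ρ).prod (ofDensity ρ)) = _
  rw [integral_prod _ ((continuous_sphKer hW).integrable_of_hasCompactSupport
    (HasCompactSupport.of_compactSpace _)), integral_ofDensity hρ, bil]
  congr 1 with x
  rw [integral_ofDensity hρ, pot]
  simp only [mul_comm (ρ _)]

theorem freeEnergy_ofDensity (hW : ContinuousOn W (Icc (-1) 1)) (hρ : IsDensity (unif n) ρ) :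
    freeEnergy W γ (ofDensity ρ) = (densEnergy (unif n) (sphKer W) γ ρ : EReal) := by
  rw [freeEnergy, entropy_ofDensity hρ, interaction_ofDensity hW hρ, densEnergy, ← EReal.coe_mul,
    ← EReal.coe_add]

theorem ofDensity_congr {ρ' : Sphere n → ℝ} (h : ρ =ᵐ[unif n] ρ') : ofDensity ρ = ofDensity ρ' :=
  withDensity_congr_ae (h.mono fun x hx => by simp only [hx])

theorem ofDensity_one : ofDensity (fun _ : Sphere n => (1 : ℝ)) = unif n := by
  simp [ofDensity]

theorem exists_density_of_entropy_ne_top {μ : Measure (Sphere n)} [IsProbabilityMeasure μ]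
    (h : entropy μ ≠ ⊤) : ∃ ρ, IsDensity (unif n) ρ ∧ μ = ofDensity ρ := by
  rw [entropy] at h
  split_ifs at h with hc
  · obtain ⟨hac, hpos, hint⟩ := hc
    have hlt : ∀ᵐ x ∂(unif n), μ.rnDeriv (unif n) x < ⊤ := Measure.rnDeriv_lt_top _ _
    refine ⟨fun x => (μ.rnDeriv (unif n) x).toReal, ⟨?_, ?_, ?_, ?_, hint⟩, ?_⟩
    · exact (Measure.measurable_rnDeriv _ _).ennreal_toReal
    · filter_upwards [hpos, hlt] with x h1 h2
      exact ENNReal.toReal_pos h1.ne' h2.ne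
    · exact Measure.integrable_toReal_rnDeriv
    · rw [Measure.integral_toReal_rnDeriv hac, probReal_univ]
    · have := Measure.haveLebesgueDecomposition_of_sigmaFinite μ (unif n)
      nth_rewrite 1 [← Measure.withDensity_rnDeriv_eq μ (unif n) hac]
      refine withDensity_congr_ae ?_
      filter_upwards [hlt] with x hx
      rw [ENNReal.ofReal_toReal hx.ne]
  · exact absurd rfl h

theorem freeEnergy_eq_top {μ : Measure (Sphere n)} (hγ : 0 < γ) (h : entropy μ = ⊤) :
    freeEnergy W γ μ = ⊤ := by
  rw [freeEnergy, h, EReal.coe_mul_top_of_pos (inv_pos.2 hγ), EReal.top_add_coe]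

/-- Measures without a positive density of finite entropy have free energy `⊤`, so only densities
compete. -/
theorem isMinimizer_ofDensity_iff (hW : ContinuousOn W (Icc (-1) 1)) (hγ : 0 < γ)
    (hρ : IsDensity (unif n) ρ) :
    IsMinimizer W γ (ofDensity ρ) ↔ ∀ ρ', IsDensity (unif n) ρ' →
      densEnergy (unif n) (sphKer W) γ ρ ≤ densEnergy (unif n) (sphKer W) γ ρ' := by
  constructor
  · rintro ⟨-, h⟩ ρ' hρ'
    have := h _ (isProbabilityMeasure_ofDensity hρ')
    rw [freeEnergy_ofDensity hW hρ, freeEnergy_ofDensity hW hρ'] at this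
    exact EReal.coe_le_coe_iff.1 this
  · refine fun h => ⟨isProbabilityMeasure_ofDensity hρ, fun ν hν => ?_⟩
    by_cases hν' : entropy ν = ⊤
    · rw [freeEnergy_eq_top hγ hν']
      exact le_top
    · obtain ⟨ρ', hρ', rfl⟩ := exists_density_of_entropy_ne_top hν'
      rw [freeEnergy_ofDensity hW hρ, freeEnergy_ofDensity hW hρ']
      exact EReal.coe_le_coe_iff.2 (h ρ' hρ')

theorem IsMinimizer.exists_density (hW : ContinuousOn W (Icc (-1) 1)) (hγ : 0 < γ)
    {μ : Measure (Sphere n)} (h : IsMinimizer W γ μ) :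
    ∃ ρ, IsDensity (unif n) ρ ∧ μ = ofDensity ρ := by
  have := h.1
  refine exists_density_of_entropy_ne_top fun htop => ?_
  have h1 := h.2 _ (isProbabilityMeasure_ofDensity isDensity_one)
  rw [freeEnergy_eq_top hγ htop, freeEnergy_ofDensity hW isDensity_one] at h1
  exact EReal.coe_ne_top _ (top_le_iff.1 h1)

/-- The excess of the free energy over the uniform state. -/
theorem densEnergy_eq (hW : ContinuousOn W (Icc (-1) 1)) (hρ : IsDensity (unif n) ρ) :
    densEnergy (unif n) (sphKer W) γ ρ = densEnergy (unif n) (sphKer W) γ (fun _ => 1) +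
      (γ⁻¹ * densEntropy (unif n) ρ +
        1 / 2 * bil (unif n) (sphKer W) (fun x => ρ x - 1) fun x => ρ x - 1) := by
  obtain ⟨B, _, hB⟩ := exists_abs_le_of_continuous (continuous_sphKer (n := n) hW)
  have hi : Integrable (fun x => ρ x - 1) (unif n) := hρ.integrable.sub (integrable_const 1)
  have h := bil_add_mul (continuous_sphKer hW) (fun x y => hB (x, y)) (sphKer_comm W)
    (isDensity_one (m := unif n)).integrable hi 1
  have e : (fun x => 1 + 1 * (ρ x - 1)) = ρ := by
    ext x
    ring
  -- The uniform state has constant potential, so the cross term with a deviation of mean zero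
  -- vanishes.
  have hp : ∀ x : Sphere n, pot (unif n) (sphKer W) (fun _ => 1) x = sphCoeff n W 0 := fun x => by
    simp only [pot, mul_one]
    exact integral_kernel hW x
  have h0 : bil (unif n) (sphKer W) (fun x => ρ x - 1) (fun _ => 1) = 0 := by
    rw [bil]
    simp only [hp]
    rw [integral_mul_const, integral_sub hρ.integrable (integrable_const 1), hρ.integral_eq_one]
    simp
  rw [e, h0] at h
  rw [densEnergy, densEnergy, h, densEntropy_one]
  ring

end Bridge

/-! ### The competitor at the point of linear stability -/

section Competitor

variable {n : ℕ} [Fact (3 ≤ n)] {W : ℝ → ℝ}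

theorem isDensity_of_continuous {ρ : Sphere n → ℝ} (hc : Continuous ρ) (hpos : ∀ x, 0 < ρ x)
    (h1 : ∫ x, ρ x ∂(unif n) = 1) : IsDensity (unif n) ρ where
  measurable := hc.measurable
  pos := .of_forall hpos
  integrable := integrable_unif_of_continuous hc
  integral_eq_one := h1
  integrable_entropy := integrable_unif_of_continuous
    (hc.mul (hc.log fun x => (hpos x).ne'))

theorem zonalRaw_eq (e : Sphere n) (l : ℕ) (x : Sphere n) :
    zonalRaw e l x = (sphGeg n l).eval (sdot e x) := (eval_gegPoly _ _ _).symm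

@[fun_prop]
theorem continuous_zonal (e : Sphere n) (l : ℕ) : Continuous (zonal e l) := by
  unfold zonal
  simp only [zonalRaw_eq]
  fun_prop

@[fun_prop]
theorem continuous_zonalComb (e : Sphere n) (c : ℕ →₀ ℝ) : Continuous (zonalComb e c) := by
  unfold zonalComb Finsupp.sum
  fun_prop

theorem integral_zonal_mul_zonal_of_ne (e : Sphere n) {k l : ℕ} (h : k ≠ l) :
    ∫ x, zonal e k x * zonal e l x ∂(unif n) = 0 := by
  have : ∀ x, zonal e k x * zonal e l x =
      ((Real.sqrt (∫ y, zonalRaw e k y ^ 2 ∂(unif n)))⁻¹ *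
        (Real.sqrt (∫ y, zonalRaw e l y ^ 2 ∂(unif n)))⁻¹) *
        (sphGeg n k * sphGeg n l).eval (sdot e x) := by
    intro x
    rw [zonal, zonal, Polynomial.eval_mul, zonalRaw_eq, zonalRaw_eq]
    ring
  simp only [this]
  rw [integral_const_mul, integral_sphGeg_mul_sphGeg h, mul_zero]

theorem integral_zonal (e : Sphere n) {l : ℕ} (h : 1 ≤ l) : ∫ x, zonal e l x ∂(unif n) = 0 := by
  have := integral_zonal_mul_zonal_of_ne e (k := 0) (l := l) (by omega)
  have h0 : ∀ x, zonal e 0 x = 1 := fun x => by simp [zonal, zonalRaw, gegenbauer]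
  simpa [h0] using this

theorem pot_zonal (hW : ContinuousOn W (Icc (-1) 1)) (e : Sphere n) (l : ℕ) (x : Sphere n) :
    pot (unif n) (sphKer W) (zonal e l) x = sphCoeff n W l * zonal e l x := by
  have h := funk_hecke hW l x e
  rw [pot, zonal, zonalRaw_eq, sdot_comm e x, mul_left_comm, ← h, ← integral_const_mul]
  congr 1 with y
  rw [zonal, zonalRaw_eq, sphKer]
  ring

theorem pot_zonalComb (hW : ContinuousOn W (Icc (-1) 1)) (e : Sphere n) (c : ℕ →₀ ℝ)
    (x : Sphere n) :
    pot (unif n) (sphKer W) (zonalComb e c) x =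
      ∑ l ∈ c.support, c l * (sphCoeff n W l * zonal e l x) := by
  have hK := continuous_sphKer (n := n) hW
  rw [pot]
  simp only [zonalComb, Finsupp.sum, Finset.mul_sum]
  rw [integral_finsetSum _ fun i _ => integrable_unif_of_continuous (by fun_prop)]
  refine Finset.sum_congr rfl fun l _ => ?_
  rw [← pot_zonal hW, pot, ← integral_const_mul]
  congr 1 with y
  ring

theorem integral_zonalComb_mul_zonal (e : Sphere n) (c : ℕ →₀ ℝ) {l : ℕ} (hl : l ∈ c.support) :
    ∫ x, zonalComb e c x * zonal e l x ∂(unif n) = c l * ∫ x, zonal e l x ^ 2 ∂(unif n) := by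
  simp only [zonalComb, Finsupp.sum, Finset.sum_mul]
  rw [integral_finsetSum _ fun i _ => integrable_unif_of_continuous (by fun_prop),
    Finset.sum_eq_single_of_mem l hl]
  · rw [← integral_const_mul]
    congr 1 with x
    ring
  · intro k _ hk
    simp only [mul_assoc]
    rw [integral_const_mul, integral_zonal_mul_zonal_of_ne e hk, mul_zero]

theorem integral_zonalComb_mul_sum (e : Sphere n) (c : ℕ →₀ ℝ) (a : ℕ → ℝ) :
    ∫ x, zonalComb e c x * ∑ l ∈ c.support, c l * (a l * zonal e l x) ∂(unif n) =
      ∑ l ∈ c.support, a l * (c l ^ 2 * ∫ x, zonal e l x ^ 2 ∂(unif n)) := by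
  simp only [Finset.mul_sum]
  rw [integral_finsetSum _ fun i _ => integrable_unif_of_continuous (by fun_prop)]
  refine Finset.sum_congr rfl fun l hl => ?_
  have : ∀ x, zonalComb e c x * (c l * (a l * zonal e l x)) =
      (c l * a l) * (zonalComb e c x * zonal e l x) := fun x => by ring
  simp only [this]
  rw [integral_const_mul, integral_zonalComb_mul_zonal e c hl]
  ring

/-- Zonal harmonics of different degrees are orthogonal eigenfunctions, so the form is diagonal in
the coefficients. -/
theorem bil_zonalComb_le (hW : ContinuousOn W (Icc (-1) 1)) (e : Sphere n) (c : ℕ →₀ ℝ) {b : ℝ}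
    (hb : ∀ l ∈ c.support, sphCoeff n W l ≤ b) :
    bil (unif n) (sphKer W) (zonalComb e c) (zonalComb e c) ≤
      b * ∫ x, zonalComb e c x ^ 2 ∂(unif n) := by
  have h1 := integral_zonalComb_mul_sum e c fun l => sphCoeff n W l
  have h2 := integral_zonalComb_mul_sum e c fun _ => 1
  have h3 : ∀ x, zonalComb e c x * ∑ l ∈ c.support, c l * (1 * zonal e l x) =
      zonalComb e c x ^ 2 := fun x => by
    simp only [one_mul, sq]
    rfl
  simp only [h3] at h2
  rw [bil]
  simp only [pot_zonalComb hW]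
  rw [h1, h2, Finset.mul_sum]
  refine Finset.sum_le_sum fun l hl => ?_
  rw [one_mul]
  exact mul_le_mul_of_nonneg_right (hb l hl)
    (mul_nonneg (sq_nonneg _) (integral_nonneg fun x => sq_nonneg _))

theorem integral_zonalComb (e : Sphere n) (c : ℕ →₀ ℝ) (hc : ∀ l ∈ c.support, 1 ≤ l) :
    ∫ x, zonalComb e c x ∂(unif n) = 0 := by
  simp only [zonalComb, Finsupp.sum]
  rw [integral_finsetSum _ fun i _ => integrable_unif_of_continuous (by fun_prop)]
  refine Finset.sum_eq_zero fun l hl => ?_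
  rw [integral_const_mul, integral_zonal e (hc l hl), mul_zero]

theorem bddBelow_sphCoeff (hW : ContinuousOn W (Icc (-1) 1)) (e : Sphere n) :
    BddBelow (range fun k : ℕ+ => sphCoeff n W k) := by
  obtain ⟨B, hB⟩ := isCompact_Icc.exists_bound_of_continuousOn hW
  refine ⟨-B, ?_⟩
  rintro _ ⟨k, rfl⟩
  exact (abs_le.1 (abs_sphCoeff_le hW hB k e)).1

theorem iInf_sphCoeff_le (hW : ContinuousOn W (Icc (-1) 1)) (e : Sphere n) {k : ℕ} (hk : 1 ≤ k) :
    ⨅ k : ℕ+, sphCoeff n W k ≤ sphCoeff n W k :=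
  ciInf_le (bddBelow_sphCoeff hW e) (⟨k, hk⟩ : ℕ+)

theorem gammaSharp_pos (hW : ContinuousOn W (Icc (-1) 1)) (e : Sphere n)
    (h : ∃ k : ℕ, 1 ≤ k ∧ sphCoeff n W k < 0) : 0 < gammaSharp n W := by
  obtain ⟨k, hk, hk'⟩ := h
  exact div_pos_of_neg_of_neg (by norm_num) ((iInf_sphCoeff_le hW e hk).trans_lt hk')

theorem densEntropy_one_add_le {v : Sphere n → ℝ} (hv : Continuous v)
    (hv1 : ∀ x, -(7 / 8) < v x) :
    densEntropy (unif n) (fun x => 1 + v x) ≤ ∫ x, v x ∂(unif n) + 1 / 2 * ∫ x, v x ^ 2 ∂(unif n) -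
      1 / 6 * ∫ x, v x ^ 3 ∂(unif n) + 2 / 3 * ∫ x, v x ^ 4 ∂(unif n) := by
  have i : ∀ f : Sphere n → ℝ, Continuous f → Integrable f (unif n) := fun f hf =>
    integrable_unif_of_continuous hf
  rw [densEntropy, ← integral_const_mul, ← integral_const_mul, ← integral_const_mul,
    ← integral_add (i _ hv) (i _ (by fun_prop)), ← integral_sub (i _ (by fun_prop))
      (i _ (by fun_prop)), ← integral_add (i _ (by fun_prop)) (i _ (by fun_prop))]
  refine integral_mono (i _ ?_) (i _ (by fun_prop)) fun x => ?_
  · exact (by fun_prop : Continuous fun x => 1 + v x).mul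
      ((by fun_prop : Continuous fun x => 1 + v x).log fun x => by linarith [hv1 x])
  · have := mul_log_one_add_le (hv1 x)
    simp only
    linarith

theorem sign_mul_abs (t : ℝ) : Real.sign t * t = |t| := by
  rcases lt_trichotomy t 0 with h | rfl | h
  · rw [Real.sign_of_neg h, abs_of_neg h, neg_one_mul]
  · simp
  · rw [Real.sign_of_pos h, abs_of_pos h, one_mul]

theorem sign_sq {t : ℝ} (ht : t ≠ 0) : Real.sign t ^ 2 = 1 := by
  rcases Real.sign_apply_eq_of_ne_zero t ht with h | h <;> rw [h] <;> norm_num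

theorem competitorDensity_pos {e : Sphere n} {c : ℕ →₀ ℝ} {δ ε : ℝ} (h : IsResonantWith e W δ c)
    (hε0 : 0 < ε) (hε1 : ε < 1 / 2) (x : Sphere n) :
    |ε * Real.sign (cubeIntegral e c) * zonalComb e c x| ≤ ε ∧ 0 < competitorDensity e c ε x := by
  have h1 : |ε * Real.sign (cubeIntegral e c) * zonalComb e c x| ≤ ε := by
    have h2 : |Real.sign (cubeIntegral e c)| = 1 := by
      rcases Real.sign_apply_eq_of_ne_zero _ h.cube_ne_zero with h | h <;> rw [h] <;> norm_num
    rw [abs_mul, abs_mul, h2, mul_one, abs_of_pos hε0]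
    exact mul_le_of_le_one_right hε0.le (h.bounded x)
  refine ⟨h1, ?_⟩
  rw [competitorDensity]
  linarith [(abs_le.1 h1).1]

theorem isDensity_competitorDensity {e : Sphere n} {c : ℕ →₀ ℝ} {δ ε : ℝ}
    (h : IsResonantWith e W δ c) (hε0 : 0 < ε) (hε1 : ε < 1 / 2) :
    IsDensity (unif n) (competitorDensity e c ε) := by
  refine isDensity_of_continuous ?_ (fun x => (competitorDensity_pos h hε0 hε1 x).2) ?_
  · unfold competitorDensity
    fun_prop
  · unfold competitorDensity
    rw [integral_add (integrable_const 1) (integrable_unif_of_continuous (by fun_prop)),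
      integral_const_mul, integral_zonalComb e c fun l hl => (h.modes hl).1]
    simp

/-- With q = ∫ u² dm ≤ 1 and t = |U_3|/ω_n, γ_# times the excess is at most ε²δq/2 + 2ε⁴q/3 - ε³t/6.
The hypothesis `hε`, multiplied by ε, makes this negative. -/
theorem densEnergy_competitorDensity_lt (hW : ContinuousOn W (Icc (-1) 1)) {e : Sphere n}
    {c : ℕ →₀ ℝ} {δ ε : ℝ} (h : IsResonantWith e W δ c) (hε0 : 0 < ε) (hε1 : ε < 1 / 2)
    (hε : ε * (δ / 2 + 2 / 3 * ε ^ 2) < |cubeIntegral e c| / surfTotal n * ε ^ 2 / 6)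
    (hδ : 0 ≤ δ) :
    densEnergy (unif n) (sphKer W) (gammaSharp n W) (competitorDensity e c ε) <
      densEnergy (unif n) (sphKer W) (gammaSharp n W) fun _ => 1 := by
  set u := zonalComb e c with hu
  have huc : Continuous u := continuous_zonalComb e c
  have hγ : 0 < gammaSharp n W := gammaSharp_pos hW e h.unstable
  set γ := gammaSharp n W
  set ξ := Real.sign (cubeIntegral e c) with hξ
  have hξ2 : ξ ^ 2 = 1 := sign_sq h.cube_ne_zero
  rw [densEnergy_eq hW (isDensity_competitorDensity h hε0 hε1)]
  have hv : (fun x => competitorDensity e c ε x - 1) = fun x => 0 + (ε * ξ) * u x := by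
    ext x
    rw [competitorDensity]
    ring
  obtain ⟨B, _, hB⟩ := exists_abs_le_of_continuous (continuous_sphKer (n := n) hW)
  have hbil := bil_add_mul (m := unif n) (continuous_sphKer hW) (fun x y => hB (x, y))
    (sphKer_comm W) (f := fun _ => 0) (integrable_const 0) (integrable_unif_of_continuous huc)
    (ε * ξ)
  have hb0 : ∀ f : Sphere n → ℝ, bil (unif n) (sphKer W) f (fun _ => 0) = 0 := fun f => by
    simp [bil, pot]
  rw [hb0, hb0, mul_zero, zero_add, zero_add, mul_pow, hξ2, mul_one] at hbil
  rw [hv, hbil]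
  have hq : bil (unif n) (sphKer W) u u ≤ -(1 - δ) / γ * ∫ x, u x ^ 2 ∂(unif n) :=
    bil_zonalComb_le hW e c fun l hl => (h.modes hl).2
  have hent := densEntropy_one_add_le (v := fun x => ε * ξ * u x) (by fun_prop) fun x => by
    have := (abs_le.1 (competitorDensity_pos h hε0 hε1 x).1).1
    linarith
  have hcomp : (fun x => 1 + ε * ξ * u x) = competitorDensity e c ε := rfl
  simp only [mul_pow] at hent
  rw [hcomp, integral_const_mul, integral_const_mul, integral_const_mul, integral_const_mul,
    hu, integral_zonalComb e c fun l hl => (h.modes hl).1, ← hu] at hent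
  have hξ4 : ξ ^ 4 = 1 := by rw [show (4 : ℕ) = 2 * 2 from rfl, pow_mul, hξ2, one_pow]
  have hξ3 : ξ ^ 3 = ξ := by rw [pow_succ, hξ2, one_mul]
  rw [hξ2, hξ3, hξ4] at hent
  set q := ∫ x, u x ^ 2 ∂(unif n)
  have hcube : ξ * ∫ x, u x ^ 3 ∂(unif n) = |cubeIntegral e c| / surfTotal n := by
    rw [integral_unif, ← sign_mul_abs, ← hξ, div_eq_inv_mul, mul_left_comm]
    rfl
  have hu2 : ∀ x, u x ^ 2 ≤ 1 := fun x => by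
    have := h.bounded x
    rw [← sq_abs]
    exact pow_le_one₀ (abs_nonneg _) this
  have hq4 : ∫ x, u x ^ 4 ∂(unif n) ≤ q := by
    refine integral_mono (integrable_unif_of_continuous (by fun_prop))
      (integrable_unif_of_continuous (by fun_prop)) fun x => ?_
    simp only
    nlinarith [hu2 x, sq_nonneg (u x)]
  have hq1 : q ≤ 1 := by
    have : ∫ x, u x ^ 2 ∂(unif n) ≤ ∫ x, (1 : ℝ) ∂(unif n) :=
      integral_mono (integrable_unif_of_continuous (by fun_prop)) (integrable_const 1) hu2
    simpa using this
  have hq0 : 0 ≤ q := integral_nonneg fun x => sq_nonneg _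
  set t := |cubeIntegral e c| / surfTotal n
  have hent2 : densEntropy (unif n) (competitorDensity e c ε) ≤
      ε ^ 2 / 2 * q - ε ^ 3 / 6 * t + 2 / 3 * ε ^ 4 * q := by
    have h4 : ε ^ 4 * ∫ x, u x ^ 4 ∂(unif n) ≤ ε ^ 4 * q :=
      mul_le_mul_of_nonneg_left hq4 (by positivity)
    rw [← hcube]
    linarith
  have hneg : ε ^ 2 / 2 * q - ε ^ 3 / 6 * t + 2 / 3 * ε ^ 4 * q - 1 / 2 * (ε ^ 2 * ((1 - δ) * q))
      < 0 := by
    have h5 : ε * (ε * (δ / 2 + 2 / 3 * ε ^ 2)) * q ≤ ε * (ε * (δ / 2 + 2 / 3 * ε ^ 2)) :=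
      mul_le_of_le_one_right (by positivity) hq1
    have h6 := mul_lt_mul_of_pos_left hε hε0
    nlinarith
  have h7 : γ⁻¹ * densEntropy (unif n) (competitorDensity e c ε) +
      1 / 2 * (ε ^ 2 * bil (unif n) (sphKer W) u u) ≤
      γ⁻¹ * (ε ^ 2 / 2 * q - ε ^ 3 / 6 * t + 2 / 3 * ε ^ 4 * q -
        1 / 2 * (ε ^ 2 * ((1 - δ) * q))) := by
    have h8 := mul_le_mul_of_nonneg_left hent2 (inv_nonneg.2 hγ.le)
    have h9 := mul_le_mul_of_nonneg_left hq (sq_nonneg ε)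
    have h10 : ε ^ 2 * (-(1 - δ) / γ * q) = -(γ⁻¹ * (ε ^ 2 * ((1 - δ) * q))) := by ring
    rw [h10] at h9
    linarith
  have h11 := mul_neg_of_pos_of_neg (inv_pos.2 hγ) hneg
  linarith

/-- For ε = √δ the bracket is δ/2 + 2δ/3 = 7δ/6, so the condition is 7√δ < |U_3|/ω_n, whence the 49;
δ < 1/4 gives ε < 1/2. For δ = 0 only 2ε³/3 must be beaten, whence the 4. -/
theorem resonance_parameter {e : Sphere n} {c : ℕ →₀ ℝ} {δ ε : ℝ} (h : IsResonantWith e W δ c)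
    (hε : (0 < δ ∧ ε = Real.sqrt δ) ∨
      (δ = 0 ∧ 0 < ε ∧ ε < min (1 / 2) (|cubeIntegral e c| / (4 * surfTotal n)))) :
    0 < ε ∧ ε < 1 / 2 ∧
      ε * (δ / 2 + 2 / 3 * ε ^ 2) < |cubeIntegral e c| / surfTotal n * ε ^ 2 / 6 := by
  have hω : 0 < surfTotal n := surfTotal_pos
  have hb := lt_min_iff.1 h.bandwidth
  rcases hε with ⟨hδ, rfl⟩ | ⟨rfl, hε0, hε1⟩
  · have hs : 0 < Real.sqrt δ := Real.sqrt_pos.2 hδ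
    have hs2 : Real.sqrt δ ^ 2 = δ := Real.sq_sqrt hδ.le
    have h1 : Real.sqrt δ < 1 / 2 := by
      rw [Real.sqrt_lt' (by norm_num)]
      linarith [hb.1]
    have h2 : Real.sqrt δ < |cubeIntegral e c| / surfTotal n / 7 := by
      have : 0 < |cubeIntegral e c| := abs_pos.2 h.cube_ne_zero
      rw [Real.sqrt_lt' (by positivity)]
      have e1 : (|cubeIntegral e c| / surfTotal n / 7) ^ 2 =
          cubeIntegral e c ^ 2 / (49 * surfTotal n ^ 2) := by
        rw [div_pow, div_pow, sq_abs]
        field_simp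
        norm_num
      rw [e1]
      exact hb.2
    refine ⟨hs, h1, ?_⟩
    rw [hs2]
    have := mul_lt_mul_of_pos_right h2 hδ
    linarith
  · obtain ⟨h1, h2⟩ := lt_min_iff.1 hε1
    refine ⟨hε0, h1, ?_⟩
    have h3 : ε < |cubeIntegral e c| / surfTotal n / 4 := by
      rwa [div_div, mul_comm (surfTotal n)]
    have := mul_lt_mul_of_pos_right h3 (pow_pos hε0 2)
    linarith

end Competitor

/-! ### The transition point and its discontinuity -/

section Transition

variable {n : ℕ} [Fact (3 ≤ n)] {W : ℝ → ℝ} {γ : ℝ}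

/-- Half the interaction energy of the deviation of `ρ` from the uniform state. -/
noncomputable def excess (W : ℝ → ℝ) (ρ : Sphere n → ℝ) : ℝ :=
  1 / 2 * bil (unif n) (sphKer W) (fun x => ρ x - 1) fun x => ρ x - 1

/-- The parameters at which the uniform state is not a minimizer. -/
def unstableSet (n : ℕ) [Fact (3 ≤ n)] (W : ℝ → ℝ) : Set ℝ :=
  {γ | 0 < γ ∧ ∃ ρ : Sphere n → ℝ, IsDensity (unif n) ρ ∧
    densEntropy (unif n) ρ + γ * excess W ρ < 0}

theorem densEnergy_le_iff (hW : ContinuousOn W (Icc (-1) 1)) (hγ : 0 < γ) {ρ : Sphere n → ℝ}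
    (hρ : IsDensity (unif n) ρ) :
    densEnergy (unif n) (sphKer W) γ (fun _ => 1) ≤ densEnergy (unif n) (sphKer W) γ ρ ↔
      0 ≤ densEntropy (unif n) ρ + γ * excess W ρ := by
  have e : densEntropy (unif n) ρ + γ * excess W ρ =
      γ * (γ⁻¹ * densEntropy (unif n) ρ + excess W ρ) := by
    field_simp
  rw [densEnergy_eq hW hρ, le_add_iff_nonneg_right, e, mul_nonneg_iff_of_pos_left hγ, excess]

theorem densEntropy_nonneg {ρ : Sphere n → ℝ} (hρ : IsDensity (unif n) ρ) :
    0 ≤ densEntropy (unif n) ρ := by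
  have := sq_integral_abs_sub_one_le hρ
  nlinarith [sq_nonneg (∫ x, |ρ x - 1| ∂(unif n))]

theorem ae_eq_one_of_densEntropy_nonpos {ρ : Sphere n → ℝ} (hρ : IsDensity (unif n) ρ)
    (h : densEntropy (unif n) ρ ≤ 0) : ρ =ᵐ[unif n] fun _ => 1 := by
  have h2 := sq_integral_abs_sub_one_le hρ
  have h3 : ∫ x, |ρ x - 1| ∂(unif n) = 0 :=
    pow_eq_zero_iff (two_ne_zero) |>.1 (le_antisymm (by linarith) (sq_nonneg _))
  have hi : Integrable (fun x => ρ x - 1) (unif n) := hρ.integrable.sub (integrable_const 1)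
  rw [integral_eq_zero_iff_of_nonneg (fun x => abs_nonneg _) hi.abs] at h3
  filter_upwards [h3] with x hx
  exact sub_eq_zero.1 (abs_eq_zero.1 hx)

/-- The entropy is nonnegative, so a density that beats the uniform state has negative `excess`, and
a larger γ only helps. -/
theorem mem_unstableSet_of_lt {γ' : ℝ} (h : γ ∈ unstableSet n W) (hlt : γ < γ') :
    γ' ∈ unstableSet n W := by
  obtain ⟨hγ, ρ, hρ, h1⟩ := h
  refine ⟨hγ.trans hlt, ρ, hρ, ?_⟩
  have h2 := densEntropy_nonneg hρ
  have h3 : excess W ρ < 0 := by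
    by_contra h
    have := mul_nonneg hγ.le (not_lt.1 h)
    linarith
  nlinarith

theorem exists_lt_mem_unstableSet (h : γ ∈ unstableSet n W) :
    ∃ γ' < γ, γ' ∈ unstableSet n W := by
  obtain ⟨hγ, ρ, hρ, h1⟩ := h
  have h2 := densEntropy_nonneg hρ
  have hc : ContinuousAt (fun s : ℝ => densEntropy (unif n) ρ + s * excess W ρ) γ := by fun_prop
  have hev : ∀ᶠ s in 𝓝[<] γ, densEntropy (unif n) ρ + s * excess W ρ < 0 ∧ 0 < s :=
    ((hc.eventually (gt_mem_nhds h1)).and (lt_mem_nhds hγ)).filter_mono nhdsWithin_le_nhds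
  obtain ⟨s, ⟨h3, h4⟩, h5⟩ := (hev.and self_mem_nhdsWithin).exists
  exact ⟨s, h5, h4, ρ, hρ, h3⟩

/-- By Csiszár-Kullback the squared L¹ distance is at most four times the entropy, so `excess` is at
least -2B times the entropy and cannot win while 2Bγ ≤ 1. -/
theorem exists_pos_le_unstableSet (hW : ContinuousOn W (Icc (-1) 1)) :
    ∃ b : ℝ, 0 < b ∧ ∀ γ ∈ unstableSet n W, b ≤ γ := by
  obtain ⟨B, hB0, hB⟩ := exists_abs_le_of_continuous (continuous_sphKer (n := n) hW)
  refine ⟨1 / (2 * (B + 1)), by positivity, ?_⟩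
  rintro γ ⟨hγ, ρ, hρ, h1⟩
  have hi : Integrable (fun x => ρ x - 1) (unif n) := hρ.integrable.sub (integrable_const 1)
  have h2 := (abs_le.1 (abs_bil_le (fun x y => hB (x, y)) hi hi)).1
  have h3 := sq_integral_abs_sub_one_le hρ
  have h0 := densEntropy_nonneg hρ
  rw [mul_assoc, ← sq] at h2
  have h4 : -(2 * B * densEntropy (unif n) ρ) ≤ excess W ρ := by
    rw [excess]
    have := mul_le_mul_of_nonneg_left h3 hB0
    linarith
  have h5 := mul_le_mul_of_nonneg_left h4 hγ.le
  by_contra hlt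
  rw [not_le, lt_div_iff₀ (by positivity)] at hlt
  have h6 : 0 ≤ densEntropy (unif n) ρ * (1 - γ * (2 * B)) :=
    mul_nonneg h0 (by linarith)
  linarith

theorem isMinimizer_unif (hW : ContinuousOn W (Icc (-1) 1)) (hγ : 0 < γ)
    (h : γ ∉ unstableSet n W) : IsMinimizer W γ (unif n) := by
  rw [← ofDensity_one, isMinimizer_ofDensity_iff hW hγ isDensity_one]
  intro ρ hρ
  rw [densEnergy_le_iff hW hγ hρ]
  by_contra hlt
  exact h ⟨hγ, ρ, hρ, not_le.1 hlt⟩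

/-- For a minimizer at γ the affine function of the parameter is at most 0 at γ and at least 0 at γ'
> γ. Its slope is then nonnegative, so the entropy is at most 0 and the density is 1. -/
theorem uniformIsUniqueMinimizer_of_lt (hW : ContinuousOn W (Icc (-1) 1)) (hγ : 0 < γ) {γ' : ℝ}
    (hlt : γ < γ') (h : γ' ∉ unstableSet n W) : UniformIsUniqueMinimizer n W γ := by
  have hγn : γ ∉ unstableSet n W := fun h' => h (mem_unstableSet_of_lt h' hlt)
  refine ⟨isMinimizer_unif hW hγ hγn, fun μ hμ => ?_⟩
  obtain ⟨ρ, hρ, rfl⟩ := hμ.exists_density hW hγ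
  rw [isMinimizer_ofDensity_iff hW hγ hρ] at hμ
  have h1 := hμ _ isDensity_one
  have h2 : densEntropy (unif n) ρ + γ * excess W ρ ≤ 0 := by
    by_contra hc
    have e : densEntropy (unif n) ρ + γ * excess W ρ =
        γ * (γ⁻¹ * densEntropy (unif n) ρ + excess W ρ) := by
      field_simp
    rw [densEnergy_eq hW hρ, add_le_iff_nonpos_right, ← excess] at h1
    rw [e] at hc
    exact hc (mul_nonpos_of_nonneg_of_nonpos hγ.le h1)
  have h3 : 0 ≤ densEntropy (unif n) ρ + γ' * excess W ρ := by
    by_contra hlt'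
    exact h ⟨hγ.trans hlt, ρ, hρ, not_le.1 hlt'⟩
  have h4 : 0 ≤ excess W ρ := by
    by_contra hneg
    nlinarith [not_le.1 hneg]
  rw [← ofDensity_one]
  refine ofDensity_congr (ae_eq_one_of_densEntropy_nonpos hρ ?_)
  have := mul_nonneg hγ.le h4
  linarith

theorem exists_nonuniform_minimizer (hW : ContinuousOn W (Icc (-1) 1))
    (h : γ ∈ unstableSet n W) : ∃ μ : Measure (Sphere n),
      μ ≪ unif n ∧ (∀ᵐ x ∂(unif n), 0 < μ.rnDeriv (unif n) x) ∧ μ ≠ unif n ∧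
        IsMinimizer W γ μ := by
  obtain ⟨hγ, ρ, hρ, h1⟩ := h
  obtain ⟨B, hB0, hB⟩ := exists_abs_le_of_continuous (continuous_sphKer (n := n) hW)
  obtain ⟨g, hg, -, -, hmin⟩ := exists_minimizer (m := unif n) (continuous_sphKer hW)
    (fun x y => hB (x, y)) (sphKer_comm W) hγ
  refine ⟨ofDensity g, ofDensity_absolutelyContinuous, rnDeriv_ofDensity_pos hg, fun heq => ?_,
    (isMinimizer_ofDensity_iff hW hγ hg).2 hmin⟩
  have h2 := (isMinimizer_ofDensity_iff hW hγ hg).2 hmin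
  rw [heq, ← ofDensity_one, isMinimizer_ofDensity_iff hW hγ isDensity_one] at h2
  exact absurd ((densEnergy_le_iff hW hγ hρ).1 (h2 ρ hρ)) (not_le.2 h1)

/-- The infimum is not itself unstable, because a strict inequality would persist slightly below it.
-/
theorem isTransitionPoint_sInf (hW : ContinuousOn W (Icc (-1) 1))
    (hne : (unstableSet n W).Nonempty) : IsTransitionPoint n W (sInf (unstableSet n W)) := by
  obtain ⟨b, hb, hb'⟩ := exists_pos_le_unstableSet (n := n) hW
  have hbdd : BddBelow (unstableSet n W) := ⟨b, hb'⟩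
  have hpos : 0 < sInf (unstableSet n W) := hb.trans_le (le_csInf hne hb')
  have hnot : sInf (unstableSet n W) ∉ unstableSet n W := fun h => by
    obtain ⟨s, hs, hs'⟩ := exists_lt_mem_unstableSet h
    exact absurd (csInf_le hbdd hs') (not_le.2 hs)
  refine ⟨hpos, fun γ hγ hlt => uniformIsUniqueMinimizer_of_lt hW hγ hlt hnot,
    isMinimizer_unif hW hpos hnot, fun γ hγ => ?_⟩
  obtain ⟨a, ha, ha'⟩ := exists_lt_of_csInf_lt hne hγ
  exact exists_nonuniform_minimizer hW (mem_unstableSet_of_lt ha ha')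

theorem le_excess (hW : ContinuousOn W (Icc (-1) 1)) (e : Sphere n) {lam : ℝ} (hlam : lam ≤ 0)
    (hp : ∀ k, 1 ≤ k → lam ≤ sphCoeff n W k) {g : Sphere n → ℝ} (hg : IsDensity (unif n) g)
    (hc : Continuous g) : 1 / 2 * (lam * ∫ x, (g x - 1) ^ 2 ∂(unif n)) ≤ excess W g := by
  have h0 : ∫ x, (g x - 1) ∂(unif n) = 0 := by
    rw [integral_sub hg.integrable (integrable_const 1), hg.integral_eq_one]
    simp
  have h := le_integral_kernel hW hlam (v := fun x => g x - 1) (by fun_prop) h0 hp e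
  rw [excess]
  exact mul_le_mul_of_nonneg_left h (by norm_num)

/-- The linear term integrates to zero and the cubic term of the Taylor bound is at most η times the
square. -/
theorem le_densEntropy_of_near_one {g : Sphere n → ℝ} (hg : IsDensity (unif n) g)
    (hc : Continuous g) (hpos : ∀ x, 0 < g x) {η : ℝ} (hη : ∀ x, |g x - 1| ≤ η) :
    1 / 2 * ((1 - η / 3) * ∫ x, (g x - 1) ^ 2 ∂(unif n)) ≤ densEntropy (unif n) g := by
  have h0 : ∫ x, (g x - 1) ∂(unif n) = 0 := by
    rw [integral_sub hg.integrable (integrable_const 1), hg.integral_eq_one]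
    simp
  have h1 : 1 / 2 * ((1 - η / 3) * ∫ x, (g x - 1) ^ 2 ∂(unif n)) =
      ∫ x, ((g x - 1) + 1 / 2 * ((1 - η / 3) * (g x - 1) ^ 2)) ∂(unif n) := by
    rw [integral_add (integrable_unif_of_continuous (by fun_prop))
      (integrable_unif_of_continuous (by fun_prop)), h0, integral_const_mul, integral_const_mul,
      zero_add]
  rw [h1, densEntropy]
  refine integral_mono (integrable_unif_of_continuous (by fun_prop)) hg.integrable_entropy
    fun x => ?_
  have h2 := le_mul_log_one_add (v := g x - 1) (by linarith [hpos x])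
  rw [add_sub_cancel] at h2
  have h3 : (g x - 1) ^ 3 ≤ η * (g x - 1) ^ 2 := by
    rw [pow_succ']
    exact mul_le_mul_of_nonneg_right ((le_abs_self _).trans (hη x)) (sq_nonneg _)
  simp only
  linarith

/-- A minimizer that is close in `L¹` to the uniform state is, below the point of linear
stability, the uniform state. -/
theorem minimizer_eq_unif_of_near (hW : ContinuousOn W (Icc (-1) 1)) (e : Sphere n) {lam B : ℝ}
    (hB : ∀ x y : Sphere n, |sphKer W x y| ≤ B) (hlam : lam ≤ 0)
    (hp : ∀ k, 1 ≤ k → lam ≤ sphCoeff n W k) (hγ : 0 < γ) {μ : Measure (Sphere n)}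
    (hμ : IsMinimizer W γ μ)
    (hnear : 0 < 1 - (Real.exp (2 * γ * (B * l1DistUnif μ)) - 1) / 3 + γ * lam) :
    μ = unif n := by
  obtain ⟨ρ, hρ, rfl⟩ := hμ.exists_density hW hγ
  have hK := continuous_sphKer (n := n) hW
  have hmin := (isMinimizer_ofDensity_iff hW hγ hρ).1 hμ
  have hae := ae_eq_gibbs_of_minimizer hK hB (sphKer_comm W) hγ hρ hmin
  have hV := continuous_pot hK hB hρ.integrable
  set g := gibbs (unif n) γ (pot (unif n) (sphKer W) ρ) with hg'
  have hg : IsDensity (unif n) g := isDensity_gibbs hV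
  have hgc : Continuous g := continuous_gibbs hV
  set N := l1DistUnif (ofDensity ρ) with hN'
  have hN : N = ∫ x, |ρ x - 1| ∂(unif n) := by
    rw [hN', l1DistUnif]
    refine integral_congr_ae ?_
    filter_upwards [toReal_rnDeriv_ofDensity hρ] with x hx
    rw [hx]
  -- Only the deviation ρ - 1 moves the potential from its constant value. The Gibbs form of the
  -- minimizer thus turns L¹ closeness into uniform closeness to 1.
  have hpot : ∀ x, |pot (unif n) (sphKer W) ρ x - sphCoeff n W 0| ≤ B * N := by
    intro x
    have hi : Integrable (fun x => ρ x - 1) (unif n) := hρ.integrable.sub (integrable_const 1)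
    have h1 := abs_pot_le (m := unif n) hB hi x
    rw [← hN] at h1
    have hWi : Integrable (fun y => W (sdot x y)) (unif n) :=
      integrable_unif_of_continuous (continuous_comp_sdot hW continuous_const continuous_id)
    have h2 : pot (unif n) (sphKer W) ρ x - sphCoeff n W 0 =
        pot (unif n) (sphKer W) (fun y => ρ y - 1) x := by
      rw [← integral_kernel hW x, pot, pot,
        ← integral_sub (integrable_kernel_mul hK hρ.integrable x) hWi]
      congr 1 with y
      rw [sphKer]
      ring
    rwa [h2]
  have hnear1 : ∀ x, |g x - 1| ≤ Real.exp (2 * γ * (B * N)) - 1 := by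
    intro x
    have := abs_gibbs_sub_le (m := unif n) hγ.le continuous_const hV hpot x
    rwa [gibbs_const, mul_one] at this
  have hE := le_densEntropy_of_near_one hg hgc (gibbs_pos hV) hnear1
  have hD := le_excess hW e hlam hp hg hgc
  have hμg : ofDensity ρ = ofDensity g := ofDensity_congr hae
  rw [hμg, isMinimizer_ofDensity_iff hW hγ hg] at hμ
  have h1 := hμ _ isDensity_one
  rw [densEnergy_eq hW hg, add_le_iff_nonpos_right, ← excess] at h1
  have h2 : densEntropy (unif n) g + γ * excess W g ≤ 0 := by
    have e : densEntropy (unif n) g + γ * excess W g =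
        γ * (γ⁻¹ * densEntropy (unif n) g + excess W g) := by
      field_simp
    rw [e]
    exact mul_nonpos_of_nonneg_of_nonpos hγ.le h1
  have hD' := mul_le_mul_of_nonneg_left hD hγ.le
  set q := ∫ x, (g x - 1) ^ 2 ∂(unif n) with hq
  have hq0 : 0 ≤ q := integral_nonneg fun x => sq_nonneg _
  -- Entropy and interaction together bound the second variation from below by a positive multiple
  -- of q, while minimality makes the sum at most 0; hence q = 0.
  have h3 : (1 - (Real.exp (2 * γ * (B * N)) - 1) / 3 + γ * lam) * q ≤ 0 := by linarith
  have h4 : q = 0 := by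
    refine le_antisymm ?_ hq0
    by_contra hlt
    exact absurd (mul_pos hnear (not_le.1 hlt)) (not_lt.2 h3)
  have hi : Integrable (fun x => (g x - 1) ^ 2) (unif n) :=
    integrable_unif_of_continuous ((hgc.sub continuous_const).pow 2)
  rw [hq, integral_eq_zero_iff_of_nonneg (fun x => sq_nonneg _) hi] at h4
  rw [hμg, ← ofDensity_one]
  refine ofDensity_congr ?_
  filter_upwards [h4] with x hx
  exact sub_eq_zero.1 (pow_eq_zero_iff (two_ne_zero) |>.1 hx)

theorem not_isContinuousTransition (hW : ContinuousOn W (Icc (-1) 1)) (e : Sphere n)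
    (hneg : ∃ k : ℕ, 1 ≤ k ∧ sphCoeff n W k < 0) {γc : ℝ} (hlt : γc < gammaSharp n W) :
    ¬ IsContinuousTransition n W γc := by
  rintro ⟨htr, -, hcont⟩
  classical
  have hex : ∀ γ : ℝ, ∃ μ : Measure (Sphere n), γc < γ →
      μ ≪ unif n ∧ μ ≠ unif n ∧ IsMinimizer W γ μ := by
    intro γ
    by_cases hγ : γc < γ
    · obtain ⟨μ, h1, -, h2, h3⟩ := htr.nonuniform_above γ hγ
      exact ⟨μ, fun _ => ⟨h1, h2, h3⟩⟩
    -- The zero measure is a default value at γ ≤ γc, where nothing is claimed.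
    · exact ⟨0, fun h => absurd h hγ⟩
  choose μ hμ using hex
  have hlim := hcont μ fun γ hγ => ⟨(hμ γ hγ).1, (hμ γ hγ).2.2⟩
  obtain ⟨B, hB0, hB⟩ := exists_abs_le_of_continuous (continuous_sphKer (n := n) hW)
  set lam := ⨅ k : ℕ+, sphCoeff n W k with hlam'
  have hp : ∀ k, 1 ≤ k → lam ≤ sphCoeff n W k := fun k hk => iInf_sphCoeff_le hW e hk
  have hlam : lam < 0 := by
    obtain ⟨k, hk, hk'⟩ := hneg
    exact (hp k hk).trans_lt hk'
  -- γc < γ_# = -1/`lam` keeps the second variation positive at γc. If the L¹ distance tended to 0,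
  -- the condition of `minimizer_eq_unif_of_near` would hold for some γ > γc, against nonuniformity.
  have hgap : 0 < 1 + γc * lam := by
    rw [gammaSharp, ← hlam', lt_div_iff_of_neg hlam] at hlt
    linarith
  have hid : Tendsto (fun γ : ℝ => γ) (𝓝[>] γc) (𝓝 γc) := tendsto_id.mono_left nhdsWithin_le_nhds
  have hexp : Tendsto (fun γ => 1 - (Real.exp (2 * γ * (B * l1DistUnif (μ γ))) - 1) / 3 + γ * lam)
      (𝓝[>] γc) (𝓝 (1 + γc * lam)) := by
    have h1 : Tendsto (fun γ => Real.exp (2 * γ * (B * l1DistUnif (μ γ)))) (𝓝[>] γc) (𝓝 1) := by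
      have := (Real.continuous_exp.tendsto _).comp ((hid.const_mul 2).mul (hlim.const_mul B))
      rw [mul_zero, mul_zero, Real.exp_zero] at this
      exact this
    have := (((h1.sub_const 1).div_const 3).const_sub 1).add (hid.mul_const lam)
    simpa using this
  obtain ⟨γ, h1, h2⟩ := ((hexp.eventually (lt_mem_nhds hgap)).and self_mem_nhdsWithin).exists
  have hγ : γc < γ := h2
  exact (hμ γ hγ).2.1 (minimizer_eq_unif_of_near hW e (fun x y => hB (x, y)) hlam.le hp
    (htr.pos.trans hγ) (hμ γ hγ).2.2 h1)

end Transition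

end SphereMV

open SphereMV
theorem mainTheorem2 (n : ℕ) (hn : 3 ≤ n) (e : Sphere n) (W : ℝ → ℝ)
    (hW : ContinuousOn W (Icc (-1) 1)) (δ : ℝ) (hδ : 0 ≤ δ) :
    (RelaxedResonance e W δ →
      ∃ γc : ℝ, 0 < γc ∧ γc < gammaSharp n W ∧ IsDiscontinuousTransition n W γc) ∧
    (∀ c : ℕ →₀ ℝ, IsResonantWith e W δ c →
      ∀ ε : ℝ,
        ((0 < δ ∧ ε = Real.sqrt δ) ∨
          (δ = 0 ∧ 0 < ε ∧ ε < min (1 / 2) (|cubeIntegral e c| / (4 * surfTotal n)))) →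
        (∀ x : Sphere n, 0 < competitorDensity e c ε x) ∧
        IsProbabilityMeasure (competitor e c ε) ∧
        freeEnergy W (gammaSharp n W) (competitor e c ε) <
          freeEnergy W (gammaSharp n W) (unif n)) := by
  have : Fact (3 ≤ n) := ⟨hn⟩
  constructor
  · rintro ⟨c, hc⟩
    obtain ⟨ε, hε⟩ : ∃ ε : ℝ, (0 < δ ∧ ε = Real.sqrt δ) ∨
        (δ = 0 ∧ 0 < ε ∧ ε < min (1 / 2) (|cubeIntegral e c| / (4 * surfTotal n))) := by
      rcases hδ.eq_or_lt with h | h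
      · have h1 : 0 < |cubeIntegral e c| := abs_pos.2 hc.cube_ne_zero
        have h2 : 0 < surfTotal n := surfTotal_pos
        obtain ⟨ε, h3, h4⟩ := exists_between (show (0 : ℝ) <
          min (1 / 2) (|cubeIntegral e c| / (4 * surfTotal n)) from
            lt_min (by norm_num) (by positivity))
        exact ⟨ε, Or.inr ⟨h.symm, h3, h4⟩⟩
      · exact ⟨_, Or.inl ⟨h, rfl⟩⟩
    obtain ⟨h0, h1, h2⟩ := resonance_parameter hc hε
    have hlt := densEnergy_competitorDensity_lt hW hc h0 h1 h2 hδ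
    have hγ : 0 < gammaSharp n W := gammaSharp_pos hW e hc.unstable
    have hd := isDensity_competitorDensity hc h0 h1
    have hmem : gammaSharp n W ∈ unstableSet n W :=
      ⟨hγ, _, hd, not_le.1 fun h => absurd ((densEnergy_le_iff hW hγ hd).2 h) (not_le.2 hlt)⟩
    have htr := isTransitionPoint_sInf hW ⟨_, hmem⟩
    -- The unstable set has no least element, so its infimum is strictly below γ_#.
    obtain ⟨s, hs, hs'⟩ := exists_lt_mem_unstableSet hmem
    obtain ⟨b, -, hb⟩ := exists_pos_le_unstableSet (n := n) hW
    have hlt' : sInf (unstableSet n W) < gammaSharp n W := (csInf_le ⟨b, hb⟩ hs').trans_lt hs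
    exact ⟨_, htr.pos, hlt', htr, not_isContinuousTransition hW e hc.unstable hlt'⟩
  · intro c hc ε hε
    obtain ⟨h0, h1, h2⟩ := resonance_parameter hc hε
    have hd := isDensity_competitorDensity hc h0 h1
    refine ⟨fun x => (competitorDensity_pos hc h0 h1 x).2, isProbabilityMeasure_ofDensity hd, ?_⟩
    have hlt := densEnergy_competitorDensity_lt hW hc h0 h1 h2 hδ
    rw [← ofDensity_one, freeEnergy_ofDensity hW isDensity_one]
    change freeEnergy W (gammaSharp n W) (ofDensity (competitorDensity e c ε)) < _
    rw [freeEnergy_ofDensity hW hd]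
    exact EReal.coe_lt_coe_iff.2 hlt
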